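/- **Undeformed theory.** Equip $\mathbb R^4$ with $\eta=\mathrm{diag}(1,-1,-1,-1)$, $x\cdot y=(x,\eta y)$, and put $p\theta q:=(p,\eta\theta\eta q)$ for real antisymmetric $4\times4$ matrices $\theta$. Write $\mathscr S_K^n=\mathscr S(\mathbb R^{4n})^{\oplus K^n}$, $\mathscr S_K=\mathscr S^1_K$, $\tilde f(p)=(2\pi)^{-2n}\int f(x)\,e^{-i\sum_j p_j\cdot x_j}\,dx$ for $f\in\mathscr S^n_K$, and let $\underline{\mathscr S}=\bigoplus_{n\ge0}\mathscr S^n_K$ be the Borchers–Uhlmann algebra. Let $\phi_1,\dots,\phi_K$ be the components of quantum fields on Minkowski space in a vacuum representation: a Hilbert space $\mathcal H$; a strongly continuous unitary representation $U$ of the translation group $\mathbb R^4$; a $U$-invariant unit vector $\Omega$; continuous linear maps $\Psi^n:\mathscr S^n_K\to\mathcal H$ whose ranges span a dense, $U$-invariant domain $\mathcal D\ni\Omega$; and operators $\phi(f):\mathcal D\to\mathcal D$, linear in $f\in\mathscr S_K$, with $\Psi^n(f_1\otimes\cdots\otimes f_n)=\phi(f_1)\cdots\phi(f_n)\Omega$,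 $\phi(f)^*\supset\phi(f^*)$, where $f^*(x)_k=\overline{f(x)_{\bar k}}$ for an involution $k\mapsto\bar k$ of the indices, and $U(y)\phi(f)U(y)^{-1}=\phi(f(\cdot-y))$. Put $\Psi(g)=\sum_n\Psi^n(g^n)$ for $g\in\underline{\mathscr S}$, and $\omega_n(f^n)=\langle\Omega,\Psi^n(f^n)\rangle$. (Every Wightman theory is of this form.) **Noncommutative Minkowski space.** Let $\kappa_e,\kappa_m\in\mathbb R$, not both zero, let $\theta_1$ be the antisymmetric matrix with $(\theta_1)_{01}=\kappa_e$, $(\theta_1)_{23}=\kappa_m$ and all other entries above the diagonal zero, and let $\Sigma\ni\theta_1$ be the set of real antisymmetric $4\times4$ matrices $\theta=(\theta^{\mu\nu})$ with $\theta_{\mu\nu}\theta^{\mu\nu}=2(\kappa_m^2-\kappa_e^2)$ and $\varepsilon_{\mu\nu\alpha\beta}\theta^{\mu\nu}\theta^{\alpha\beta}=-8\kappa_e\kappa_m$ ($\varepsilon_{0123}=-1$), with the measure $\sigma$ induced on $\Sigma\subset\mathbb R^{16}$ by the Euclidean metric. For $\theta\in\Sigma$ let $\Lambda_\theta$ be a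 proper orthochronous Lorentz transformation with $\Lambda_\theta\theta_1\Lambda_\theta^T=\theta$, chosen measurably and locally boundedly in $\theta$. On functions of $s\in\mathbb R^2$ let $\hat x=(s_1,-i\kappa_e\partial_{s_1},s_2,-i\kappa_m\partial_{s_2})$, and on functions of $(s,\theta)\in\mathbb R^2\times\Sigma$ let $X=\Lambda_\theta\hat x$, with its Weyl operators $e^{ip\cdot X}$. **Deformed fields.** For functions $\boldsymbol g:(s,\theta)\mapsto\boldsymbol g_{s,\theta}\in\underline{\mathscr S}$ and $f\in\mathscr S_K$ define $f\times\boldsymbol g$ by $\widetilde{(f\times\boldsymbol g)}{}^{n+1}_{s,\theta}(p,q)_{k\boldsymbol l}=\tilde f(p)_k\,(e^{ip\cdot X}\tilde{\boldsymbol g}^n)_{s,\theta}(q)_{\boldsymbol l}$. Let $\underline{\mathscr S}^\otimes$ be the smallest space of such functions that contains $C_0^\infty(\mathbb R^2\times\Sigma)\otimes\underline{\mathscr S}$ and is stable under all maps $\boldsymbol g\mapsto f\times\boldsymbol g$; put $\Psi^\otimes(\boldsymbol g)(s,\theta)=\Psi(\boldsymbol g_{s,\theta})$. Let $\mathcal D^\otimes=\Psi^\otimes(\underline{\mathscr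 S}^\otimes)\subset L^2(\mathbb R^2\times\Sigma\to\mathcal H,\,d^2s\times d\sigma)$, let $\phi^\otimes(f)\Psi^\otimes(\boldsymbol g)=\Psi^\otimes(f\times\boldsymbol g)$ be the Weyl–Wigner deformed fields on $\mathcal D^\otimes$, and let $\mathcal P^\otimes$ be the algebra of all polynomials in them. For $\theta\in\Sigma$ let $\omega^\theta$ be the linear functional on $\mathcal P^\otimes$ whose value on $\phi^\otimes(f_1)\cdots\phi^\otimes(f_n)$ is $\omega_n$ evaluated on the test function with Fourier transform $\prod_j\tilde f_j(p_j)_{k_j}\prod_{l<r}e^{-\frac i2p_l\theta p_r}$. Let $\otimes_\theta$ be the Moyal tensor product, the bilinear product on $\underline{\mathscr S}$ with $$\widetilde{(f^n\otimes_\theta g^m)}(p,q)_{\boldsymbol k\boldsymbol t}=\prod_{l=1}^n\prod_{r=1}^m e^{-\frac i2p_l\theta q_r}\;\tilde f^n(p)_{\boldsymbol k}\,\tilde g^m(q)_{\boldsymbol t}.$$ GNS data of a state on a $*$-algebra of operators means a $*$-representation $\pi$ on a dense invariant domain of a Hilbert space together with a vector in that domain which implements the state and is strongly cyclic (its orbit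 is dense in the domain in the graph topology of $\pi$). Two such data are unitarily equivalent if a unitary maps one implementing vector to the other and carries the closure (in the graph topology) of one representation, with its domain, onto the closure of the other. **Theorem.** The functions $\Psi^\otimes(\boldsymbol g)$, $\boldsymbol g\in\underline{\mathscr S}^\otimes$, are square integrable; the $\phi^\otimes(f)$ are well-defined linear operators on $\mathcal D^\otimes$ with $\phi^\otimes(f)^*\supset\phi^\otimes(f^*)$; and $\mathcal P^\otimes$ is a $*$-algebra. For every $\theta\in\Sigma$, $\omega^\theta$ is well defined and is a state on $\mathcal P^\otimes$. Up to unitary equivalence, the GNS data of $(\mathcal P^\otimes,\omega^\theta)$ are given by the Hilbert space $\mathcal H$, the domain $\mathcal D$, the vacuum vector $\Omega$ and the representation $\pi^\theta$ of $\mathcal P^\otimes$ on $\mathcal D$ with $$\pi^\theta(\phi^\otimes(f))\,\Psi(g)=\Psi(f\otimes_\theta g),\qquad f\in\mathscr S_K,\ g\in\underline{\mathscr S}.$$ -/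

import Mathlib

open MeasureTheory SchwartzMap
open scoped InnerProductSpace SchwartzMap FourierTransform

noncomputable section

namespace WeylWigner

/-! ### Operations on Schwartz functions -/

/-- The function `(x, y) ↦ f x * g y`. -/
def tensor {E F : Type*} [NormedAddCommGroup E] [NormedSpace ℝ E] [NormedAddCommGroup F]
    [NormedSpace ℝ F] (f : 𝓢(E, ℂ)) (g : 𝓢(F, ℂ)) : 𝓢(E × F, ℂ) where
  toFun z := f z.1 * g z.2
  smooth' := ((f.smooth ⊤).comp contDiff_fst).mul ((g.smooth ⊤).comp contDiff_snd)
  decay' k n := by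
    have hf := fun k n => f.decay k n
    have hg := fun k n => g.decay k n
    choose Cf hCf using hf
    choose Cg hCg using hg
    refine ⟨∑ i ∈ Finset.range (n + 1), (n.choose i : ℝ) *
      (Cf k i * Cg 0 (n - i) + Cf 0 i * Cg k (n - i)), fun z => ?_⟩
    have h1 : ContDiff ℝ n (fun z : E × F => f z.1) := (f.smooth n).comp contDiff_fst
    have h2 : ContDiff ℝ n (fun z : E × F => g z.2) := (g.smooth n).comp contDiff_snd
    have hm := norm_iteratedFDeriv_mul_le h1 h2 z (n := n) le_rfl
    have e1 : ∀ i ≤ n, ‖iteratedFDeriv ℝ i (fun z : E × F => f z.1) z‖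
        ≤ ‖iteratedFDeriv ℝ i f z.1‖ := by
      intro i _
      have := (ContinuousLinearMap.fst ℝ E F).iteratedFDeriv_comp_right (f := f)
        (f.smooth i) z (i := i) le_rfl
      have h' : (fun z : E × F => f z.1) = f ∘ (ContinuousLinearMap.fst ℝ E F) := rfl
      rw [h', this]
      refine (ContinuousMultilinearMap.norm_compContinuousLinearMap_le _ _).trans ?_
      refine mul_le_of_le_one_right (norm_nonneg _) ?_
      exact Finset.prod_le_one (fun _ _ => norm_nonneg _)
        (fun _ _ => ContinuousLinearMap.norm_fst_le ℝ E F)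
    have e2 : ∀ i ≤ n, ‖iteratedFDeriv ℝ i (fun z : E × F => g z.2) z‖
        ≤ ‖iteratedFDeriv ℝ i g z.2‖ := by
      intro i _
      have := (ContinuousLinearMap.snd ℝ E F).iteratedFDeriv_comp_right (f := g)
        (g.smooth i) z (i := i) le_rfl
      have h' : (fun z : E × F => g z.2) = g ∘ (ContinuousLinearMap.snd ℝ E F) := rfl
      rw [h', this]
      refine (ContinuousMultilinearMap.norm_compContinuousLinearMap_le _ _).trans ?_
      refine mul_le_of_le_one_right (norm_nonneg _) ?_
      exact Finset.prod_le_one (fun _ _ => norm_nonneg _)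
        (fun _ _ => ContinuousLinearMap.norm_snd_le ℝ E F)
    refine (mul_le_mul_of_nonneg_left hm (by positivity)).trans ?_
    rw [Finset.mul_sum]
    refine Finset.sum_le_sum fun i hi => ?_
    have hi' : i ≤ n := Nat.lt_succ_iff.mp (Finset.mem_range.mp hi)
    have hz : ‖z‖ ^ k ≤ ‖z.1‖ ^ k + ‖z.2‖ ^ k := by
      rw [Prod.norm_def]
      rcases le_total ‖z.1‖ ‖z.2‖ with h | h
      · rw [max_eq_right h]; linarith [pow_nonneg (norm_nonneg z.1) k]
      · rw [max_eq_left h]; linarith [pow_nonneg (norm_nonneg z.2) k]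
    have b1 := e1 i hi'
    have b2 := e2 (n - i) (Nat.sub_le _ _)
    set A := ‖iteratedFDeriv ℝ i f z.1‖
    set B := ‖iteratedFDeriv ℝ (n - i) g z.2‖
    have hA0 : A ≤ Cf 0 i := by simpa using (hCf 0 i).2 z.1
    have hB0 : B ≤ Cg 0 (n - i) := by simpa using (hCg 0 (n - i)).2 z.2
    have hAk : ‖z.1‖ ^ k * A ≤ Cf k i := (hCf k i).2 z.1
    have hBk : ‖z.2‖ ^ k * B ≤ Cg k (n - i) := (hCg k (n - i)).2 z.2
    have hA : 0 ≤ A := norm_nonneg _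
    have hB : 0 ≤ B := norm_nonneg _
    have p1 : 0 ≤ ‖z.1‖ ^ k * A := by positivity
    have p2 : 0 ≤ ‖z.2‖ ^ k * B := by positivity
    calc ‖z‖ ^ k * (↑(n.choose i) * ‖iteratedFDeriv ℝ i (fun z : E × F => f z.1) z‖ *
          ‖iteratedFDeriv ℝ (n - i) (fun z : E × F => g z.2) z‖)
        ≤ (‖z.1‖ ^ k + ‖z.2‖ ^ k) * (↑(n.choose i) * A * B) := by gcongr
      _ = ↑(n.choose i) * ((‖z.1‖ ^ k * A) * B + A * (‖z.2‖ ^ k * B)) := by ring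
      _ ≤ _ := by
        gcongr
        · exact p1.trans hAk
        · exact hA.trans hA0

@[simp]
theorem tensor_apply {E F : Type*} [NormedAddCommGroup E] [NormedSpace ℝ E]
    [NormedAddCommGroup F] [NormedSpace ℝ F] (f : 𝓢(E, ℂ)) (g : 𝓢(F, ℂ)) (z : E × F) :
    tensor f g z = f z.1 * g z.2 := rfl

/-- Composition of a Schwartz function with an injective linear map. -/
def compInj {E F : Type*} [NormedAddCommGroup E] [NormedSpace ℝ E] [FiniteDimensional ℝ E]
    [NormedAddCommGroup F] [NormedSpace ℝ F] (L : E →L[ℝ] F) (hL : Function.Injective L) :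
    𝓢(F, ℂ) →L[ℂ] 𝓢(E, ℂ) :=
  compCLMOfAntilipschitz ℂ L.hasTemperateGrowth
    ((L : E →ₗ[ℝ] F).exists_antilipschitzWith (LinearMap.ker_eq_bot.mpr hL)).choose_spec.2

@[simp]
theorem compInj_apply {E F : Type*} [NormedAddCommGroup E] [NormedSpace ℝ E]
    [FiniteDimensional ℝ E] [NormedAddCommGroup F] [NormedSpace ℝ F] (L : E →L[ℝ] F)
    (hL : Function.Injective L) (f : 𝓢(F, ℂ)) (x : E) : compInj L hL f x = f (L x) := rfl

theorem expI_hasTemperateGrowth :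
    (fun t : ℝ => Complex.exp (Complex.I * (t : ℂ))).HasTemperateGrowth := by
  have key : ∀ n : ℕ, iteratedDeriv n (fun t : ℝ => Complex.exp (Complex.I * (t : ℂ)))
      = fun t : ℝ => Complex.I ^ n * Complex.exp (Complex.I * (t : ℂ)) := by
    intro n
    induction n with
    | zero => simp
    | succ n ih =>
      rw [iteratedDeriv_succ, ih]
      funext t
      have h1 : HasDerivAt (fun t : ℝ => Complex.I * (t : ℂ)) (Complex.I * 1) t :=
        (Complex.ofRealCLM.hasDerivAt).const_mul _
      have := ((h1.cexp).const_mul (Complex.I ^ n)).deriv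
      rw [this]; ring
  refine ⟨?_, fun n => ⟨0, 1, fun t => ?_⟩⟩
  · exact (contDiff_const.mul Complex.ofRealCLM.contDiff).cexp
  rw [norm_iteratedFDeriv_eq_norm_iteratedDeriv, key]
  have : ‖Complex.exp (Complex.I * (t : ℂ))‖ = 1 := by
    rw [mul_comm]; exact Complex.norm_exp_ofReal_mul_I t
  simp [this]

/-- Multiplication of a Schwartz function with the phase factor `exp (i Q x)`, where `Q` is real
valued and of temperate growth. -/
def mulPhase {E : Type*} [NormedAddCommGroup E] [NormedSpace ℝ E] (Q : E → ℝ)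
    (hQ : Q.HasTemperateGrowth) : 𝓢(E, ℂ) →L[ℂ] 𝓢(E, ℂ) :=
  bilinLeftCLM (ContinuousLinearMap.lsmul ℂ ℂ).flip (expI_hasTemperateGrowth.comp hQ)

@[simp]
theorem mulPhase_apply {E : Type*} [NormedAddCommGroup E] [NormedSpace ℝ E] (Q : E → ℝ)
    (hQ : Q.HasTemperateGrowth) (f : 𝓢(E, ℂ)) (x : E) :
    mulPhase Q hQ f x = Complex.exp (Complex.I * (Q x : ℂ)) * f x := rfl

/-! ### Minkowski space, test functions and the Fourier transform -/

/-- Momentum or position variables `x = (x₁, …, xₙ) ∈ ℝ⁴ⁿ`. -/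
abbrev X (n : ℕ) : Type := EuclideanSpace ℝ (Fin n × Fin 4)

abbrev R2 : Type := EuclideanSpace ℝ (Fin 2)

abbrev R4 : Type := EuclideanSpace ℝ (Fin 4)

/-- Real `4 × 4` matrices, as a Euclidean space `ℝ¹⁶`. -/
abbrev R16 : Type := EuclideanSpace ℝ (Fin 4 × Fin 4)

/-- The diagonal entries of the Minkowski metric. -/
def eta : Fin 4 → ℝ := ![1, -1, -1, -1]

theorem eta_mul_self (μ : Fin 4) : eta μ * eta μ = 1 := by
  fin_cases μ <;> simp [eta]

/-- The bilinear form `p θ q = (p, η θ η q)`. -/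
def twist (θ : R16) (p q : Fin 4 → ℝ) : ℝ :=
  ∑ μ, ∑ ν, (eta μ * p μ) * θ (μ, ν) * (eta ν * q ν)

/-- The linear map `p ↦ c η p` on `ℝ⁴ⁿ`, for `c ≠ 0`. -/
def scaleEta (n : ℕ) (c : ℝ) (hc : c ≠ 0) : X n ≃L[ℝ] X n :=
  LinearEquiv.toContinuousLinearEquiv
    { toFun := fun p => WithLp.toLp 2 fun i => c * (eta i.2 * p i)
      invFun := fun p => WithLp.toLp 2 fun i => c⁻¹ * (eta i.2 * p i)
      map_add' := fun p q => by ext i; simp; ring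
      map_smul' := fun a p => by ext i; simp; ring
      left_inv := fun p => by
        ext i
        have := eta_mul_self i.2
        simp only
        field_simp
        linear_combination p i * this
      right_inv := fun p => by
        ext i
        have := eta_mul_self i.2
        simp only
        field_simp
        linear_combination p i * this }

/-- The Fourier transform `f̃(p) = (2π)^{-2n} ∫ f(x) e^{-i ∑ⱼ pⱼ · xⱼ} dx` on `𝓢(ℝ⁴ⁿ)`, where
`p · x` is the Minkowski product. -/
def FT (n : ℕ) : 𝓢(X n, ℂ) ≃L[ℂ] 𝓢(X n, ℂ) :=
  (FourierTransform.fourierCLE ℂ 𝓢(X n, ℂ)).trans <|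
    ContinuousLinearEquiv.equivOfInverse
      ((((2 * Real.pi : ℝ) : ℂ) ^ (2 * n))⁻¹ • compCLMOfContinuousLinearEquiv ℂ
        (scaleEta n (2 * Real.pi)⁻¹ (inv_ne_zero Real.two_pi_pos.ne')))
      ((((2 * Real.pi : ℝ) : ℂ) ^ (2 * n)) • compCLMOfContinuousLinearEquiv ℂ
        (scaleEta n (2 * Real.pi)⁻¹ (inv_ne_zero Real.two_pi_pos.ne')).symm)
      (fun f => by
        have h : (((2 * Real.pi : ℝ) : ℂ) ^ (2 * n)) ≠ 0 :=
          pow_ne_zero _ (Complex.ofReal_ne_zero.mpr Real.two_pi_pos.ne')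
        ext x
        simp [-Complex.ofReal_mul, h])
      (fun f => by
        have h : (((2 * Real.pi : ℝ) : ℂ) ^ (2 * n)) ≠ 0 :=
          pow_ne_zero _ (Complex.ofReal_ne_zero.mpr Real.two_pi_pos.ne')
        ext x
        simp [-Complex.ofReal_mul, h])

theorem FT_apply (n : ℕ) (f : 𝓢(X n, ℂ)) (p : X n) :
    FT n f p = (((2 * Real.pi : ℝ) : ℂ) ^ (2 * n))⁻¹ *
      ∫ x : X n, Complex.exp (-Complex.I * (∑ i, eta i.2 * p i * x i : ℝ)) * f x := by
  have h : FT n f p = (((2 * Real.pi : ℝ) : ℂ) ^ (2 * n))⁻¹ *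
    (𝓕 (f : X n → ℂ)) (scaleEta n (2 * Real.pi)⁻¹ (inv_ne_zero Real.two_pi_pos.ne') p) := rfl
  rw [h, Real.fourier_eq']
  congr 2
  funext x
  rw [smul_eq_mul]
  congr 2
  have : (-2 * Real.pi * inner ℝ x
      (scaleEta n (2 * Real.pi)⁻¹ (inv_ne_zero Real.two_pi_pos.ne') p) : ℝ)
      = - ∑ i, eta i.2 * p i * x i := by
    rw [PiLp.inner_apply, Finset.mul_sum, ← Finset.sum_neg_distrib]
    refine Finset.sum_congr rfl fun i _ => ?_
    simp only [scaleEta, RCLike.inner_apply, conj_trivial, LinearEquiv.coe_toContinuousLinearEquiv',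
      LinearEquiv.coe_mk, LinearMap.coe_mk, AddHom.coe_mk]
    field_simp [Real.pi_ne_zero]
  rw [this]
  push_cast
  ring

/-- The splitting `ℝ⁴⁽ⁿ⁺ᵐ⁾ → ℝ⁴ⁿ × ℝ⁴ᵐ` into the first `n` and the last `m` variables. -/
def split (n m : ℕ) : X (n + m) →L[ℝ] X n × X m :=
  LinearMap.toContinuousLinearMap
    { toFun := fun x => (WithLp.toLp 2 fun i => x (Fin.castAdd m i.1, i.2),
        WithLp.toLp 2 fun i => x (Fin.natAdd n i.1, i.2))
      map_add' := fun x y => by ext i <;> simp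
      map_smul' := fun a x => by ext i <;> simp }

@[simp]
theorem split_fst (n m : ℕ) (x : X (n + m)) (i : Fin n × Fin 4) :
    (split n m x).1 i = x (Fin.castAdd m i.1, i.2) := rfl

@[simp]
theorem split_snd (n m : ℕ) (x : X (n + m)) (i : Fin m × Fin 4) :
    (split n m x).2 i = x (Fin.natAdd n i.1, i.2) := rfl

theorem split_injective (n m : ℕ) : Function.Injective (split n m) := by
  intro x y h
  ext ⟨j, μ⟩
  refine Fin.addCases (fun a => ?_) (fun b => ?_) j
  · simpa using congrArg (fun z : X n × X m => z.1 (a, μ)) h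
  · simpa using congrArg (fun z : X n × X m => z.2 (b, μ)) h

/-- The tensor product `(f ⊗ g)(x, y) = f(x) g(y)` of `f ∈ 𝓢(ℝ⁴ⁿ)` and `g ∈ 𝓢(ℝ⁴ᵐ)`. -/
def prodS {n m : ℕ} (f : 𝓢(X n, ℂ)) (g : 𝓢(X m, ℂ)) : 𝓢(X (n + m), ℂ) :=
  compInj (split n m) (split_injective n m) (tensor f g)

@[simp]
theorem prodS_apply {n m : ℕ} (f : 𝓢(X n, ℂ)) (g : 𝓢(X m, ℂ)) (x : X (n + m)) :
    prodS f g x = f (split n m x).1 * g (split n m x).2 := rfl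

/-- The function `x ↦ ∏ⱼ fⱼ(xⱼ)` on `ℝ⁴ⁿ`. -/
def tprodS : (n : ℕ) → (Fin n → 𝓢(X 1, ℂ)) → 𝓢(X n, ℂ)
  | 0, _ => HasCompactSupport.toSchwartzMap (f := fun _ : X 0 => (1 : ℂ))
      (HasCompactSupport.of_compactSpace _) contDiff_const
  | n + 1, f => prodS (tprodS n fun j => f j.castSucc) (f (Fin.last n))

/-- The `j`-th variable of `x ∈ ℝ⁴ⁿ`. -/
def pt {n : ℕ} (x : X n) (j : Fin n) : X 1 := WithLp.toLp 2 fun i => x (j, i.2)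

theorem tprodS_apply {n : ℕ} (f : Fin n → 𝓢(X 1, ℂ)) (x : X n) :
    tprodS n f x = ∏ j, f j (pt x j) := by
  induction n with
  | zero => rfl
  | succ n ih =>
    rw [tprodS, prodS_apply, ih, Fin.prod_univ_castSucc]
    congr 2
    ext i
    have : (Fin.natAdd n i.1 : Fin (n + 1)) = Fin.last n := by
      have := i.1.isLt
      ext; simp
    simp [pt, this]

/-- `K`-component test functions of `n` variables: `𝓢(ℝ⁴ⁿ)` to the power `Kⁿ`. -/
abbrev TestFn (K n : ℕ) : Type := (Fin n → Fin K) → 𝓢(X n, ℂ)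

/-- The `n`-fold tensor product of one-variable test functions. -/
def tprod {K n : ℕ} (f : Fin n → TestFn K 1) : TestFn K n :=
  fun k => tprodS n fun j => f j fun _ => k j

/-- The Borchers-Uhlmann algebra: terminating sequences `(f⁰, f¹, …)` of test functions. -/
abbrev Borchers (K : ℕ) : Type := DirectSum ℕ (TestFn K)

theorem coord_hasTemperateGrowth {ι : Type*} [Fintype ι] (i : ι) :
    (fun x : EuclideanSpace ℝ ι => x i).HasTemperateGrowth :=
  (EuclideanSpace.proj (𝕜 := ℝ) i).hasTemperateGrowth

theorem twist_hasTemperateGrowth {n : ℕ} (θ : R16) (l r : Fin n) :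
    (fun P : X n => twist θ (fun μ => P (l, μ)) (fun ν => P (r, ν))).HasTemperateGrowth := by
  unfold twist
  refine Function.HasTemperateGrowth.sum fun μ _ => Function.HasTemperateGrowth.sum fun ν _ => ?_
  have h1 := coord_hasTemperateGrowth (l, μ)
  have h2 := coord_hasTemperateGrowth (r, ν)
  fun_prop

/-- The exponent `-½ ∑_{l ≤ n} ∑_{r ≤ m} p_l θ q_r`. -/
def moyalExponent (θ : R16) (n m : ℕ) (P : X (n + m)) : ℝ :=
  ∑ l : Fin n, ∑ r : Fin m, -(1 / 2 : ℝ) *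
    twist θ (fun μ => P (Fin.castAdd m l, μ)) (fun μ => P (Fin.natAdd n r, μ))

theorem moyalExponent_hasTemperateGrowth (θ : R16) (n m : ℕ) :
    (moyalExponent θ n m).HasTemperateGrowth := by
  unfold moyalExponent
  refine Function.HasTemperateGrowth.sum fun l _ => Function.HasTemperateGrowth.sum fun r _ => ?_
  exact (Function.HasTemperateGrowth.const _).mul (twist_hasTemperateGrowth θ _ _)

/-- The Moyal tensor product of `f ∈ 𝓢(ℝ⁴ⁿ)` and `g ∈ 𝓢(ℝ⁴ᵐ)`, multi-component. -/
def moyalN {K : ℕ} (θ : R16) {n m : ℕ} (f : TestFn K n) (g : TestFn K m) : TestFn K (n + m) :=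
  fun k => (FT (n + m)).symm <|
    mulPhase (moyalExponent θ n m) (moyalExponent_hasTemperateGrowth θ n m) <|
      prodS (FT n (f fun j => k (Fin.castAdd m j))) (FT m (g fun j => k (Fin.natAdd n j)))

theorem FT_moyalN {K : ℕ} (θ : R16) {n m : ℕ} (f : TestFn K n) (g : TestFn K m)
    (k : Fin (n + m) → Fin K) (P : X (n + m)) :
    FT (n + m) (moyalN θ f g k) P =
      Complex.exp (Complex.I * (moyalExponent θ n m P : ℂ)) *
        (FT n (f fun j => k (Fin.castAdd m j)) (split n m P).1 *
          FT m (g fun j => k (Fin.natAdd n j)) (split n m P).2) := by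
  simp [moyalN]

theorem prodS_add_left {n m : ℕ} (f f' : 𝓢(X n, ℂ)) (g : 𝓢(X m, ℂ)) :
    prodS (f + f') g = prodS f g + prodS f' g := by ext x; simp [add_mul]

theorem prodS_add_right {n m : ℕ} (f : 𝓢(X n, ℂ)) (g g' : 𝓢(X m, ℂ)) :
    prodS f (g + g') = prodS f g + prodS f g' := by ext x; simp [mul_add]

theorem prodS_smul_left {n m : ℕ} (c : ℂ) (f : 𝓢(X n, ℂ)) (g : 𝓢(X m, ℂ)) :
    prodS (c • f) g = c • prodS f g := by ext x; simp [mul_assoc]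

theorem prodS_smul_right {n m : ℕ} (c : ℂ) (f : 𝓢(X n, ℂ)) (g : 𝓢(X m, ℂ)) :
    prodS f (c • g) = c • prodS f g := by ext x; simp [mul_left_comm]

/-- `moyalN` as a bilinear map. -/
def moyalBilin (K : ℕ) (θ : R16) (n m : ℕ) :
    TestFn K n →ₗ[ℂ] TestFn K m →ₗ[ℂ] TestFn K (n + m) :=
  LinearMap.mk₂ ℂ (moyalN θ)
    (fun f f' g => by funext k; simp [moyalN, prodS_add_left])
    (fun c f g => by funext k; simp [moyalN, prodS_smul_left])
    (fun f g g' => by funext k; simp [moyalN, prodS_add_right])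
    (fun c f g => by funext k; simp [moyalN, prodS_smul_right])

/-- The Moyal tensor product `⊗_θ` on the Borchers-Uhlmann algebra. -/
def moyal (K : ℕ) (θ : R16) : Borchers K →ₗ[ℂ] Borchers K →ₗ[ℂ] Borchers K :=
  DirectSum.toModule ℂ ℕ _ fun n =>
    LinearMap.flip <| DirectSum.toModule ℂ ℕ _ fun m =>
      LinearMap.flip <| (moyalBilin K θ n m).compr₂ (DirectSum.lof ℂ ℕ (TestFn K) (n + m))

/-- The embedding of one-variable test functions into the Borchers-Uhlmann algebra. -/
def emb {K : ℕ} (f : TestFn K 1) : Borchers K := DirectSum.lof ℂ ℕ (TestFn K) 1 f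

theorem moyal_lof (K : ℕ) (θ : R16) (n m : ℕ) (f : TestFn K n) (g : TestFn K m) :
    moyal K θ (DirectSum.lof ℂ ℕ (TestFn K) n f) (DirectSum.lof ℂ ℕ (TestFn K) m g) =
      DirectSum.lof ℂ ℕ (TestFn K) (n + m) (moyalN θ f g) := by
  simp [moyal, DirectSum.toModule_lof, moyalBilin]

/-- The exponent `-½ ∑_{l < r} p_l θ p_r`. -/
def twistExponent (θ : R16) (n : ℕ) (P : X n) : ℝ :=
  ∑ l : Fin n, ∑ r : Fin n, if l < r then -(1 / 2 : ℝ) *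
    twist θ (fun μ => P (l, μ)) (fun μ => P (r, μ)) else 0

theorem twistExponent_hasTemperateGrowth (θ : R16) (n : ℕ) :
    (twistExponent θ n).HasTemperateGrowth := by
  unfold twistExponent
  refine Function.HasTemperateGrowth.sum fun l _ => Function.HasTemperateGrowth.sum fun r _ => ?_
  by_cases h : l < r
  · simp only [h, if_true]
    exact (Function.HasTemperateGrowth.const _).mul (twist_hasTemperateGrowth θ _ _)
  · simp only [h, if_false]
    exact Function.HasTemperateGrowth.const _

/-- The test function with Fourier transform
`∏ⱼ f̃ⱼ(pⱼ)_{kⱼ} · ∏_{l < r} e^{-(i/2) p_l θ p_r}`. -/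
def twistedTprod {K n : ℕ} (θ : R16) (f : Fin n → TestFn K 1) : TestFn K n :=
  fun k => (FT n).symm <|
    mulPhase (twistExponent θ n) (twistExponent_hasTemperateGrowth θ n) <|
      tprodS n fun j => FT 1 (f j fun _ => k j)

/-- The involution `f*(x)_k = conj (f(x)_{k̄})` on one-variable test functions, for a given
conjugation `k ↦ k̄` of the indices. -/
def conjT {K : ℕ} (bar : Fin K → Fin K) (f : TestFn K 1) : TestFn K 1 :=
  fun k => postcompCLM (𝕜 := ℝ) (Complex.conjCLE : ℂ →L[ℝ] ℂ) (f fun j => bar (k j))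

/-- The translate `f_{(y)}(x) = f(x - y)` of a one-variable test function. -/
def transT {K : ℕ} (y : R4) (f : TestFn K 1) : TestFn K 1 :=
  fun k => compSubConstCLM ℂ (WithLp.toLp 2 fun i => y i.2 : X 1) (f k)

/-! ### Noncommutative Minkowski space -/

/-- The set `Σ` of all antisymmetric real matrices `θ` with
`θ_{μν} θ^{μν} = 2 (κ_m² - κ_e²)` and `ε_{μναβ} θ^{μν} θ^{αβ} = -8 κ_e κ_m`, where the matrix
entries are `θ^{μν}` and `ε_{0123} = -1`. It contains the reference matrix `theta1 κe κm`. -/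
def Sig (κe κm : ℝ) : Set R16 :=
  {θ | (∀ μ ν, θ (μ, ν) = -θ (ν, μ)) ∧
    ∑ μ, ∑ ν, (eta μ * eta ν * θ (μ, ν)) * θ (μ, ν) = 2 * (κm ^ 2 - κe ^ 2) ∧
    ∑ g : Equiv.Perm (Fin 4), -((Equiv.Perm.sign g : ℤ) : ℝ) * θ (g 0, g 1) * θ (g 2, g 3) =
      -8 * κe * κm}

/-- The reference matrix `θ₁`. -/
def theta1 (κe κm : ℝ) : Matrix (Fin 4) (Fin 4) ℝ :=
  !![0, κe, 0, 0; -κe, 0, 0, 0; 0, 0, 0, κm; 0, 0, -κm, 0]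

/-- A choice of proper orthochronous Lorentz transformations `Λ_θ` with `Λ_θ θ₁ Λ_θᵀ = θ` for all
`θ ∈ Σ`, depending on `θ` in a measurable and locally bounded way. (In general there is no choice
which is continuous on all of `Σ`.) -/
structure LorentzSection (κe κm : ℝ) where
  toFun : Sig κe κm → Matrix (Fin 4) (Fin 4) ℝ
  lorentz : ∀ θ, (toFun θ).transpose * Matrix.diagonal eta * toFun θ = Matrix.diagonal eta
  proper : ∀ θ, (toFun θ).det = 1
  orthochronous : ∀ θ, 0 < toFun θ 0 0
  orbit : ∀ θ μ ν, (toFun θ * theta1 κe κm * (toFun θ).transpose) μ ν = (θ : R16) (μ, ν)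
  measurable : ∀ μ ν, Measurable fun θ => toFun θ μ ν
  bounded : ∀ C : Set (Sig κe κm), IsCompact C → ∃ B : ℝ, ∀ θ ∈ C, ∀ μ ν, |toFun θ μ ν| ≤ B

/-- The coefficients `a_ν = ∑_μ (η p)_μ M_{μν}`, so that `p · X = ∑_ν a_ν x̂_ν` for
`X = M x̂`. -/
def coef (M : Matrix (Fin 4) (Fin 4) ℝ) (p : X 1) (ν : Fin 4) : ℝ :=
  ∑ μ, eta μ * p (0, μ) * M μ ν

/-- The displacement of the variable `s ∈ ℝ²` by `e^{i p · X}`. -/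
def weylShift (κe κm : ℝ) (M : Matrix (Fin 4) (Fin 4) ℝ) (p : X 1) : R2 :=
  !₂[κe * coef M p 1, κm * coef M p 3]

/-- The exponent of the phase factor of `e^{i p · X}`. -/
def weylExponent (κe κm : ℝ) (M : Matrix (Fin 4) (Fin 4) ℝ) (p : X 1) (s : R2) : ℝ :=
  coef M p 0 * s 0 + coef M p 2 * s 1 +
    (1 / 2 : ℝ) * (κe * (coef M p 0 * coef M p 1) + κm * (coef M p 2 * coef M p 3))

/-- The unitary `e^{i p · X}`, `X = M x̂`, in the Schrödinger representation
`x̂₀ = s₁`, `x̂₁ = -i κ_e ∂_{s₁}`, `x̂₂ = s₂`, `x̂₃ = -i κ_m ∂_{s₂}`. -/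
def weyl (κe κm : ℝ) (M : Matrix (Fin 4) (Fin 4) ℝ) (p : X 1) (v : R2 → ℂ) : R2 → ℂ :=
  fun s => Complex.exp (Complex.I * (weylExponent κe κm M p s : ℂ)) *
    v (s + weylShift κe κm M p)

theorem coef_add (M : Matrix (Fin 4) (Fin 4) ℝ) (p q : X 1) (ν : Fin 4) :
    coef M (p + q) ν = coef M p ν + coef M q ν := by
  simp only [coef, ← Finset.sum_add_distrib]
  exact Finset.sum_congr rfl fun μ _ => by simp; ring

theorem coef_smul (M : Matrix (Fin 4) (Fin 4) ℝ) (c : ℝ) (p : X 1) (ν : Fin 4) :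
    coef M (c • p) ν = c * coef M p ν := by
  simp only [coef, Finset.mul_sum]
  exact Finset.sum_congr rfl fun μ _ => by simp; ring

/-- The linear map `(s, (p, q)) ↦ (p, (s + weylShift p, q))`. -/
def shear (κe κm : ℝ) (M : Matrix (Fin 4) (Fin 4) ℝ) (m : ℕ) :
    R2 × X (1 + m) →L[ℝ] X 1 × (R2 × X m) :=
  LinearMap.toContinuousLinearMap
    { toFun := fun z => ((split 1 m z.2).1,
        (z.1 + weylShift κe κm M (split 1 m z.2).1, (split 1 m z.2).2))
      map_add' := fun z w => by
        refine Prod.ext (by simp) (Prod.ext ?_ (by simp))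
        ext i
        fin_cases i <;> simp [weylShift, coef_add] <;> ring
      map_smul' := fun c z => by
        refine Prod.ext (by simp) (Prod.ext ?_ (by simp))
        ext i
        fin_cases i <;> simp [weylShift, coef_smul] <;> ring }

theorem shear_injective (κe κm : ℝ) (M : Matrix (Fin 4) (Fin 4) ℝ) (m : ℕ) :
    Function.Injective (shear κe κm M m) := by
  rintro ⟨s, P⟩ ⟨s', P'⟩ h
  have h1 : (split 1 m P).1 = (split 1 m P').1 := congrArg (fun z => z.1) h
  have h2 : s + weylShift κe κm M (split 1 m P).1 = s' + weylShift κe κm M (split 1 m P').1 :=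
    congrArg (fun z => z.2.1) h
  have h3 : (split 1 m P).2 = (split 1 m P').2 := congrArg (fun z => z.2.2) h
  rw [h1] at h2
  exact Prod.ext (add_right_cancel h2) (split_injective 1 m (Prod.ext h1 h3))

theorem weylExponent_hasTemperateGrowth (κe κm : ℝ) (M : Matrix (Fin 4) (Fin 4) ℝ) (m : ℕ) :
    (fun z : R2 × X (1 + m) =>
      weylExponent κe κm M (split 1 m z.2).1 z.1).HasTemperateGrowth := by
  have hs : ∀ i : Fin 2, (fun z : R2 × X (1 + m) => z.1 i).HasTemperateGrowth := fun i =>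
    (coord_hasTemperateGrowth i).comp (ContinuousLinearMap.fst ℝ R2 (X (1 + m))).hasTemperateGrowth
  have hc : ∀ ν : Fin 4,
      (fun z : R2 × X (1 + m) => coef M (split 1 m z.2).1 ν).HasTemperateGrowth := by
    intro ν
    unfold coef
    refine Function.HasTemperateGrowth.sum fun μ _ => ?_
    have : (fun z : R2 × X (1 + m) => (split 1 m z.2).1 (0, μ)).HasTemperateGrowth :=
      (coord_hasTemperateGrowth (Fin.castAdd m (0 : Fin 1), μ)).comp
        (ContinuousLinearMap.snd ℝ R2 (X (1 + m))).hasTemperateGrowth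
    fun_prop
  have h0 := hs 0
  have h1 := hs 1
  have c0 := hc 0
  have c1 := hc 1
  have c2 := hc 2
  have c3 := hc 3
  unfold weylExponent
  fun_prop

/-- The Schwartz function `(s, (p, q)) ↦ f(p) · (e^{i p · X} g(·, q))(s)`. -/
def timesS (κe κm : ℝ) (M : Matrix (Fin 4) (Fin 4) ℝ) {m : ℕ} (f : 𝓢(X 1, ℂ))
    (g : 𝓢(R2 × X m, ℂ)) : 𝓢(R2 × X (1 + m), ℂ) :=
  mulPhase _ (weylExponent_hasTemperateGrowth κe κm M m) <|
    compInj (shear κe κm M m) (shear_injective κe κm M m) (tensor f g)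

theorem timesS_apply (κe κm : ℝ) (M : Matrix (Fin 4) (Fin 4) ℝ) {m : ℕ} (f : 𝓢(X 1, ℂ))
    (g : 𝓢(R2 × X m, ℂ)) (s : R2) (P : X (1 + m)) :
    timesS κe κm M f g (s, P) =
      f (split 1 m P).1 *
        weyl κe κm M (split 1 m P).1 (fun s' => g (s', (split 1 m P).2)) s := by
  simp only [timesS, mulPhase_apply, compInj_apply, tensor_apply, weyl, shear,
    LinearMap.coe_toContinuousLinearMap', LinearMap.coe_mk, AddHom.coe_mk]
  ring

/-! ### The enlarged Borchers-Uhlmann algebra -/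

/-- Functions of `θ ∈ Σ`, `s ∈ ℝ²` and `n` momentum variables, with `Kⁿ` components, which are
Schwartz functions of `(s, p)`. An element is the partial Fourier transform of
`(s, θ, x) ↦ 𝐠ⁿ_{s,θ}(x)` with respect to `x`. -/
abbrev Amb (κe κm : ℝ) (K n : ℕ) : Type :=
  (Fin n → Fin K) → Sig κe κm → 𝓢(R2 × X n, ℂ)

/-- Terminating sequences of such functions. -/
abbrev AmbBorchers (κe κm : ℝ) (K : ℕ) : Type := DirectSum ℕ (Amb κe κm K)

/-- The component of the action `f × 𝐠` on functions of `m` momentum variables. -/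
def timesN {κe κm : ℝ} (Λ : LorentzSection κe κm) {K : ℕ} (f : TestFn K 1) (m : ℕ) :
    Amb κe κm K m →ₗ[ℂ] Amb κe κm K (1 + m) where
  toFun g k θ := timesS κe κm (Λ.toFun θ)
    (FT 1 (f fun j => k (Fin.castAdd m j))) (g (fun j => k (Fin.natAdd 1 j)) θ)
  map_add' g g' := by
    funext k θ
    ext z
    simp only [Pi.add_apply, add_apply, timesS, mulPhase_apply, compInj_apply, tensor_apply]
    ring
  map_smul' c g := by
    funext k θ
    ext z
    simp only [Pi.smul_apply, smul_apply, timesS, mulPhase_apply, compInj_apply,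
      tensor_apply, RingHom.id_apply, smul_eq_mul]
    ring

/-- The action `f × 𝐠` of a one-variable test function, whose Fourier transform at `(p, q)` is
`f̃(p) · (e^{i p · X} 𝐠̃)(q)`; here `X = Λ_θ x̂` acts on the variable `s` at each `θ`. -/
def times {κe κm : ℝ} (Λ : LorentzSection κe κm) {K : ℕ} (f : TestFn K 1) :
    AmbBorchers κe κm K →ₗ[ℂ] AmbBorchers κe κm K :=
  DirectSum.toModule ℂ ℕ _ fun m =>
    (DirectSum.lof ℂ ℕ (Amb κe κm K) (1 + m)).comp (timesN Λ f m)

/-- The slice `s ↦ v(s, θ)` of a smooth, compactly supported function. -/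
def sliceV {v : R2 × R16 → ℂ} (h₁ : ContDiff ℝ (⊤ : ℕ∞) v) (h₂ : HasCompactSupport v) (θ : R16) :
    𝓢(R2, ℂ) :=
  HasCompactSupport.toSchwartzMap (f := fun s => v (s, θ))
    (h₂.comp_isClosedEmbedding
      (Topology.IsClosedEmbedding.of_continuous_injective_isClosedMap
        (by fun_prop) (fun _ _ h => congrArg Prod.fst h)
        (isClosedMap_prodMk_right θ)))
    (h₁.comp (contDiff_id.prodMk contDiff_const))

/-- The function `(s, θ) ↦ v(s, θ) g` for a test function `g` of `n` variables. -/
def elemN {κe κm : ℝ} {K : ℕ} {v : R2 × R16 → ℂ} (h₁ : ContDiff ℝ (⊤ : ℕ∞) v)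
    (h₂ : HasCompactSupport v) (n : ℕ) : TestFn K n →ₗ[ℂ] Amb κe κm K n where
  toFun g k θ := tensor (sliceV h₁ h₂ (θ : R16)) (FT n (g k))
  map_add' g g' := by
    funext k θ
    ext z
    simp [mul_add]
  map_smul' c g := by
    funext k θ
    ext z
    simp [mul_left_comm]

/-- The element `v ⊗ g`, `(s, θ) ↦ v(s, θ) g`, for a function `v ∈ C₀^∞(ℝ² × Σ)`, given as the
restriction of a function in `C₀^∞(ℝ² × ℝ¹⁶)`, and `g` in the Borchers-Uhlmann algebra. -/
def elem {κe κm : ℝ} {K : ℕ} {v : R2 × R16 → ℂ} (h₁ : ContDiff ℝ (⊤ : ℕ∞) v)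
    (h₂ : HasCompactSupport v) : Borchers K →ₗ[ℂ] AmbBorchers κe κm K :=
  DirectSum.toModule ℂ ℕ _ fun n =>
    (DirectSum.lof ℂ ℕ (Amb κe κm K) n).comp (elemN h₁ h₂ n)

/-- The enlarged Borchers-Uhlmann algebra: the smallest space which contains
`C₀^∞(ℝ² × Σ) ⊗ Borchers K` and is stable under the action `𝐠 ↦ f × 𝐠` of all test functions. -/
def enlarged {κe κm : ℝ} (Λ : LorentzSection κe κm) (K : ℕ) :
    Submodule ℂ (AmbBorchers κe κm K) :=
  sInf {W | (∀ (v : R2 × R16 → ℂ) (h₁ : ContDiff ℝ (⊤ : ℕ∞) v) (h₂ : HasCompactSupport v)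
      (g : Borchers K), elem h₁ h₂ g ∈ W) ∧
    ∀ (f : TestFn K 1), ∀ g ∈ W, times Λ f g ∈ W}

/-- Restriction of a Schwartz function on `ℝ² × ℝ⁴ⁿ` to a fixed value of `s`. -/
def sliceS {n : ℕ} (s : R2) : 𝓢(R2 × X n, ℂ) →L[ℂ] 𝓢(X n, ℂ) :=
  compCLMOfAntilipschitz ℂ (g := fun p : X n => (s, p)) (K := 1)
    (by
      have h : (fun p : X n => (s, p)) =
          (fun _ : X n => (s, (0 : X n))) + ⇑(ContinuousLinearMap.inr ℝ R2 (X n)) := by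
        funext p; simp
      rw [h]
      exact (Function.HasTemperateGrowth.const _).add
        (ContinuousLinearMap.hasTemperateGrowth _))
    (AntilipschitzWith.of_le_mul_dist fun p q => by simp [Prod.dist_eq])

/-- The component `𝐠ⁿ_{s,θ}`, in position space. -/
def evalN {κe κm : ℝ} {K : ℕ} (s : R2) (θ : Sig κe κm) (n : ℕ) :
    Amb κe κm K n →ₗ[ℂ] TestFn K n where
  toFun g k := (FT n).symm (sliceS s (g k θ))
  map_add' g g' := by funext k; simp
  map_smul' c g := by funext k; simp

/-- The sequence of test functions `𝐠_{s,θ}`, in position space. -/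
def evalAt {κe κm : ℝ} {K : ℕ} (s : R2) (θ : Sig κe κm) :
    AmbBorchers κe κm K →ₗ[ℂ] Borchers K :=
  DirectSum.toModule ℂ ℕ _ fun n =>
    (DirectSum.lof ℂ ℕ (TestFn K) n).comp (evalN s θ n)

/-- The measure `d²s × dσ(θ)`, where `σ` is the measure on the four-dimensional submanifold
`Σ ⊂ ℝ¹⁶` induced by the Euclidean metric. -/
def vMeasure (κe κm : ℝ) : Measure (R2 × Sig κe κm) :=
  (volume : Measure R2).prod (μHE[4] : Measure (Sig κe κm))

/-! ### Algebras of unbounded operators and GNS data -/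

/-- `⟨A x, y⟩ = ⟨x, B y⟩` for all vectors in the common invariant domain `E`, i.e. `B` is the
restriction of the adjoint of `A` to `E`. -/
def IsFormalAdjoint {E : Type*} [NormedAddCommGroup E] [InnerProductSpace ℂ E]
    (A B : Module.End ℂ E) : Prop :=
  ∀ x y : E, ⟪A x, y⟫_ℂ = ⟪x, B y⟫_ℂ

/-- An algebra of operators on the domain `E` is a *-algebra: it contains, with every operator,
the restriction of its adjoint to `E`. -/
def IsStarAlgebra {E : Type*} [NormedAddCommGroup E] [InnerProductSpace ℂ E]
    (𝒜 : Subalgebra ℂ (Module.End ℂ E)) : Prop :=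
  ∀ A ∈ 𝒜, ∃ B ∈ 𝒜, IsFormalAdjoint A B

/-- A state: a normalized linear functional with `ω (A* A) ≥ 0`. -/
def IsState {E : Type*} [NormedAddCommGroup E] [InnerProductSpace ℂ E]
    (𝒜 : Subalgebra ℂ (Module.End ℂ E)) (ω : 𝒜 →ₗ[ℂ] ℂ) : Prop :=
  ω 1 = 1 ∧ ∀ A B : 𝒜, IsFormalAdjoint (A : Module.End ℂ E) (B : Module.End ℂ E) →
    0 ≤ (ω (B * A)).re ∧ (ω (B * A)).im = 0

/-- GNS data of a state `ω` on a *-algebra of operators: a *-representation `π` on a dense domain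
of a Hilbert space `H` and a vector implementing `ω`, which is cyclic in the strong sense that
`{π(b) Ω}` is dense in the domain with respect to the graph topology of `π`, i.e. the topology of
all seminorms `x ↦ ‖π(a) x‖`. -/
structure GNSData {E : Type*} [NormedAddCommGroup E] [InnerProductSpace ℂ E]
    (𝒜 : Subalgebra ℂ (Module.End ℂ E)) (ω : 𝒜 →ₗ[ℂ] ℂ)
    (H : Type*) [NormedAddCommGroup H] [InnerProductSpace ℂ H] where
  dom : Submodule ℂ H
  dense : Dense (dom : Set H)
  π : 𝒜 →ₐ[ℂ] Module.End ℂ dom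
  star : ∀ A B : 𝒜, IsFormalAdjoint (A : Module.End ℂ E) (B : Module.End ℂ E) →
    IsFormalAdjoint (π A) (π B)
  vac : dom
  implements : ∀ A : 𝒜, ω A = ⟪vac, π A vac⟫_ℂ
  cyclic : ∀ x : dom, (fun A : 𝒜 => (π A x : H)) ∈
    closure (Set.range fun (B : 𝒜) (A : 𝒜) => (π A (π B vac) : H))

/-- The vectors `x` in the domain of the closure of the representation `π`, each given by the
function `A ↦ π̄(A) x`; the closure is taken in the graph topology. -/
def GNSData.closedOrbits {E : Type*} [NormedAddCommGroup E] [InnerProductSpace ℂ E]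
    {𝒜 : Subalgebra ℂ (Module.End ℂ E)} {ω : 𝒜 →ₗ[ℂ] ℂ}
    {H : Type*} [NormedAddCommGroup H] [InnerProductSpace ℂ H] (G : GNSData 𝒜 ω H) :
    Set (𝒜 → H) :=
  closure (Set.range fun (x : G.dom) (A : 𝒜) => (G.π A x : H))

/-- Unitary equivalence of GNS data: a unitary `V` which maps one implementing vector to the other,
maps `π(A) Ω` to `π'(A) Ω'`, and which carries the closure of the first representation to the
closure of the second, including the domains. -/
def GNSData.UnitarilyEquivalent {E : Type*} [NormedAddCommGroup E] [InnerProductSpace ℂ E]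
    {𝒜 : Subalgebra ℂ (Module.End ℂ E)} {ω : 𝒜 →ₗ[ℂ] ℂ}
    {H : Type*} [NormedAddCommGroup H] [InnerProductSpace ℂ H]
    {H' : Type*} [NormedAddCommGroup H'] [InnerProductSpace ℂ H']
    (G : GNSData 𝒜 ω H) (G' : GNSData 𝒜 ω H') : Prop :=
  ∃ V : H ≃ₗᵢ[ℂ] H', V G.vac = G'.vac ∧
    (∀ A : 𝒜, V (G.π A G.vac) = G'.π A G'.vac) ∧
    ∀ T : 𝒜 → H, T ∈ G.closedOrbits ↔ (fun A => V (T A)) ∈ G'.closedOrbits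

/-! ### The undeformed theory -/

/-- The domain spanned by the vectors `Ψⁿ(fⁿ)`. -/
def vacDom {K : ℕ} {H : Type*} [NormedAddCommGroup H] [InnerProductSpace ℂ H]
    (Psi : (n : ℕ) → TestFn K n →L[ℂ] H) : Submodule ℂ H :=
  Submodule.span ℂ (⋃ n, Set.range (Psi n))

/-- A theory of `K` quantum field components `φ₁, …, φ_K` on Minkowski space in a translationally
invariant vacuum representation. The set of fields is closed under taking adjoints, with
`φ_k(f)* = φ_{k̄}(f̄)`. Wightman theories are of this kind; Lorentz covariance, the spectrum
condition and locality are not required. -/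
structure FieldTheory (K : ℕ) (H : Type*) [NormedAddCommGroup H] [InnerProductSpace ℂ H] where
  /-- The conjugation `k ↦ k̄` of the indices. -/
  bar : Fin K → Fin K
  bar_bar : ∀ k, bar (bar k) = k
  /-- The strongly continuous unitary representation of the translations. -/
  U : R4 → H ≃ₗᵢ[ℂ] H
  U_zero : ∀ ξ, U 0 ξ = ξ
  U_add : ∀ y y' ξ, U (y + y') ξ = U y (U y' ξ)
  U_continuous : ∀ ξ, Continuous fun y => U y ξ
  /-- The vector valued tempered distributions `Ψⁿ` on `ℝ⁴ⁿ`, with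
  `Ψⁿ(f₁ ⊗ ⋯ ⊗ fₙ) = φ(f₁) ⋯ φ(fₙ) Ω`. -/
  Psi : (n : ℕ) → TestFn K n →L[ℂ] H
  dense : Dense (vacDom Psi : Set H)
  /-- The vacuum vector. -/
  vac : vacDom Psi
  norm_vac : ‖vac‖ = 1
  U_vac : ∀ y, U y (vac : H) = vac
  /-- The fields `φ(f) = ∑_k φ_k(f_k)`. -/
  phi : TestFn K 1 →ₗ[ℂ] Module.End ℂ (vacDom Psi)
  phi_adjoint : ∀ f, IsFormalAdjoint (phi f) (phi (conjT bar f))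
  Psi_tprod : ∀ (n : ℕ) (f : Fin n → TestFn K 1),
    Psi n (tprod f) = ((List.ofFn fun j => phi (f j)).prod vac : vacDom Psi)
  U_dom : ∀ y, ∀ ξ ∈ vacDom Psi, U y ξ ∈ vacDom Psi
  U_phi : ∀ y f (ξ : vacDom Psi),
    U y (phi f ξ : H) = phi (transT y f) ⟨U y ξ, U_dom y ξ ξ.2⟩

namespace FieldTheory

variable {K : ℕ} {H : Type*} [NormedAddCommGroup H] [InnerProductSpace ℂ H]
  (T : FieldTheory K H)

/-- The domain `𝒟` of the undeformed theory. -/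
def dom : Submodule ℂ H := vacDom T.Psi

/-- The map `Ψ(g) = ∑ₙ Ψⁿ(gⁿ)` on the Borchers-Uhlmann algebra. -/
def PsiB : Borchers K →ₗ[ℂ] H :=
  DirectSum.toModule ℂ ℕ _ fun n => (T.Psi n : TestFn K n →ₗ[ℂ] H)

/-- The `n`-point functions `ωₙ(fⁿ) = ⟨Ω, Ψⁿ(fⁿ)⟩`. -/
def npoint (n : ℕ) (f : TestFn K n) : ℂ := ⟪(T.vac : H), T.Psi n f⟫_ℂ

/-- The `H`-valued function `Ψ^⊗(𝐠)(s, θ) = Ψ(𝐠_{s,θ})`. -/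
def PsiOt {κe κm : ℝ} (g : AmbBorchers κe κm K) (z : R2 × Sig κe κm) : H :=
  T.PsiB (evalAt z.1 z.2 g)

/-- The domain `𝒟^⊗ ⊂ L²(ℝ² × Σ → H)` of all vectors `Ψ^⊗(𝐠)`. -/
def domOt {κe κm : ℝ} (Λ : LorentzSection κe κm) :
    Submodule ℂ (Lp H 2 (vMeasure κe κm)) where
  carrier := {ξ | ∃ g ∈ enlarged Λ K, ξ =ᵐ[vMeasure κe κm] T.PsiOt g}
  zero_mem' := ⟨0, Submodule.zero_mem _, by
    filter_upwards [Lp.coeFn_zero H 2 (vMeasure κe κm)] with z hz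
    rw [hz]; simp [PsiOt]⟩
  add_mem' := by
    rintro ξ ξ' ⟨g, hg, h⟩ ⟨g', hg', h'⟩
    refine ⟨g + g', Submodule.add_mem _ hg hg', ?_⟩
    filter_upwards [Lp.coeFn_add ξ ξ', h, h'] with z h1 h2 h3
    rw [h1, Pi.add_apply, h2, h3]; simp [PsiOt]
  smul_mem' := by
    rintro c ξ ⟨g, hg, h⟩
    refine ⟨c • g, Submodule.smul_mem _ c hg, ?_⟩
    filter_upwards [Lp.coeFn_smul c ξ, h] with z h1 h2
    rw [h1, Pi.smul_apply, h2]; simp [PsiOt]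

/-- `A` is the Weyl-Wigner deformed field operator `φ^⊗(f)`, that is the linear operator on `𝒟^⊗`
with `φ^⊗(f) Ψ^⊗(𝐠) = Ψ^⊗(f × 𝐠)` for all `𝐠`. -/
def IsDeformedField {κe κm : ℝ} (Λ : LorentzSection κe κm) (f : TestFn K 1)
    (A : Module.End ℂ (T.domOt Λ)) : Prop :=
  ∀ (ξ : T.domOt Λ), ∀ g ∈ enlarged Λ K, (ξ : Lp H 2 (vMeasure κe κm)) =ᵐ[vMeasure κe κm] T.PsiOt g →
    (A ξ : Lp H 2 (vMeasure κe κm)) =ᵐ[vMeasure κe κm] T.PsiOt (times Λ f g)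

/-- The algebra `𝒫^⊗` of all polynomials in the fields `φ^⊗(f)`. -/
def polyAlgebra {κe κm : ℝ} (Λ : LorentzSection κe κm) :
    Subalgebra ℂ (Module.End ℂ (T.domOt Λ)) :=
  Algebra.adjoin ℂ {A | ∃ f, T.IsDeformedField Λ f A}

/-- The linear functional `ω` on `𝒫^⊗` is the product state `ω^θ`: the value of
`φ^⊗(f₁) ⋯ φ^⊗(fₙ)` is obtained by evaluating the `n`-point function on the test function with
Fourier transform `∏ⱼ f̃ⱼ(pⱼ) · ∏_{l < r} e^{-(i/2) p_l θ p_r}`. -/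
def IsOmegaTheta {κe κm : ℝ} (Λ : LorentzSection κe κm) (θ : Sig κe κm)
    (ω : T.polyAlgebra Λ →ₗ[ℂ] ℂ) : Prop :=
  ∀ (n : ℕ) (f : Fin n → TestFn K 1) (A : Fin n → T.polyAlgebra Λ),
    (∀ j, T.IsDeformedField Λ (f j) (A j : Module.End ℂ (T.domOt Λ))) →
      ω (List.ofFn A).prod = T.npoint n (twistedTprod (θ : R16) f)

end FieldTheory

end WeylWigner

end

open MeasureTheory WeylWigner

open MeasureTheory SchwartzMap
open scoped InnerProductSpace SchwartzMap FourierTransform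

noncomputable section

set_option linter.unusedSectionVars false
set_option maxSynthPendingDepth 3

namespace WeylWigner

/-! ### Slices of Schwartz functions on a product -/

/-! Fix `θ` and `M = Λ_θ`. The Weyl operators satisfy e^{ip·X} e^{iq·X} = e^{-(i/2) pθq}
e^{i(p+q)·X}. Hence, with Q the total momentum, the map V : g ↦ (e^{iQ·X} v) g from the
Borchers–Uhlmann algebra to functions of `s` turns Moyal multiplication into the action ×
(`timesS_Vmap`, `timesFib_VFib`). It preserves inner products up to the factor ‖v‖²: translation
invariance moves functions of Q across the form ⟨Ψ(h), Ψ(g)⟩, and the Weyl operators are unitary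
(`integral_inner_Vmap`). So each fibre of the enlarged theory over `θ` contains a copy of the theory
deformed with `θ`.

Adjoints come from the undeformed fields. Smearing in `s` against products turns f × into an
undeformed field with test function f(p)⟨w, e^{ip·X} v⟩, which gives the adjoint relation in each
fibre (`integral_inner_times`). Integrated over `θ` it holds for φ^⊗, and pulled back along V it
holds for ⊗_θ (`inner_PsiB_moyal`). A map with a formal adjoint preserves the null space of the form
(`exists_descend`), so both families of fields are well-defined operators.

The crux is that π^θ is well defined for every single `θ`, although elements of 𝒫^⊗ only know `θ` up
to null sets. If a polynomial `w` in the φ^⊗ vanishes, apply it to Ψ^⊗(v ⊗ 1). Over almost every `θ`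
this is V of the Moyal polynomial acting on 1, so that polynomial annihilates Ω wherever v does not
vanish. The resulting vector depends continuously on `θ` and σ has full support, so the relation
holds for all `θ` (`PsiB_moyalPoly_unitB_eq_zero`). Cyclicity and adjoints extend it from Ω to 𝒟
(`polyD_eq_zero`). Then ω^θ is the vector state of Ω under π^θ, strong cyclicity follows from
density of tensor products and continuity of the Ψⁿ (`orbit_mem_closure`), and uniqueness is the
usual GNS argument.

The analytic tools are that continuous linear maps commute with integrals of slices of Schwartz
functions (`integral_slice`), the density of product functions (`dense_span_tensor`), and the fact
that σ is locally finite with full support. Square integrability holds because elements of the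
enlarged algebra depend on `θ` through a Schwartz function of (Λ_θ, θ) with compact support in `θ`
(`SmoothPar`). -/

theorem exists_dual_of_notMem_closure {E : Type*} [AddCommGroup E] [Module ℝ E]
    [TopologicalSpace E] [IsTopologicalAddGroup E] [ContinuousSMul ℝ E] [LocallyConvexSpace ℝ E]
    (p : Submodule ℝ E) {x : E} (hx : x ∉ closure (p : Set E)) :
    ∃ f : E →L[ℝ] ℝ, f x ≠ 0 ∧ ∀ y ∈ p, f y = 0 := by
  obtain ⟨f, u, hf, hu⟩ := geometric_hahn_banach_closed_point
    (p.convex.closure : Convex ℝ (closure (p : Set E))) isClosed_closure hx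
  have h0 : ∀ y ∈ p, f y = 0 := by
    intro y hy
    by_contra hne
    -- A functional bounded above by `u` on a subspace vanishes there: otherwise a multiple of `y`
    -- takes the value `u + 1`.
    have := hf (((u + 1) / f y) • y) (subset_closure (p.smul_mem _ hy))
    rw [map_smul, smul_eq_mul, div_mul_cancel₀ _ hne] at this
    linarith
  refine ⟨f, ?_, h0⟩
  have := hf 0 (subset_closure p.zero_mem)
  rw [map_zero] at this
  linarith

/-- A functional that vanishes on `p` also kills the integral, and such functionals detect the
closure. The submodule need not be closed, since it will be the range of a map on Schwartz space. -/
theorem integral_mem_closure_submodule {α B : Type*} [MeasurableSpace α] {μ : Measure α}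
    [NormedAddCommGroup B] [NormedSpace ℝ B] [CompleteSpace B] (p : Submodule ℝ B) {F : α → B}
    (hF : Integrable F μ) (hp : ∀ y, F y ∈ p) : ∫ y, F y ∂μ ∈ closure (p : Set B) := by
  by_contra h
  obtain ⟨f, hf, h0⟩ := exists_dual_of_notMem_closure p h
  apply hf
  rw [← f.integral_comp_comm hF]
  simp [h0 _ (hp _)]

section Slice

variable {V E F : Type*} [NormedAddCommGroup V] [NormedSpace ℝ V]
  [NormedAddCommGroup E] [NormedSpace ℝ E]
  [NormedAddCommGroup F] [NormedSpace ℝ F] [NormedSpace ℂ F] [SMulCommClass ℝ ℂ F]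

/-- The slice `x ↦ G (y, x)` of a Schwartz function. -/
def slice (y : V) : 𝓢(V × E, F) →L[ℂ] 𝓢(E, F) :=
  compCLMOfAntilipschitz ℂ (g := fun p : E => (y, p)) (K := 1)
    (by
      have h : (fun p : E => (y, p)) =
          (fun _ : E => (y, (0 : E))) + ⇑(ContinuousLinearMap.inr ℝ V E) := by
        funext p; simp
      rw [h]
      exact (Function.HasTemperateGrowth.const _).add
        (ContinuousLinearMap.hasTemperateGrowth _))
    (AntilipschitzWith.of_le_mul_dist fun p q => by simp [Prod.dist_eq])

@[simp]
theorem slice_apply (y : V) (G : 𝓢(V × E, F)) (x : E) : slice y G x = G (y, x) := rfl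

@[simp]
theorem slice_tensor (y : V) (f : 𝓢(V, ℂ)) (g : 𝓢(E, ℂ)) :
    slice y (tensor f g) = f y • g := by
  ext x; simp

theorem iteratedFDeriv_slice (y : V) (G : 𝓢(V × E, F)) (l : ℕ) (x : E) :
    iteratedFDeriv ℝ l (slice y G) x =
      (iteratedFDeriv ℝ l G (y, x)).compContinuousLinearMap
        fun _ => ContinuousLinearMap.inr ℝ V E := by
  have h : (slice y G : E → F) =
      (fun z => G ((y, 0) + z)) ∘ (ContinuousLinearMap.inr ℝ V E) := by
    funext x; simp
  have hc : ContDiff ℝ l (fun z => G ((y, 0) + z)) :=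
    (G.smooth l).comp (contDiff_const.add contDiff_id)
  rw [h, (ContinuousLinearMap.inr ℝ V E).iteratedFDeriv_comp_right hc x le_rfl,
    iteratedFDeriv_comp_add_left]
  simp

theorem norm_inr_pow_le (l : ℕ) :
    (∏ _i : Fin l, ‖ContinuousLinearMap.inr ℝ V E‖) ≤ 1 :=
  Finset.prod_le_one (fun _ _ => norm_nonneg _) (fun _ _ =>
    ContinuousLinearMap.opNorm_le_bound _ zero_le_one (fun x => by simp))

theorem norm_iteratedFDeriv_slice_le (y : V) (G : 𝓢(V × E, F)) (l : ℕ) (x : E) :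
    ‖iteratedFDeriv ℝ l (slice y G) x‖ ≤ ‖iteratedFDeriv ℝ l G (y, x)‖ := by
  rw [iteratedFDeriv_slice]
  refine (ContinuousMultilinearMap.norm_compContinuousLinearMap_le _ _).trans ?_
  exact mul_le_of_le_one_right (norm_nonneg _) (norm_inr_pow_le l)

/-- Both ‖y‖ and ‖x‖ are bounded by ‖(y, x)‖, so decay of any order in `y` is paid for by a higher
weight in the seminorm of `G`. -/
theorem seminorm_slice_le (k l N : ℕ) (G : 𝓢(V × E, F)) (y : V) :
    (1 + ‖y‖) ^ N * SchwartzMap.seminorm ℝ k l (slice y G) ≤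
      2 ^ (k + N) * ((Finset.Iic (k + N, l)).sup (schwartzSeminormFamily ℝ (V × E) F)) G := by
  have hpos : 0 < (1 + ‖y‖) ^ N := by positivity
  rw [← le_div_iff₀' hpos]
  refine SchwartzMap.seminorm_le_bound ℝ k l _ (by positivity) fun x => ?_
  rw [le_div_iff₀' hpos]
  have h1 : (1 + ‖y‖) ^ N * ‖x‖ ^ k ≤ (1 + ‖(y, x)‖) ^ (k + N) := by
    rw [pow_add, mul_comm]
    have hy : ‖y‖ ≤ ‖(y, x)‖ := norm_fst_le (y, x)
    have hx : ‖x‖ ≤ 1 + ‖(y, x)‖ := (norm_snd_le (y, x)).trans (by linarith)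
    gcongr
  have h2 := norm_iteratedFDeriv_slice_le y G l x
  calc (1 + ‖y‖) ^ N * (‖x‖ ^ k * ‖iteratedFDeriv ℝ l (slice y G) x‖)
      = ((1 + ‖y‖) ^ N * ‖x‖ ^ k) * ‖iteratedFDeriv ℝ l (slice y G) x‖ := by ring
    _ ≤ (1 + ‖(y, x)‖) ^ (k + N) * ‖iteratedFDeriv ℝ l G (y, x)‖ := by gcongr
    _ ≤ _ := SchwartzMap.one_add_le_sup_seminorm_apply (m := (k + N, l)) le_rfl le_rfl G (y, x)

/-- Mean value inequality in the slice variable, at the cost of one derivative. The weight ‖x‖ᵏ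
stays fixed along the segment and is absorbed by the seminorm. -/
theorem norm_sub_iteratedFDeriv_le (G : 𝓢(V × E, F)) (k l : ℕ) (x : E) (y y' : V) :
    ‖x‖ ^ k * ‖iteratedFDeriv ℝ l G (y, x) - iteratedFDeriv ℝ l G (y', x)‖ ≤
      SchwartzMap.seminorm ℝ k (l + 1) G * ‖y - y'‖ := by
  -- The argument divides by ‖x‖ᵏ, so the case where it vanishes is separated.
  rcases (pow_nonneg (norm_nonneg x) k).eq_or_lt with h0 | hpos
  · rw [← h0, zero_mul]; positivity
  rw [← le_div_iff₀' hpos, mul_div_right_comm]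
  have hd : ∀ z, HasFDerivAt (iteratedFDeriv ℝ l G) (fderiv ℝ (iteratedFDeriv ℝ l G) z) z :=
    fun z => ((G.smooth ⊤).differentiable_iteratedFDeriv
      (by exact_mod_cast WithTop.coe_lt_top l) z).hasFDerivAt
  have hF : ∀ t ∈ (Set.univ : Set V), HasFDerivWithinAt (fun t : V => iteratedFDeriv ℝ l G (t, x))
      ((fderiv ℝ (iteratedFDeriv ℝ l G) (t, x)).comp (ContinuousLinearMap.inl ℝ V E))
      Set.univ t := fun t _ =>
    ((hd (t, x)).comp t (hasFDerivAt_prodMk_left t x)).hasFDerivWithinAt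
  refine Convex.norm_image_sub_le_of_norm_hasFDerivWithin_le hF (fun t _ => ?_) convex_univ
    (Set.mem_univ y') (Set.mem_univ y)
  rw [le_div_iff₀' hpos]
  have h1 : ‖(fderiv ℝ (iteratedFDeriv ℝ l G) (t, x)).comp (ContinuousLinearMap.inl ℝ V E)‖
      ≤ ‖iteratedFDeriv ℝ (l + 1) G (t, x)‖ := by
    refine (ContinuousLinearMap.opNorm_comp_le _ _).trans ?_
    rw [norm_fderiv_iteratedFDeriv]
    exact mul_le_of_le_one_right (norm_nonneg _)
      (ContinuousLinearMap.opNorm_le_bound _ zero_le_one (fun x => by simp))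
  have h2 : ‖x‖ ≤ ‖(t, x)‖ := norm_snd_le (t, x)
  calc _ ≤ ‖(t, x)‖ ^ k * ‖iteratedFDeriv ℝ (l + 1) G (t, x)‖ := by gcongr
    _ ≤ _ := SchwartzMap.le_seminorm ℝ k (l + 1) G (t, x)

theorem seminorm_slice_sub_le (k l : ℕ) (G : 𝓢(V × E, F)) (y y' : V) :
    SchwartzMap.seminorm ℝ k l (slice y G - slice y' G) ≤
      SchwartzMap.seminorm ℝ k (l + 1) G * ‖y - y'‖ := by
  refine SchwartzMap.seminorm_le_bound ℝ k l _ (by positivity) fun x => ?_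
  refine le_trans ?_ (norm_sub_iteratedFDeriv_le G k l x y y')
  gcongr
  have : iteratedFDeriv ℝ l (⇑(slice y G - slice y' G)) x =
      (iteratedFDeriv ℝ l G (y, x) - iteratedFDeriv ℝ l G (y', x)).compContinuousLinearMap
        fun _ => ContinuousLinearMap.inr ℝ V E := by
    have h : (⇑(slice y G - slice y' G)) = ⇑(slice y G) - ⇑(slice y' G) := by
      funext x; simp
    rw [h, iteratedFDeriv_sub_apply ((slice y G).smooth l).contDiffAt ((slice y' G).smooth l).contDiffAt,
      iteratedFDeriv_slice, iteratedFDeriv_slice]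
    rfl
  rw [this]
  refine (ContinuousMultilinearMap.norm_compContinuousLinearMap_le _ _).trans ?_
  exact mul_le_of_le_one_right (norm_nonneg _) (norm_inr_pow_le l)

theorem finset_sup_le_sum_apply {M ι : Type*} [AddCommGroup M] [Module ℝ M]
    (p : ι → Seminorm ℝ M) (s : Finset ι) (x : M) : s.sup p x ≤ ∑ i ∈ s, p i x :=
  Seminorm.finset_sup_apply_le (Finset.sum_nonneg fun _ _ => apply_nonneg _ _) fun _ hi =>
    Finset.single_le_sum (f := fun i => p i x) (fun _ _ => apply_nonneg _ _) hi

/-- Every Schwartz seminorm of the difference of two slices is Lipschitz in `y`. -/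
theorem continuous_slice (G : 𝓢(V × E, F)) : Continuous fun y : V => slice y G := by
  rw [continuous_iff_continuousAt]
  intro y₀
  refine ((schwartz_withSeminorms ℝ E F).tendsto_nhds' _ _).mpr ?_
  intro s ε hε
  have hsup : ∀ s : Finset (ℕ × ℕ), ∃ C, 0 ≤ C ∧ ∀ y,
      s.sup (schwartzSeminormFamily ℝ E F) (slice y G - slice y₀ G) ≤ C * ‖y - y₀‖ := by
    intro s
    refine ⟨∑ i ∈ s, SchwartzMap.seminorm ℝ i.1 (i.2 + 1) G,
      Finset.sum_nonneg fun _ _ => apply_nonneg _ _, fun y => ?_⟩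
    refine (finset_sup_le_sum_apply _ s _).trans ?_
    rw [Finset.sum_mul]
    exact Finset.sum_le_sum fun i _ => seminorm_slice_sub_le i.1 i.2 G y y₀
  obtain ⟨C, hC, h⟩ := hsup s
  have : Filter.Tendsto (fun y : V => C * ‖y - y₀‖) (nhds y₀) (nhds 0) := by
    have : Continuous fun y : V => C * ‖y - y₀‖ := by fun_prop
    simpa using this.tendsto y₀
  filter_upwards [this.eventually (gt_mem_nhds hε)] with y hy
  exact (h y).trans_lt hy

theorem exists_seminorm_bound {H : Type*} [NormedAddCommGroup H] [NormedSpace ℝ H]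
    (a : 𝓢(E, F) →L[ℝ] H) : ∃ (s : Finset (ℕ × ℕ)) (C : ℝ), 0 ≤ C ∧
      ∀ f, ‖a f‖ ≤ C * s.sup (schwartzSeminormFamily ℝ E F) f := by
  obtain ⟨s, C, _, h⟩ := Seminorm.bound_of_continuous (schwartz_withSeminorms ℝ E F)
    ((normSeminorm ℝ H).comp (a : 𝓢(E, F) →ₗ[ℝ] H)) (by
      change Continuous fun f => ‖a f‖
      fun_prop)
  exact ⟨s, C, C.2, fun f => h f⟩

/-- Rapid decay of `y ↦ a (G (y, ·))`, uniformly for `G` in a bounded set. -/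
theorem exists_slice_bound {H : Type*} [NormedAddCommGroup H] [NormedSpace ℝ H]
    (a : 𝓢(E, F) →L[ℝ] H) (N : ℕ) : ∃ (s : Finset (ℕ × ℕ)) (C : ℝ), 0 ≤ C ∧
      ∀ (G : 𝓢(V × E, F)) (y : V), (1 + ‖y‖) ^ N * ‖a (slice y G)‖ ≤
        C * s.sup (schwartzSeminormFamily ℝ (V × E) F) G := by
  obtain ⟨s, C, hC, h⟩ := exists_seminorm_bound a
  -- The seminorm (k, l) of a slice with weight N needs the seminorms of `G` up to (k + N, l); the
  -- union over `s` collects them.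
  refine ⟨s.sup fun i => Finset.Iic (i.1 + N, i.2), C * ∑ i ∈ s, 2 ^ (i.1 + N),
    mul_nonneg hC (Finset.sum_nonneg fun _ _ => by positivity), fun G y => ?_⟩
  calc (1 + ‖y‖) ^ N * ‖a (slice y G)‖
      ≤ (1 + ‖y‖) ^ N * (C * s.sup (schwartzSeminormFamily ℝ E F) (slice y G)) := by
        gcongr; exact h _
    _ ≤ (1 + ‖y‖) ^ N * (C * ∑ i ∈ s, schwartzSeminormFamily ℝ E F i (slice y G)) := by
        gcongr
        exact finset_sup_le_sum_apply _ s _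
    _ = C * ∑ i ∈ s, (1 + ‖y‖) ^ N * schwartzSeminormFamily ℝ E F i (slice y G) := by
        rw [← Finset.mul_sum]; ring
    _ ≤ C * ∑ i ∈ s, 2 ^ (i.1 + N) * ((s.sup fun i => Finset.Iic (i.1 + N, i.2)).sup
          (schwartzSeminormFamily ℝ (V × E) F)) G := by
        refine mul_le_mul_of_nonneg_left (Finset.sum_le_sum fun i hi => ?_) hC
        refine (seminorm_slice_le i.1 i.2 N G y).trans ?_
        gcongr
        exact Seminorm.le_def.mp (Finset.sup_mono
          (Finset.le_sup (f := fun i : ℕ × ℕ => Finset.Iic (i.1 + N, i.2)) hi)) G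
    _ = _ := by rw [← Finset.sum_mul]; ring

end Slice

/-! ### Partial integrals of Schwartz functions -/

section PartialIntegral

variable {V E F : Type*} [NormedAddCommGroup V] [NormedSpace ℝ V]
  [NormedAddCommGroup E] [NormedSpace ℝ E]
  [NormedAddCommGroup F] [NormedSpace ℝ F] [NormedSpace ℂ F] [SMulCommClass ℝ ℂ F]

/-- The derivatives at a point, as continuous linear maps on the Schwartz space. -/
def derivAt (l : ℕ) (x : E) : 𝓢(E, F) →L[ℝ] (E [×l]→L[ℝ] F) :=
  mkCLMtoNormedSpace (𝕜 := ℝ) (𝕜' := ℝ) (σ := RingHom.id ℝ) (fun f => iteratedFDeriv ℝ l f x)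
    (fun f g => iteratedFDeriv_add_apply (f.smooth l).contDiffAt (g.smooth l).contDiffAt)
    (fun a f => iteratedFDeriv_const_smul_apply (f.smooth l).contDiffAt)
    ⟨{(0, l)}, 1, zero_le_one, fun f => by
      simpa using SchwartzMap.norm_iteratedFDeriv_le_seminorm ℝ f l x⟩

@[simp]
theorem derivAt_apply (l : ℕ) (x : E) (f : 𝓢(E, F)) :
    derivAt l x f = iteratedFDeriv ℝ l f x := rfl

/-- Bounded continuous functions with values in the `l`-linear maps. -/
def BddMultilinear (E F : Type*) [NormedAddCommGroup E] [NormedSpace ℝ E] [NormedAddCommGroup F]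
    [NormedSpace ℝ F] (l : ℕ) : Type _ :=
  BoundedContinuousFunction E (E [×l]→L[ℝ] F)

instance (l : ℕ) : NormedAddCommGroup (BddMultilinear E F l) :=
  inferInstanceAs (NormedAddCommGroup (BoundedContinuousFunction E (E [×l]→L[ℝ] F)))

instance (l : ℕ) : NormedSpace ℝ (BddMultilinear E F l) :=
  inferInstanceAs (NormedSpace ℝ (BoundedContinuousFunction E (E [×l]→L[ℝ] F)))

instance (l : ℕ) [CompleteSpace F] : CompleteSpace (BddMultilinear E F l) :=
  inferInstanceAs (CompleteSpace (BoundedContinuousFunction E (E [×l]→L[ℝ] F)))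

instance (l : ℕ) : FunLike (BddMultilinear E F l) E (E [×l]→L[ℝ] F) :=
  inferInstanceAs (FunLike (BoundedContinuousFunction E (E [×l]→L[ℝ] F)) E (E [×l]→L[ℝ] F))

theorem BddMultilinear.norm_coe_le_norm {l : ℕ} (b : BddMultilinear E F l) (x : E) :
    ‖b x‖ ≤ ‖b‖ :=
  BoundedContinuousFunction.norm_coe_le_norm (α := E) (β := E [×l]→L[ℝ] F) b x

theorem BddMultilinear.ext {l : ℕ} {b b' : BddMultilinear E F l} (h : ∀ x, b x = b' x) : b = b' :=
  DFunLike.ext (F := BoundedContinuousFunction E (E [×l]→L[ℝ] F)) _ _ h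

/-- Evaluation at a point. -/
def BddMultilinear.eval (l : ℕ) (x : E) : BddMultilinear E F l →L[ℝ] (E [×l]→L[ℝ] F) :=
  LinearMap.mkContinuous
    { toFun := fun b => b x
      map_add' := fun _ _ => rfl
      map_smul' := fun _ _ => rfl } 1 (fun b => by
      rw [one_mul]; exact b.norm_coe_le_norm x)

/-- The bounded continuous function `x ↦ ‖x‖ᵏ Dˡ f(x)`. -/
def weightedDerivFun (k l : ℕ) (f : 𝓢(E, F)) : BddMultilinear E F l :=
  BoundedContinuousFunction.ofNormedAddCommGroup
      (fun x => ‖x‖ ^ k • iteratedFDeriv ℝ l f x)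
      ((continuous_norm.pow k).smul ((f.smooth l).continuous_iteratedFDeriv le_rfl))
      (SchwartzMap.seminorm ℝ k l f)
      (fun x => by
        rw [norm_smul, norm_pow, norm_norm]
        exact SchwartzMap.le_seminorm ℝ k l f x)

theorem weightedDerivFun_apply (k l : ℕ) (f : 𝓢(E, F)) (x : E) :
    weightedDerivFun k l f x = ‖x‖ ^ k • derivAt l x f := rfl

/-- The map `f ↦ (x ↦ ‖x‖ᵏ Dˡ f(x))` on the Schwartz space. -/
def weightedDeriv (k l : ℕ) : 𝓢(E, F) →L[ℝ] BddMultilinear E F l :=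
  mkCLMtoNormedSpace (𝕜 := ℝ) (𝕜' := ℝ) (σ := RingHom.id ℝ) (weightedDerivFun k l)
    (fun f g => BddMultilinear.ext fun x => by
      rw [weightedDerivFun_apply, map_add, smul_add]; rfl)
    (fun a f => BddMultilinear.ext fun x => by
      rw [weightedDerivFun_apply, map_smul, smul_comm]; rfl)
    ⟨{(k, l)}, 1, zero_le_one, fun f => by
      rw [Finset.sup_singleton, schwartzSeminormFamily_apply, one_mul]
      exact BoundedContinuousFunction.norm_ofNormedAddCommGroup_le (α := E)
        (β := E [×l]→L[ℝ] F) _ (apply_nonneg _ _) fun x => by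
          rw [norm_smul, norm_pow, norm_norm]
          exact SchwartzMap.le_seminorm ℝ k l f x⟩

@[simp]
theorem weightedDeriv_apply (k l : ℕ) (f : 𝓢(E, F)) (x : E) :
    weightedDeriv k l f x = ‖x‖ ^ k • iteratedFDeriv ℝ l f x := rfl

theorem seminorm_le_norm_weightedDeriv (k l : ℕ) (f : 𝓢(E, F)) :
    SchwartzMap.seminorm ℝ k l f ≤ ‖weightedDeriv k l f‖ := by
  refine SchwartzMap.seminorm_le_bound ℝ k l f (norm_nonneg _) fun x => ?_
  have := (weightedDeriv k l f).norm_coe_le_norm x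
  rwa [weightedDeriv_apply, norm_smul, norm_pow, norm_norm] at this

variable [MeasurableSpace V] [BorelSpace V] [SecondCountableTopology V]
  (μ : Measure V) [μ.HasTemperateGrowth] [CompleteSpace F]

/-- The exponent is the one for which the right-hand side is integrable, so this provides the
dominating function for every integral over slices. -/
theorem exists_slice_bound_rpow {H : Type*} [NormedAddCommGroup H] [NormedSpace ℝ H]
    (a : 𝓢(E, F) →L[ℝ] H) : ∃ (s : Finset (ℕ × ℕ)) (C : ℝ), 0 ≤ C ∧
      ∀ (G : 𝓢(V × E, F)) (y : V), ‖a (slice y G)‖ ≤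
        C * s.sup (schwartzSeminormFamily ℝ (V × E) F) G *
          (1 + ‖y‖) ^ (-(μ.integrablePower : ℝ)) := by
  obtain ⟨s, C, hC, h⟩ := exists_slice_bound (V := V) a μ.integrablePower
  refine ⟨s, C, hC, fun G y => ?_⟩
  have hpos : 0 < (1 + ‖y‖) ^ μ.integrablePower := by positivity
  rw [Real.rpow_neg (by positivity), Real.rpow_natCast, ← div_eq_mul_inv, le_div_iff₀' hpos]
  exact h G y

theorem integrable_slice {H : Type*} [NormedAddCommGroup H] [NormedSpace ℝ H]
    (a : 𝓢(E, F) →L[ℝ] H) (G : 𝓢(V × E, F)) : Integrable (fun y => a (slice y G)) μ := by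
  obtain ⟨s, C, hC, h⟩ := exists_slice_bound_rpow μ a
  refine ((Measure.integrable_pow_neg_integrablePower μ).const_mul
    (C * s.sup (schwartzSeminormFamily ℝ (V × E) F) G)).mono'
    (a.continuous.comp (continuous_slice G)).aestronglyMeasurable ?_
  exact Filter.Eventually.of_forall fun y => h G y

theorem hasFDerivAt_integral_iteratedFDeriv_slice (G : 𝓢(V × E, F)) (l : ℕ) (x : E) :
    HasFDerivAt (fun x => ∫ y, iteratedFDeriv ℝ l (slice y G) x ∂μ)
      (∫ y, fderiv ℝ (iteratedFDeriv ℝ l (slice y G)) x ∂μ) x ∧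
    Integrable (fun y => fderiv ℝ (iteratedFDeriv ℝ l (slice y G)) x) μ := by
  -- With weight 0, the sup norm of `weightedDeriv` bounds the derivative at all `x` simultaneously,
  -- as differentiation under the integral requires.
  obtain ⟨s, C, hC, h⟩ := exists_slice_bound_rpow (V := V) μ
    (weightedDeriv (E := E) (F := F) 0 (l + 1))
  have hb : ∀ (x : E) (y : V), ‖fderiv ℝ (iteratedFDeriv ℝ l (slice y G)) x‖ ≤
      C * s.sup (schwartzSeminormFamily ℝ (V × E) F) G *
          (1 + ‖y‖) ^ (-(μ.integrablePower : ℝ)) := by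
    intro x y
    rw [norm_fderiv_iteratedFDeriv]
    refine le_trans ?_ (h G y)
    have := (weightedDeriv 0 (l + 1) (slice y G)).norm_coe_le_norm x
    simpa using this
  have hm : AEStronglyMeasurable (fun y => fderiv ℝ (iteratedFDeriv ℝ l (slice y G)) x) μ := by
    have : Continuous fun y => continuousMultilinearCurryLeftEquiv ℝ (fun _ : Fin (l + 1) => E) F
          (derivAt (l + 1) x (slice y G)) :=
      (LinearIsometryEquiv.continuous _).comp
          ((derivAt (l + 1) x).continuous.comp (continuous_slice G))
    refine Continuous.aestronglyMeasurable (this.congr fun y => ?_)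
    rw [derivAt_apply, fderiv_iteratedFDeriv]
    rfl
  refine ⟨hasFDerivAt_integral_of_dominated_of_fderiv_le (𝕜 := ℝ) (μ := μ) (x₀ := x)
      (s := Set.univ) (F := fun x y => iteratedFDeriv ℝ l (slice y G) x)
      (F' := fun x y => fderiv ℝ (iteratedFDeriv ℝ l (slice y G)) x)
      (bound := fun y => C * s.sup (schwartzSeminormFamily ℝ (V × E) F) G *
          (1 + ‖y‖) ^ (-(μ.integrablePower : ℝ))) Filter.univ_mem
      (Filter.Eventually.of_forall fun x =>
        (integrable_slice μ (derivAt l x) G).aestronglyMeasurable)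
      (integrable_slice μ (derivAt l x) G) hm
      (Filter.Eventually.of_forall fun y x _ => hb x y)
      ((Measure.integrable_pow_neg_integrablePower μ).const_mul _)
      (Filter.Eventually.of_forall fun y x _ =>
        (((slice y G).smooth ⊤).differentiable_iteratedFDeriv
          (by exact_mod_cast WithTop.coe_lt_top l) x).hasFDerivAt), ?_⟩
  exact ((Measure.integrable_pow_neg_integrablePower μ).const_mul _).mono' hm
    (Filter.Eventually.of_forall fun y => hb x y)

theorem iteratedFDeriv_partialIntegral (G : 𝓢(V × E, F)) (l : ℕ) :
    iteratedFDeriv ℝ l (fun x => ∫ y, G (y, x) ∂μ) =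
        fun x => ∫ y, iteratedFDeriv ℝ l (slice y G) x ∂μ := by
  induction l with
  | zero =>
    funext x
    ext v
    refine Eq.trans ?_ (ContinuousMultilinearMap.integral_apply
      (integrable_slice μ (derivAt 0 x) G) v).symm
    simp
  | succ l ih =>
    funext x
    obtain ⟨h1, h2⟩ := hasFDerivAt_integral_iteratedFDeriv_slice μ G l x
    ext v
    rw [iteratedFDeriv_succ_apply_left, ih, h1.fderiv, ContinuousLinearMap.integral_apply h2,
      ContinuousMultilinearMap.integral_apply (h2.apply_continuousLinearMap _)]
    exact (ContinuousMultilinearMap.integral_apply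
      (integrable_slice μ (derivAt (l + 1) x) G) v).symm

/-- The Schwartz function `x ↦ ∫ G(y, x) dy`. -/
def pint (G : 𝓢(V × E, F)) : 𝓢(E, F) where
  toFun x := ∫ y, G (y, x) ∂μ
  smooth' := contDiff_of_differentiable_iteratedFDeriv fun l _ x =>
    by
      rw [iteratedFDeriv_partialIntegral μ G l]
      exact (hasFDerivAt_integral_iteratedFDeriv_slice μ G l x).1.differentiableAt
  decay' k l := by
    obtain ⟨s, C, hC, h⟩ := exists_slice_bound_rpow (V := V) μ (weightedDeriv (E := E) (F := F) k l)
    refine ⟨∫ y, C * s.sup (schwartzSeminormFamily ℝ (V × E) F) G *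
          (1 + ‖y‖) ^ (-(μ.integrablePower : ℝ)) ∂μ, fun x => ?_⟩
    rw [iteratedFDeriv_partialIntegral μ G l]
    have : ‖x‖ ^ k * ‖∫ y, iteratedFDeriv ℝ l (slice y G) x ∂μ‖ =
        ‖∫ y, weightedDeriv k l (slice y G) x ∂μ‖ := by
      simp only [weightedDeriv_apply]
      rw [integral_smul, norm_smul, norm_pow, norm_norm]
    rw [this]
    refine norm_integral_le_of_norm_le ((Measure.integrable_pow_neg_integrablePower μ).const_mul _) ?_
    exact Filter.Eventually.of_forall fun y =>
      ((weightedDeriv k l (slice y G)).norm_coe_le_norm x).trans (h G y)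

@[simp]
theorem pint_apply (G : 𝓢(V × E, F)) (x : E) : pint μ G x = ∫ y, G (y, x) ∂μ := rfl

theorem integral_weightedDeriv_slice (k l : ℕ) (G : 𝓢(V × E, F)) :
    ∫ y, weightedDeriv k l (slice y G) ∂μ = weightedDeriv k l (pint μ G) := by
  refine BddMultilinear.ext fun x => ?_
  have h := (BddMultilinear.eval (F := F) l x).integral_comp_comm
      (integrable_slice μ (weightedDeriv k l) G)
  refine Eq.trans h.symm ?_
  change ∫ y, ‖x‖ ^ k • iteratedFDeriv ℝ l (slice y G) x ∂μ =
    ‖x‖ ^ k • iteratedFDeriv ℝ l (fun x => ∫ y, G (y, x) ∂μ) x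
  rw [integral_smul, iteratedFDeriv_partialIntegral μ G l]

/-- Continuous linear maps commute with partial integrals. -/
theorem integral_slice {H : Type*} [NormedAddCommGroup H] [NormedSpace ℝ H] [CompleteSpace H]
    (a : 𝓢(E, F) →L[ℝ] H) (G : 𝓢(V × E, F)) :
    ∫ y, a (slice y G) ∂μ = a (pint μ G) := by
  obtain ⟨s, C, hC, h⟩ := exists_seminorm_bound a
  -- Schwartz space is not normed, so the finitely many seminorms that control `a` are recorded by a
  -- map `ι` into a Banach space, with ‖a f‖ ≤ C ‖ι f‖.
  let ι : 𝓢(E, F) →L[ℝ] ((i : s) → BddMultilinear E F i.1.2) :=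
    ContinuousLinearMap.pi fun i => weightedDeriv i.1.1 i.1.2
  have hι : ∀ f, ‖a f‖ ≤ C * ‖ι f‖ := by
    intro f
    refine (h f).trans (mul_le_mul_of_nonneg_left ?_ hC)
    refine Seminorm.finset_sup_apply_le (norm_nonneg _) fun i hi => ?_
    exact (seminorm_le_norm_weightedDeriv i.1 i.2 f).trans (norm_le_pi_norm (ι f) ⟨i, hi⟩)
  have hιint : ∫ y, ι (slice y G) ∂μ = ι (pint μ G) := by
    funext i
    have := (ContinuousLinearMap.proj (R := ℝ)
      (φ := fun i : s => BddMultilinear E F i.1.2) i).integral_comp_comm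
        (integrable_slice μ ι G)
    refine this.symm.trans ?_
    exact integral_weightedDeriv_slice μ i.1.1 i.1.2 G
  -- The integral of (ι, a) over the slices lies in the closure of the pairs (ι f, a f). These
  -- satisfy the closed condition ‖a f - a(pint G)‖ ≤ C ‖ι f - ι(pint G)‖. The integral has first
  -- component ι(pint G), so the condition forces its second component to be a(pint G).
  let c := ι.prod a
  have hmem := integral_mem_closure_submodule (LinearMap.range c.toLinearMap)
    (integrable_slice μ c G) (fun y => ⟨slice y G, rfl⟩)
  have hc : ∫ y, c (slice y G) ∂μ = (ι (pint μ G), ∫ y, a (slice y G) ∂μ) := by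
    have := integral_pair (integrable_slice μ ι G) (integrable_slice μ a G)
    rw [hιint] at this
    exact this
  rw [hc] at hmem
  have hcl : IsClosed {z : ((i : s) → BddMultilinear E F i.1.2) × H |
      ‖z.2 - a (pint μ G)‖ ≤ C * ‖z.1 - ι (pint μ G)‖} :=
    isClosed_le (by fun_prop) (by fun_prop)
  have hsub := closure_minimal (t := {z : ((i : s) →
      BddMultilinear E F i.1.2) × H |
      ‖z.2 - a (pint μ G)‖ ≤ C * ‖z.1 - ι (pint μ G)‖}) (by
    rintro _ ⟨f, rfl⟩
    change ‖a f - a (pint μ G)‖ ≤ C * ‖ι f - ι (pint μ G)‖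
    rw [← map_sub, ← map_sub]
    exact hι _) hcl hmem
  simpa [sub_eq_zero] using hsub

end PartialIntegral

/-! ### Density of compactly supported functions and of tensor products -/

/-! ### Continuity of the tensor product in each factor -/

section Tensor

variable {E F : Type*} [NormedAddCommGroup E] [NormedSpace ℝ E]
  [NormedAddCommGroup F] [NormedSpace ℝ F]

/-- Leibniz rule with a bound explicit in the seminorms of both factors, from which continuity in
one factor can be read off. -/
theorem norm_iteratedFDeriv_tensor_le (f : 𝓢(E, ℂ)) (g : 𝓢(F, ℂ)) (k n : ℕ) (z : E × F) :
    ‖z‖ ^ k * ‖iteratedFDeriv ℝ n (tensor f g) z‖ ≤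
      ∑ i ∈ Finset.range (n + 1), (n.choose i : ℝ) *
        (SchwartzMap.seminorm ℝ k i f * SchwartzMap.seminorm ℝ 0 (n - i) g +
          SchwartzMap.seminorm ℝ 0 i f * SchwartzMap.seminorm ℝ k (n - i) g) := by
  have h1 : ContDiff ℝ n (fun z : E × F => f z.1) := (f.smooth n).comp contDiff_fst
  have h2 : ContDiff ℝ n (fun z : E × F => g z.2) := (g.smooth n).comp contDiff_snd
  have hm := norm_iteratedFDeriv_mul_le h1 h2 z (n := n) le_rfl
  have e1 : ∀ i, ‖iteratedFDeriv ℝ i (fun z : E × F => f z.1) z‖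
      ≤ ‖iteratedFDeriv ℝ i f z.1‖ := by
    intro i
    have h' : (fun z : E × F => f z.1) = f ∘ (ContinuousLinearMap.fst ℝ E F) := rfl
    rw [h', (ContinuousLinearMap.fst ℝ E F).iteratedFDeriv_comp_right (f.smooth i) z le_rfl]
    refine (ContinuousMultilinearMap.norm_compContinuousLinearMap_le _ _).trans ?_
    refine mul_le_of_le_one_right (norm_nonneg _) ?_
    exact Finset.prod_le_one (fun _ _ => norm_nonneg _)
      (fun _ _ => ContinuousLinearMap.norm_fst_le ℝ E F)
  have e2 : ∀ i, ‖iteratedFDeriv ℝ i (fun z : E × F => g z.2) z‖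
      ≤ ‖iteratedFDeriv ℝ i g z.2‖ := by
    intro i
    have h' : (fun z : E × F => g z.2) = g ∘ (ContinuousLinearMap.snd ℝ E F) := rfl
    rw [h', (ContinuousLinearMap.snd ℝ E F).iteratedFDeriv_comp_right (g.smooth i) z le_rfl]
    refine (ContinuousMultilinearMap.norm_compContinuousLinearMap_le _ _).trans ?_
    refine mul_le_of_le_one_right (norm_nonneg _) ?_
    exact Finset.prod_le_one (fun _ _ => norm_nonneg _)
      (fun _ _ => ContinuousLinearMap.norm_snd_le ℝ E F)
  refine (mul_le_mul_of_nonneg_left hm (by positivity)).trans ?_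
  rw [Finset.mul_sum]
  refine Finset.sum_le_sum fun i hi => ?_
  have hz : ‖z‖ ^ k ≤ ‖z.1‖ ^ k + ‖z.2‖ ^ k := by
    rw [Prod.norm_def]
    rcases le_total ‖z.1‖ ‖z.2‖ with h | h
    · rw [max_eq_right h]; linarith [pow_nonneg (norm_nonneg z.1) k]
    · rw [max_eq_left h]; linarith [pow_nonneg (norm_nonneg z.2) k]
  have b1 := e1 i
  have b2 := e2 (n - i)
  have hA0 := SchwartzMap.norm_iteratedFDeriv_le_seminorm ℝ f i z.1
  have hB0 := SchwartzMap.norm_iteratedFDeriv_le_seminorm ℝ g (n - i) z.2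
  have hAk := SchwartzMap.le_seminorm ℝ k i f z.1
  have hBk := SchwartzMap.le_seminorm ℝ k (n - i) g z.2
  calc ‖z‖ ^ k * (↑(n.choose i) * ‖iteratedFDeriv ℝ i (fun z : E × F => f z.1) z‖ *
        ‖iteratedFDeriv ℝ (n - i) (fun z : E × F => g z.2) z‖)
      ≤ (‖z.1‖ ^ k + ‖z.2‖ ^ k) *
        (↑(n.choose i) * ‖iteratedFDeriv ℝ i f z.1‖ * ‖iteratedFDeriv ℝ (n - i) g z.2‖) := by
        gcongr
    _ = ↑(n.choose i) * ((‖z.1‖ ^ k * ‖iteratedFDeriv ℝ i f z.1‖) *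
          ‖iteratedFDeriv ℝ (n - i) g z.2‖ + ‖iteratedFDeriv ℝ i f z.1‖ *
          (‖z.2‖ ^ k * ‖iteratedFDeriv ℝ (n - i) g z.2‖)) := by ring
    _ ≤ _ := by gcongr

/-- The map `g ↦ f ⊗ g`. -/
def tensorCLM (f : 𝓢(E, ℂ)) : 𝓢(F, ℂ) →L[ℂ] 𝓢(E × F, ℂ) :=
  mkCLM (𝕜 := ℂ) (𝕜' := ℂ) (σ := RingHom.id ℂ) (fun g => ⇑(tensor f g))
    (fun g g' z => by simp [mul_add]) (fun a g z => by simp [mul_left_comm])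
    (fun g => (tensor f g).smooth ⊤) (by
      rintro ⟨k, n⟩
      refine ⟨Finset.Iic (k, n), ∑ i ∈ Finset.range (n + 1), (n.choose i : ℝ) *
        (SchwartzMap.seminorm ℝ k i f + SchwartzMap.seminorm ℝ 0 i f),
        Finset.sum_nonneg fun _ _ => by positivity, fun g z => ?_⟩
      refine (norm_iteratedFDeriv_tensor_le f g k n z).trans ?_
      rw [Finset.sum_mul]
      refine Finset.sum_le_sum fun i hi => ?_
      have hle : ∀ k' ≤ k, SchwartzMap.seminorm ℝ k' (n - i) g ≤
          (Finset.Iic (k, n)).sup (schwartzSeminormFamily ℂ F ℂ) g := fun k' hk' =>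
        Seminorm.le_def.mp (Finset.le_sup (f := schwartzSeminormFamily ℂ F ℂ)
          (Finset.mem_Iic.mpr (Prod.mk_le_mk.mpr ⟨hk', Nat.sub_le n i⟩) :
            (k', n - i) ∈ Finset.Iic (k, n))) g
      have h0 := hle 0 (Nat.zero_le _)
      have h1 := hle k le_rfl
      rw [mul_assoc, add_mul]
      gcongr)

@[simp]
theorem tensorCLM_apply (f : 𝓢(E, ℂ)) (g : 𝓢(F, ℂ)) : tensorCLM f g = tensor f g := rfl

/-- Exchange of the two variables. -/
def swapCLM : 𝓢(E × F, ℂ) →L[ℂ] 𝓢(F × E, ℂ) :=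
  compCLMOfContinuousLinearEquiv ℂ (ContinuousLinearEquiv.prodComm ℝ F E)

/-- The map `f ↦ f ⊗ g`. -/
def tensorCLMRight (g : 𝓢(F, ℂ)) : 𝓢(E, ℂ) →L[ℂ] 𝓢(E × F, ℂ) :=
  swapCLM.comp (tensorCLM g)

@[simp]
theorem tensorCLMRight_apply (g : 𝓢(F, ℂ)) (f : 𝓢(E, ℂ)) : tensorCLMRight g f = tensor f g := by
  ext z
  change g z.2 * f z.1 = f z.1 * g z.2
  ring

end Tensor

/-! ### Cutoffs and density of compactly supported functions -/

section Cutoff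

variable {E : Type*} [NormedAddCommGroup E] [NormedSpace ℝ E] [FiniteDimensional ℝ E]

/-- A smooth, compactly supported cutoff function, as a Schwartz function. -/
def bumpS (c : E) (χ : ContDiffBump c) : 𝓢(E, ℂ) :=
  HasCompactSupport.toSchwartzMap (f := fun x => (χ x : ℂ))
    (χ.hasCompactSupport.comp_left (g := fun t : ℝ => (t : ℂ)) Complex.ofReal_zero)
    (Complex.ofRealCLM.contDiff.comp χ.contDiff)

@[simp]
theorem bumpS_apply (c : E) (χ : ContDiffBump c) (x : E) : bumpS c χ x = (χ x : ℂ) := rfl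

theorem exists_cutoff (K : Set E) (hK : IsCompact K) :
    ∃ χ : 𝓢(E, ℂ), HasCompactSupport χ ∧ ∀ x ∈ K, χ x = 1 := by
  obtain ⟨R, hR, h⟩ := hK.isBounded.exists_pos_norm_le
  let χ : ContDiffBump (0 : E) := ⟨R, R + 1, hR, by linarith⟩
  refine ⟨bumpS 0 χ, χ.hasCompactSupport.comp_left (g := fun t : ℝ => (t : ℂ))
    Complex.ofReal_zero, fun x hx => ?_⟩
  rw [bumpS_apply, χ.one_of_mem_closedBall (by simpa using h x hx), Complex.ofReal_one]

/-- The error lives in ‖x‖ ≥ R, where inserting the factor ‖x‖ / R ≥ 1 gains 1 / R for one extra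
weight on `f`. Derivatives of the dilated cutoff stay bounded because R ≥ 1. -/
theorem exists_bound_cutoff_sub (χ : 𝓢(E, ℂ)) (hχ : ∀ x : E, ‖x‖ ≤ 1 → χ x = 1)
    (f : 𝓢(E, ℂ)) (k n : ℕ) : ∃ C : ℝ, 0 ≤ C ∧ ∀ R : ℝ, 1 ≤ R → ∀ x : E,
      ‖x‖ ^ k * ‖iteratedFDeriv ℝ n (fun x => (1 - χ (R⁻¹ • x)) * f x) x‖ ≤ C / R := by
  refine ⟨∑ i ∈ Finset.range (n + 1), (n.choose i : ℝ) *
    ((1 + SchwartzMap.seminorm ℝ 0 i χ) * SchwartzMap.seminorm ℝ (k + 1) (n - i) f),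
    Finset.sum_nonneg fun _ _ => by positivity, fun R hR x => ?_⟩
  have hR0 : 0 < R := by linarith
  rcases lt_or_ge ‖x‖ R with hx | hx
  · have : (fun x => (1 - χ (R⁻¹ • x)) * f x) =ᶠ[nhds x] fun _ => 0 := by
      filter_upwards [(continuous_norm.tendsto x).eventually (gt_mem_nhds hx)] with y hy
      rw [hχ, sub_self, zero_mul]
      rw [norm_smul, Real.norm_of_nonneg (by positivity), inv_mul_le_one₀ hR0]
      exact hy.le
    rw [(Filter.EventuallyEq.iteratedFDeriv (𝕜 := ℝ) this n).eq_of_nhds]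
    simp only [iteratedFDeriv_fun_zero, Pi.zero_apply, norm_zero, mul_zero]
    exact div_nonneg (Finset.sum_nonneg fun _ _ => by positivity) hR0.le
  have hx1 : 1 ≤ ‖x‖ / R := by rwa [one_le_div hR0]
  have hu : ContDiff ℝ n (fun x : E => 1 - χ (R⁻¹ • x)) :=
    contDiff_const.sub ((χ.smooth n).comp (contDiff_const_smul _))
  have hm := norm_iteratedFDeriv_mul_le hu (f.smooth n) x (n := n) le_rfl
  have hub : ∀ i, ‖iteratedFDeriv ℝ i (fun x : E => 1 - χ (R⁻¹ • x)) x‖ ≤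
      1 + SchwartzMap.seminorm ℝ 0 i χ := by
    intro i
    have h1 : ContDiff ℝ i (fun _ : E => (1 : ℂ)) := contDiff_const
    have h2 : ContDiff ℝ i (fun x : E => χ (R⁻¹ • x)) :=
      (χ.smooth i).comp (contDiff_const_smul _)
    have heq : (fun x : E => 1 - χ (R⁻¹ • x)) = (fun _ : E => (1 : ℂ)) - fun x => χ (R⁻¹ • x) := rfl
    rw [heq, iteratedFDeriv_sub_apply h1.contDiffAt h2.contDiffAt]
    refine (norm_sub_le _ _).trans (add_le_add ?_ ?_)
    · rcases Nat.eq_zero_or_pos i with rfl | hi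
      · simp
      · rw [iteratedFDeriv_const_of_ne hi.ne']; simp
    · have h3 : (fun x : E => χ (R⁻¹ • x)) =
          χ ∘ (R⁻¹ • ContinuousLinearMap.id ℝ E : E →L[ℝ] E) := by
        funext x; simp
      rw [h3, ContinuousLinearMap.iteratedFDeriv_comp_right _ (χ.smooth i) x le_rfl]
      refine (ContinuousMultilinearMap.norm_compContinuousLinearMap_le _ _).trans ?_
      refine (mul_le_of_le_one_right (norm_nonneg _) ?_).trans
        (SchwartzMap.norm_iteratedFDeriv_le_seminorm ℝ χ i _)
      refine Finset.prod_le_one (fun _ _ => norm_nonneg _) fun _ _ => ?_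
      refine ContinuousLinearMap.opNorm_le_bound _ zero_le_one fun y => ?_
      simp only [smul_apply, ContinuousLinearMap.id_apply, norm_smul, one_mul]
      rw [Real.norm_of_nonneg (by positivity)]
      exact mul_le_of_le_one_left (norm_nonneg _) (inv_le_one_of_one_le₀ hR)
  refine (mul_le_mul_of_nonneg_left hm (by positivity)).trans ?_
  rw [Finset.mul_sum, Finset.sum_div]
  refine Finset.sum_le_sum fun i _ => ?_
  have h4 := SchwartzMap.le_seminorm ℝ (k + 1) (n - i) f x
  have h5 := hub i
  calc ‖x‖ ^ k * (↑(n.choose i) * ‖iteratedFDeriv ℝ i (fun x : E => 1 - χ (R⁻¹ • x)) x‖ *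
        ‖iteratedFDeriv ℝ (n - i) f x‖)
      ≤ ‖x‖ ^ k * (↑(n.choose i) * ‖iteratedFDeriv ℝ i (fun x : E => 1 - χ (R⁻¹ • x)) x‖ *
        ‖iteratedFDeriv ℝ (n - i) f x‖) * (‖x‖ / R) :=
        le_mul_of_one_le_right (by positivity) hx1
    _ = ↑(n.choose i) * (‖iteratedFDeriv ℝ i (fun x : E => 1 - χ (R⁻¹ • x)) x‖ *
        (‖x‖ ^ (k + 1) * ‖iteratedFDeriv ℝ (n - i) f x‖)) / R := by ring
    _ ≤ _ := by gcongr

/-- The products χ(x / (N + 1)) f(x) converge to f at rate 1 / (N + 1) in each seminorm. -/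
theorem dense_hasCompactSupport : Dense {f : 𝓢(E, ℂ) | HasCompactSupport f} := by
  obtain ⟨χ, hχc, hχ⟩ := exists_cutoff (Metric.closedBall (0 : E) 1) (isCompact_closedBall 0 1)
  intro f
  let e : ℕ → (E ≃L[ℝ] E) := fun N => ContinuousLinearEquiv.smulLeft
    (Units.mk0 ((N : ℝ) + 1)⁻¹ (by positivity))
  let u : ℕ → 𝓢(E, ℂ) := fun N =>
    smulLeftCLM ℂ (compCLMOfContinuousLinearEquiv ℂ (e N) χ : E → ℂ) f
  have hu : ∀ N x, u N x = χ (((N : ℝ) + 1)⁻¹ • x) * f x := by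
    intro N x
    simp only [u]
    rw [smulLeftCLM_apply_apply (SchwartzMap.hasTemperateGrowth _)]
    rfl
  refine mem_closure_of_tendsto (f := u) (b := Filter.atTop) ?_ (Filter.Eventually.of_forall ?_)
  · refine ((schwartz_withSeminorms ℝ E ℂ).tendsto_nhds' _ _).mpr fun s ε hε => ?_
    choose C hC0 hC using exists_bound_cutoff_sub χ (fun x hx => hχ x (by simpa using hx)) f
    have hb : ∀ N : ℕ, s.sup (schwartzSeminormFamily ℝ E ℂ) (u N - f) ≤
        (∑ i ∈ s, C i.1 i.2) * (1 / ((N : ℝ) + 1)) := by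
      intro N
      refine (finset_sup_le_sum_apply _ s _).trans ?_
      rw [Finset.sum_mul]
      refine Finset.sum_le_sum fun i _ => ?_
      rw [mul_one_div]
      refine SchwartzMap.seminorm_le_bound ℝ i.1 i.2 _
        (div_nonneg (hC0 _ _) (by positivity)) fun x => ?_
      have heq : (⇑(u N - f) : E → ℂ) =
          -(fun x => (1 - χ (((N : ℝ) + 1)⁻¹ • x)) * f x) := by
        funext x
        simp only [sub_apply, hu, Pi.neg_apply]
        ring
      rw [heq, iteratedFDeriv_neg_apply, norm_neg]
      exact hC i.1 i.2 _ (by linarith [(Nat.cast_nonneg N : (0 : ℝ) ≤ N)]) x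
    have hlim : Filter.Tendsto (fun N : ℕ => (∑ i ∈ s, C i.1 i.2) * (1 / ((N : ℝ) + 1)))
        Filter.atTop (nhds 0) := by
      simpa using tendsto_one_div_add_atTop_nhds_zero_nat.const_mul (∑ i ∈ s, C i.1 i.2)
    filter_upwards [hlim.eventually (gt_mem_nhds hε)] with N hN
    exact (hb N).trans_lt hN
  · intro N
    have : (⇑(u N) : E → ℂ) = (fun x => χ (e N x)) * ⇑f := by
      funext x
      exact hu N x
    change HasCompactSupport (⇑(u N))
    rw [this]
    exact (hχc.comp_homeomorph (e N).toHomeomorph).mul_right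

end Cutoff

/-! ### Density of finite sums of product functions -/

section Density

variable {E F : Type*} [NormedAddCommGroup E] [NormedSpace ℝ E] [FiniteDimensional ℝ E]
  [NormedAddCommGroup F] [NormedSpace ℝ F] [FiniteDimensional ℝ F]

/-- Fourier inversion writes `f` as a superposition of plane waves, and each plane wave on E × F is
a product. Cutoffs equal to 1 on the projections of the support of `f` make the factors Schwartz
without changing the superposition. -/
theorem exists_partialIntegral_tensor (f : 𝓢(E × F, ℂ)) (hf : HasCompactSupport f) :
    ∃ G : 𝓢(EuclideanSpace ℝ (Fin (Module.finrank ℝ (E × F))) × (E × F), ℂ),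
      pint volume G = f ∧ ∀ ξ, ∃ (a : 𝓢(E, ℂ)) (b : 𝓢(F, ℂ)), slice ξ G = tensor a b := by
  let e : (E × F) ≃L[ℝ] EuclideanSpace ℝ (Fin (Module.finrank ℝ (E × F))) := toEuclidean
  obtain ⟨χ₁, -, h₁⟩ := exists_cutoff (Prod.fst '' tsupport f) (hf.image continuous_fst)
  obtain ⟨χ₂, -, h₂⟩ := exists_cutoff (Prod.snd '' tsupport f) (hf.image continuous_snd)
  let f' := compCLMOfContinuousLinearEquiv ℂ e.symm f
  have hQ : (fun z : EuclideanSpace ℝ (Fin (Module.finrank ℝ (E × F))) × (E × F) =>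
      2 * Real.pi * inner ℝ z.1 (e z.2)).HasTemperateGrowth := by
    have h1 := (innerSL ℝ (E := EuclideanSpace ℝ (Fin (Module.finrank ℝ (E × F))))).bilinear_hasTemperateGrowth
      (ContinuousLinearMap.fst ℝ _ (E × F)).hasTemperateGrowth
      (((e : (E × F) →L[ℝ] _).comp (ContinuousLinearMap.snd ℝ
        (EuclideanSpace ℝ (Fin (Module.finrank ℝ (E × F)))) (E × F))).hasTemperateGrowth)
    exact (Function.HasTemperateGrowth.const (2 * Real.pi)).mul h1
  refine ⟨mulPhase _ hQ (tensor (𝓕 f') (tensor χ₁ χ₂)), ?_, fun ξ => ?_⟩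
  · ext z
    simp only [pint_apply, mulPhase_apply, tensor_apply]
    have hinv : f z = ∫ ξ, Complex.exp (Complex.I *
        ((2 * Real.pi * inner ℝ ξ (e z) : ℝ) : ℂ)) * 𝓕 f' ξ := by
      have h0 : 𝓕⁻ (𝓕 f') = f' := FourierTransform.fourierInv_fourier_eq f'
      have h1 : f z = 𝓕⁻ (𝓕 f') (e z) := by
        rw [h0]; simp [f']
      rw [h1, fourierInv_coe, Real.fourierInv_eq']
      refine integral_congr_ae (Filter.Eventually.of_forall fun ξ => ?_)
      simp only [smul_eq_mul]
      congr 2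
      push_cast
      ring
    by_cases hz : z ∈ tsupport f
    · rw [h₁ _ ⟨z, hz, rfl⟩, h₂ _ ⟨z, hz, rfl⟩, hinv]
      simp
    -- Off the support the cutoffs are arbitrary, but they do not depend on ξ and come out of an
    -- integral whose value is f(z) = 0.
    · have : f z = 0 := image_eq_zero_of_notMem_tsupport hz
      have h3 : ∀ ξ, Complex.exp (Complex.I * ((2 * Real.pi * inner ℝ ξ (e z) : ℝ) : ℂ)) *
          (𝓕 f' ξ * (χ₁ z.1 * χ₂ z.2)) = (χ₁ z.1 * χ₂ z.2) *
          (Complex.exp (Complex.I * ((2 * Real.pi * inner ℝ ξ (e z) : ℝ) : ℂ)) * 𝓕 f' ξ) :=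
        fun ξ => by ring
      simp only [h3]
      rw [integral_const_mul, ← hinv, this, mul_zero]
  · have hQ1 : (fun x : E => 2 * Real.pi * inner ℝ ξ (e (x, 0))).HasTemperateGrowth :=
      ((2 * Real.pi) • (innerSL ℝ ξ).comp ((e : (E × F) →L[ℝ] _).comp
        (ContinuousLinearMap.inl ℝ E F))).hasTemperateGrowth
    have hQ2 : (fun y : F => 2 * Real.pi * inner ℝ ξ (e (0, y))).HasTemperateGrowth :=
      ((2 * Real.pi) • (innerSL ℝ ξ).comp ((e : (E × F) →L[ℝ] _).comp
        (ContinuousLinearMap.inr ℝ E F))).hasTemperateGrowth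
    refine ⟨𝓕 f' ξ • mulPhase _ hQ1 χ₁, mulPhase _ hQ2 χ₂, ?_⟩
    ext z
    have h : e z = e (z.1, 0) + e (0, z.2) := by rw [← map_add]; simp
    simp only [slice_apply, mulPhase_apply, tensor_apply, smul_apply, smul_eq_mul]
    rw [h, inner_add_right, mul_add, Complex.ofReal_add, mul_add, Complex.exp_add]
    ring

/-- By duality: a functional that vanishes on products vanishes on their superpositions by
`integral_slice`, hence on compactly supported functions, which are dense. -/
theorem dense_span_tensor :
    Dense (Submodule.span ℂ {G : 𝓢(E × F, ℂ) | ∃ a b, G = tensor a b} : Set 𝓢(E × F, ℂ)) := by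
  set S := Submodule.span ℂ {G : 𝓢(E × F, ℂ) | ∃ a b, G = tensor a b} with hS
  have hsub : {f : 𝓢(E × F, ℂ) | HasCompactSupport f} ⊆ closure (S : Set 𝓢(E × F, ℂ)) := by
    intro f hf
    by_contra hn
    obtain ⟨u, hu, h0⟩ := exists_dual_of_notMem_closure (S.restrictScalars ℝ) hn
    obtain ⟨G, rfl, hG⟩ := exists_partialIntegral_tensor f hf
    apply hu
    rw [← integral_slice]
    have : ∀ ξ, u (slice ξ G) = 0 := by
      intro ξ
      obtain ⟨a, b, hab⟩ := hG ξ
      rw [hab]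
      exact h0 _ (Submodule.subset_span ⟨a, b, rfl⟩)
    simp [this]
  intro f
  have := closure_mono hsub (dense_hasCompactSupport f)
  rwa [closure_closure] at this

end Density

/-! ### Tensor products of test functions and the Fourier transform -/

/-- The map `g ↦ f ⊗ g`. -/
def prodSCLM {n m : ℕ} (f : 𝓢(X n, ℂ)) : 𝓢(X m, ℂ) →L[ℂ] 𝓢(X (n + m), ℂ) :=
  (compInj (split n m) (split_injective n m)).comp (tensorCLM f)

@[simp]
theorem prodSCLM_apply {n m : ℕ} (f : 𝓢(X n, ℂ)) (g : 𝓢(X m, ℂ)) : prodSCLM f g = prodS f g := rfl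

/-- The map `f ↦ f ⊗ g`. -/
def prodSCLMRight {n m : ℕ} (g : 𝓢(X m, ℂ)) : 𝓢(X n, ℂ) →L[ℂ] 𝓢(X (n + m), ℂ) :=
  (compInj (split n m) (split_injective n m)).comp (tensorCLMRight g)

@[simp]
theorem prodSCLMRight_apply {n m : ℕ} (g : 𝓢(X m, ℂ)) (f : 𝓢(X n, ℂ)) :
    prodSCLMRight g f = prodS f g := by
  simp only [prodSCLMRight, ContinuousLinearMap.comp_apply, tensorCLMRight_apply]
  rfl

/-- The concatenation `ℝ⁴ⁿ × ℝ⁴ᵐ → ℝ⁴⁽ⁿ⁺ᵐ⁾`. -/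
def join (n m : ℕ) (z : X n × X m) : X (n + m) :=
  WithLp.toLp 2 fun i => Fin.addCases (fun a => z.1 (a, i.2)) (fun b => z.2 (b, i.2)) i.1

@[simp]
theorem join_castAdd (n m : ℕ) (z : X n × X m) (a : Fin n) (μ : Fin 4) :
    join n m z (Fin.castAdd m a, μ) = z.1 (a, μ) := by simp [join]

@[simp]
theorem join_natAdd (n m : ℕ) (z : X n × X m) (b : Fin m) (μ : Fin 4) :
    join n m z (Fin.natAdd n b, μ) = z.2 (b, μ) := by simp [join]

@[simp]
theorem split_join (n m : ℕ) (z : X n × X m) : split n m (join n m z) = z := by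
  refine Prod.ext ?_ ?_
  · ext i; simp
  · ext i; simp

@[simp]
theorem join_split (n m : ℕ) (x : X (n + m)) : join n m (split n m x) = x :=
  split_injective n m (split_join n m _)

/-- The concatenation as a linear isometry. -/
def joinIso (n m : ℕ) : WithLp 2 (X n × X m) ≃ₗᵢ[ℝ] X (n + m) where
  toFun z := join n m z.ofLp
  invFun x := WithLp.toLp 2 (split n m x)
  map_add' z w := split_injective n m (by
    rw [map_add]; simp)
  map_smul' c z := split_injective n m (by
    rw [map_smul]; simp)
  left_inv z := by simp
  right_inv x := by simp
  norm_map' z := by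
    change ‖join n m z.ofLp‖ = ‖z‖
    rw [← sq_eq_sq₀ (norm_nonneg _) (norm_nonneg _), WithLp.prod_norm_sq_eq_of_L2,
      EuclideanSpace.norm_sq_eq, EuclideanSpace.norm_sq_eq, EuclideanSpace.norm_sq_eq,
      Fintype.sum_prod_type, Fintype.sum_prod_type, Fintype.sum_prod_type, Fin.sum_univ_add]
    simp

theorem measurePreserving_join (n m : ℕ) : MeasurePreserving (join n m) :=
  (joinIso n m).measurePreserving.comp (WithLp.volume_preserving_toLp (X n) (X m))

theorem measurableEmbedding_join (n m : ℕ) : MeasurableEmbedding (join n m) :=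
  (joinIso n m).toHomeomorph.measurableEmbedding.comp
    (MeasurableEquiv.toLp 2 (X n × X m)).measurableEmbedding

theorem FT_prodS {n m : ℕ} (f : 𝓢(X n, ℂ)) (g : 𝓢(X m, ℂ)) :
    FT (n + m) (prodS f g) = prodS (FT n f) (FT m g) := by
  ext P
  rw [FT_apply, prodS_apply, FT_apply, FT_apply,
    ← (measurePreserving_join n m).integral_comp (measurableEmbedding_join n m),
    mul_mul_mul_comm, ← integral_prod_mul, ← mul_inv, ← pow_add, ← mul_add]
  congr 1
  refine integral_congr_ae (Filter.Eventually.of_forall fun z => ?_)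
  simp only [prodS_apply, split_join]
  rw [mul_mul_mul_comm, ← Complex.exp_add, ← mul_add, ← Complex.ofReal_add]
  congr 4
  rw [Fintype.sum_prod_type, Fintype.sum_prod_type, Fintype.sum_prod_type, Fin.sum_univ_add]
  simp

theorem FT_tprodS_zero (f : Fin 0 → 𝓢(X 1, ℂ)) : FT 0 (tprodS 0 f) = tprodS 0 f := by
  ext P
  have hv : (volume : Measure (X 0)) = Measure.dirac 0 := by
    have h := (EuclideanSpace.volume_preserving_symm_measurableEquiv_toLp (Fin 0 × Fin 4)).symm
    rw [← h.map_eq, volume_pi, Measure.pi_of_empty (x := 0), Measure.map_dirac]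
    congr 1
  rw [FT_apply, hv, integral_dirac]
  simp [tprodS_apply]

theorem FT_tprodS {n : ℕ} (f : Fin n → 𝓢(X 1, ℂ)) :
    FT n (tprodS n f) = tprodS n fun j => FT 1 (f j) := by
  induction n with
  | zero => rw [FT_tprodS_zero]; ext P; simp [tprodS_apply]
  | succ n ih => rw [tprodS, FT_prodS, ih, tprodS]

theorem dense_span_prodS (n m : ℕ) : Dense (Submodule.span ℂ
    {G : 𝓢(X (n + m), ℂ) | ∃ a b, G = prodS a b} : Set 𝓢(X (n + m), ℂ)) := by
  let J : 𝓢(X n × X m, ℂ) →L[ℂ] 𝓢(X (n + m), ℂ) := compInj (split n m) (split_injective n m)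
  have hJ : Function.Surjective J := by
    intro f
    let e : (X n × X m) ≃L[ℝ] X (n + m) := LinearEquiv.toContinuousLinearEquiv
      { toFun := join n m
        invFun := split n m
        map_add' := fun z w => split_injective n m (by rw [map_add]; simp)
        map_smul' := fun c z => split_injective n m (by rw [map_smul]; simp)
        left_inv := fun z => by simp
        right_inv := fun x => by simp }
    refine ⟨compCLMOfContinuousLinearEquiv ℂ e f, ?_⟩
    ext x
    change f (join n m (split n m x)) = f x
    rw [join_split]
  have h := hJ.denseRange.dense_image J.continuous (dense_span_tensor (E := X n) (F := X m))
  refine h.mono ?_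
  rintro _ ⟨G, hG, rfl⟩
  induction hG using Submodule.span_induction with
  | mem G h => obtain ⟨a, b, rfl⟩ := h; exact Submodule.subset_span ⟨a, b, rfl⟩
  | zero => rw [map_zero]; exact Submodule.zero_mem _
  | add G G' _ _ h h' => rw [map_add]; exact Submodule.add_mem _ h h'
  | smul c G _ h => rw [map_smul]; exact Submodule.smul_mem _ c h

/-- Induction on the number of variables: multiplication by a fixed last factor is continuous, so it
carries the closure for `n` into the closure for `n + 1`. -/
theorem dense_span_tprodS (n : ℕ) : Dense (Submodule.span ℂ
    (Set.range (tprodS n)) : Set 𝓢(X n, ℂ)) := by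
  induction n with
  | zero =>
    intro f
    refine subset_closure ?_
    have : f = f 0 • tprodS 0 (fun j => j.elim0) := by
      ext x
      rw [Subsingleton.elim x 0]
      simp [tprodS_apply]
    rw [this]
    exact Submodule.smul_mem _ _ (Submodule.subset_span ⟨_, rfl⟩)
  | succ n ih =>
    have key : ∀ (a : 𝓢(X n, ℂ)) (b : 𝓢(X 1, ℂ)), prodS a b ∈
        (Submodule.span ℂ (Set.range (tprodS (n + 1)))).topologicalClosure := by
      intro a b
      have hmaps : Set.MapsTo (prodSCLMRight (n := n) b)
          (Submodule.span ℂ (Set.range (tprodS n)) : Set 𝓢(X n, ℂ))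
          (Submodule.span ℂ (Set.range (tprodS (n + 1))) : Set 𝓢(X (n + 1), ℂ)) := by
        intro G hG
        induction hG using Submodule.span_induction with
        | mem G h =>
          obtain ⟨f, rfl⟩ := h
          refine Submodule.subset_span ⟨Fin.snoc f b, ?_⟩
          rw [prodSCLMRight_apply, tprodS]
          simp
        | zero => rw [map_zero]; exact Submodule.zero_mem _
        | add G G' _ _ h h' => rw [map_add]; exact Submodule.add_mem _ h h'
        | smul c G _ h => rw [map_smul]; exact Submodule.smul_mem _ c h
      have := map_mem_closure (prodSCLMRight b).continuous (ih a) hmaps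
      rwa [prodSCLMRight_apply] at this
    intro f
    have hle : Submodule.span ℂ {G : 𝓢(X (n + 1), ℂ) | ∃ a b, G = prodS a b} ≤
        (Submodule.span ℂ (Set.range (tprodS (n + 1)))).topologicalClosure := by
      rw [Submodule.span_le]
      rintro _ ⟨a, b, rfl⟩
      exact key a b
    have h1 := closure_mono (SetLike.coe_subset_coe.mpr hle) (dense_span_prodS n 1 f)
    rwa [Submodule.topologicalClosure_coe, closure_closure] at h1

/-! ### Involution and translations in momentum space -/

/-- The involution `f ↦ conj f(-p)`, which is complex conjugation in position space. -/
def starS : 𝓢(X 1, ℂ) →L[ℝ] 𝓢(X 1, ℂ) :=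
  (postcompCLM (𝕜 := ℝ) (Complex.conjCLE : ℂ →L[ℝ] ℂ)).comp
    (compCLMOfContinuousLinearEquiv ℝ (ContinuousLinearEquiv.neg ℝ))

@[simp]
theorem starS_apply (f : 𝓢(X 1, ℂ)) (p : X 1) : starS f p = (starRingEnd ℂ) (f (-p)) := rfl

theorem FT_conj (f : 𝓢(X 1, ℂ)) :
    FT 1 (postcompCLM (𝕜 := ℝ) (Complex.conjCLE : ℂ →L[ℝ] ℂ) f) = starS (FT 1 f) := by
  ext p
  rw [FT_apply, starS_apply, FT_apply, map_mul, ← integral_conj]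
  congr 1
  · rw [map_inv₀, map_pow, Complex.conj_ofReal]
  · refine integral_congr_ae (Filter.Eventually.of_forall fun x => ?_)
    change _ * (starRingEnd ℂ) (f x) = _
    simp only [map_mul, ← Complex.exp_conj, map_neg, Complex.conj_I, Complex.conj_ofReal]
    congr 2
    simp

/-- The Minkowski product on `ℝ⁴`. -/
def mink (y p : X 1) : ℝ := ∑ i, eta i.2 * p i * y i

theorem mink_hasTemperateGrowth {D : Type*} [NormedAddCommGroup D] [NormedSpace ℝ D]
    {u v : D → X 1} (hu : u.HasTemperateGrowth) (hv : v.HasTemperateGrowth) :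
    (fun z => mink (u z) (v z)).HasTemperateGrowth := by
  unfold mink
  refine Function.HasTemperateGrowth.sum fun i _ => ?_
  have h1 := (coord_hasTemperateGrowth i).comp hu
  have h2 := (coord_hasTemperateGrowth i).comp hv
  exact ((Function.HasTemperateGrowth.const (eta i.2)).mul h2).mul h1

/-- The total momentum. -/
def tot (n : ℕ) : X n →L[ℝ] X 1 :=
  LinearMap.toContinuousLinearMap
    { toFun := fun P => WithLp.toLp 2 fun i => ∑ j, P (j, i.2)
      map_add' := fun x y => by ext i; simp [Finset.sum_add_distrib]
      map_smul' := fun a x => by ext i; simp [Finset.mul_sum] }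

@[simp]
theorem tot_apply (n : ℕ) (P : X n) (i : Fin 1 × Fin 4) : tot n P i = ∑ j, P (j, i.2) := rfl

theorem tot_add (n m : ℕ) (P : X (n + m)) :
    tot (n + m) P = tot n (split n m P).1 + tot m (split n m P).2 := by
  ext i
  simp [Fin.sum_univ_add]

theorem tot_one (p : X 1) : tot 1 p = p := by
  ext ⟨j, μ⟩
  have : j = 0 := Subsingleton.elim _ _
  subst this
  simp

theorem tot_eq_sum_pt {n : ℕ} (P : X n) : tot n P = ∑ j, pt P j := by
  ext i
  simp [pt]

theorem mink_add_right (y p q : X 1) : mink y (p + q) = mink y p + mink y q := by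
  simp [mink, ← Finset.sum_add_distrib, mul_add, add_mul]

theorem mink_neg_left (y p : X 1) : mink (-y) p = -mink y p := by
  simp [mink]

/-- The translation by `y`, in momentum space. -/
def transS (n : ℕ) (y : X 1) : 𝓢(X n, ℂ) →L[ℂ] 𝓢(X n, ℂ) :=
  mulPhase (fun P => mink (-y) (tot n P))
    (mink_hasTemperateGrowth (Function.HasTemperateGrowth.const _) (tot n).hasTemperateGrowth)

theorem transS_apply (n : ℕ) (y : X 1) (f : 𝓢(X n, ℂ)) (P : X n) :
    transS n y f P = Complex.exp (Complex.I * (mink (-y) (tot n P) : ℂ)) * f P := rfl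

theorem FT_translate (y : X 1) (f : 𝓢(X 1, ℂ)) :
    FT 1 (compSubConstCLM ℂ y f) = transS 1 y (FT 1 f) := by
  ext p
  have h := integral_add_right_eq_self (μ := (volume : Measure (X 1)))
    (fun x => Complex.exp (-Complex.I * (∑ i, eta i.2 * p i * x i : ℝ)) *
      compSubConstCLM ℂ y f x) y
  rw [FT_apply, ← h, transS_apply, FT_apply, mul_left_comm]
  congr 1
  rw [← integral_const_mul]
  refine integral_congr_ae (Filter.Eventually.of_forall fun x => ?_)
  simp only [compSubConstCLM_apply, add_sub_cancel_right]
  rw [← mul_assoc, ← Complex.exp_add]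
  congr 2
  rw [tot_one, mink_neg_left, mink]
  simp only [PiLp.add_apply, mul_add, Finset.sum_add_distrib]
  push_cast
  ring

theorem transS_tprodS {n : ℕ} (y : X 1) (f : Fin n → 𝓢(X 1, ℂ)) :
    transS n y (tprodS n f) = tprodS n fun j => transS 1 y (f j) := by
  ext P
  rw [transS_apply, tprodS_apply, tprodS_apply]
  simp only [transS_apply, tot_one]
  rw [Finset.prod_mul_distrib, ← Complex.exp_sum, tot_eq_sum_pt]
  congr 2
  rw [← Finset.mul_sum]
  congr 1
  have : ∀ s : Finset (Fin n), mink (-y) (∑ j ∈ s, pt P j) = ∑ j ∈ s, mink (-y) (pt P j) := by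
    intro s
    induction s using Finset.cons_induction with
    | empty => simp [mink]
    | cons a s ha ih => rw [Finset.sum_cons, Finset.sum_cons, mink_add_right, ih]
  rw [this]
  push_cast
  rfl

/-! ### Integrated inner products -/

section Pair

variable {H : Type*} [NormedAddCommGroup H] [InnerProductSpace ℂ H]
variable {V E F : Type*} [NormedAddCommGroup V] [NormedSpace ℝ V] [MeasurableSpace V]
  [BorelSpace V] [SecondCountableTopology V]
  [NormedAddCommGroup E] [NormedSpace ℝ E] [NormedAddCommGroup F] [NormedSpace ℝ F]
  (μ : Measure V) [μ.HasTemperateGrowth]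

theorem continuous_inner_slice (a : 𝓢(E, ℂ) →L[ℂ] H) (d : 𝓢(F, ℂ) →L[ℂ] H) (h : 𝓢(V × E, ℂ))
    (g : 𝓢(V × F, ℂ)) : Continuous fun s => ⟪a (slice s h), d (slice s g)⟫_ℂ :=
  (a.continuous.comp (continuous_slice h)).inner (d.continuous.comp (continuous_slice g))

theorem exists_inner_slice_bound (a : 𝓢(E, ℂ) →L[ℂ] H) (d : 𝓢(F, ℂ) →L[ℂ] H)
    (h : 𝓢(V × E, ℂ)) : ∃ (t : Finset (ℕ × ℕ)) (C : ℝ), 0 ≤ C ∧ ∀ (g : 𝓢(V × F, ℂ)) (s : V),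
      ‖⟪a (slice s h), d (slice s g)⟫_ℂ‖ ≤ C * t.sup (schwartzSeminormFamily ℝ (V × F) ℂ) g *
        (1 + ‖s‖) ^ (-(μ.integrablePower : ℝ)) := by
  obtain ⟨t, C, hC, hd⟩ := exists_slice_bound_rpow (V := V) μ (d.restrictScalars ℝ)
  obtain ⟨t', C', hC', ha⟩ := exists_slice_bound (V := V) (a.restrictScalars ℝ) 0
  refine ⟨t, C' * t'.sup (schwartzSeminormFamily ℝ (V × E) ℂ) h * C, by positivity,
    fun g s => ?_⟩
  have h1 := hd g s
  have h2 := ha h s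
  simp only [pow_zero, one_mul, ContinuousLinearMap.coe_restrictScalars'] at h1 h2
  calc _ ≤ ‖a (slice s h)‖ * ‖d (slice s g)‖ := norm_inner_le_norm _ _
    _ ≤ (C' * t'.sup (schwartzSeminormFamily ℝ (V × E) ℂ) h) *
        (C * t.sup (schwartzSeminormFamily ℝ (V × F) ℂ) g *
          (1 + ‖s‖) ^ (-(μ.integrablePower : ℝ))) := by gcongr
    _ = _ := by ring

theorem integrable_inner_slice (a : 𝓢(E, ℂ) →L[ℂ] H) (d : 𝓢(F, ℂ) →L[ℂ] H) (h : 𝓢(V × E, ℂ))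
    (g : 𝓢(V × F, ℂ)) : Integrable (fun s => ⟪a (slice s h), d (slice s g)⟫_ℂ) μ := by
  obtain ⟨t, C, hC, hb⟩ := exists_inner_slice_bound μ a d h
  exact ((Measure.integrable_pow_neg_integrablePower μ).const_mul _).mono'
    (continuous_inner_slice a d h g).aestronglyMeasurable
    (Filter.Eventually.of_forall fun s => hb g s)

theorem sup_seminorm_real_le {E : Type*} [NormedAddCommGroup E] [NormedSpace ℝ E]
    (t : Finset (ℕ × ℕ)) (f : 𝓢(E, ℂ)) :
    t.sup (schwartzSeminormFamily ℝ E ℂ) f ≤ t.sup (schwartzSeminormFamily ℂ E ℂ) f :=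
  Seminorm.finset_sup_apply_le (apply_nonneg _ _) fun _ hi =>
    Seminorm.le_def.mp (Finset.le_sup (f := schwartzSeminormFamily ℂ E ℂ) hi) f

/-- The map `g ↦ ∫ ⟨a(h_s), d(g_s)⟩ ds`. -/
def pairCLM (a : 𝓢(E, ℂ) →L[ℂ] H) (d : 𝓢(F, ℂ) →L[ℂ] H) (h : 𝓢(V × E, ℂ)) :
    𝓢(V × F, ℂ) →L[ℂ] ℂ :=
  mkCLMtoNormedSpace (𝕜 := ℂ) (𝕜' := ℂ) (σ := RingHom.id ℂ)
    (fun g => ∫ s, ⟪a (slice s h), d (slice s g)⟫_ℂ ∂μ)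
    (fun g g' => by
      simp only [map_add, inner_add_right]
      exact integral_add (integrable_inner_slice μ a d h g) (integrable_inner_slice μ a d h g'))
    (fun c g => by
      simp only [map_smul, inner_smul_right, RingHom.id_apply, smul_eq_mul]
      exact integral_const_mul _ _)
    (by
      obtain ⟨t, C, hC, hb⟩ := exists_inner_slice_bound μ a d h
      have hI : 0 ≤ ∫ s : V, (1 + ‖s‖) ^ (-(μ.integrablePower : ℝ)) ∂μ :=
        integral_nonneg fun s => by positivity
      refine ⟨t, C * ∫ s : V, (1 + ‖s‖) ^ (-(μ.integrablePower : ℝ)) ∂μ, by positivity,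
        fun g => ?_⟩
      refine (norm_integral_le_of_norm_le
        ((Measure.integrable_pow_neg_integrablePower μ).const_mul _)
        (Filter.Eventually.of_forall fun s => hb g s)).trans ?_
      rw [integral_const_mul, mul_right_comm]
      gcongr
      exact sup_seminorm_real_le t g)

theorem pairCLM_apply (a : 𝓢(E, ℂ) →L[ℂ] H) (d : 𝓢(F, ℂ) →L[ℂ] H) (h : 𝓢(V × E, ℂ))
    (g : 𝓢(V × F, ℂ)) : pairCLM μ a d h g = ∫ s, ⟪a (slice s h), d (slice s g)⟫_ℂ ∂μ := rfl

theorem conj_pairCLM (a : 𝓢(E, ℂ) →L[ℂ] H) (d : 𝓢(F, ℂ) →L[ℂ] H) (h : 𝓢(V × E, ℂ))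
    (g : 𝓢(V × F, ℂ)) : (starRingEnd ℂ) (pairCLM μ a d h g) = pairCLM μ d a g h := by
  rw [pairCLM_apply, pairCLM_apply, ← integral_conj]
  simp only [inner_conj_symm]

end Pair

/-! ### The Weyl operators -/

theorem coef_neg (M : Matrix (Fin 4) (Fin 4) ℝ) (p : X 1) (ν : Fin 4) :
    coef M (-p) ν = -coef M p ν := by
  have := coef_smul M (-1) p ν
  simpa using this

/-- The quadratic term with coefficient 1/2 is exactly what makes e^{-ip·X} the inverse of e^{ip·X}.
-/
theorem weylExponent_neg (κe κm : ℝ) (M : Matrix (Fin 4) (Fin 4) ℝ) (p : X 1) (s : R2) :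
    weylExponent κe κm M (-p) (s + weylShift κe κm M p) = -weylExponent κe κm M p s := by
  simp only [weylExponent, coef_neg, PiLp.add_apply, weylShift]
  simp
  ring

theorem weylShift_neg (κe κm : ℝ) (M : Matrix (Fin 4) (Fin 4) ℝ) (p : X 1) :
    weylShift κe κm M (-p) = -weylShift κe κm M p := by
  ext i
  fin_cases i <;> simp [weylShift, coef_neg]

/-- Unitarity of the Weyl operators: the shift of `s` is undone by a change of variables and the
phases are inverse to each other. -/
theorem integral_conj_weyl (κe κm : ℝ) (M : Matrix (Fin 4) (Fin 4) ℝ) (p : X 1) (v w : R2 → ℂ) :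
    ∫ s, w s * (starRingEnd ℂ) (weyl κe κm M (-p) v s) =
      ∫ s, (starRingEnd ℂ) (v s) * weyl κe κm M p w s := by
  rw [← integral_add_right_eq_self (μ := (volume : Measure R2))
    (fun s => w s * (starRingEnd ℂ) (weyl κe κm M (-p) v s)) (weylShift κe κm M p)]
  refine integral_congr_ae (Filter.Eventually.of_forall fun s => ?_)
  simp only [weyl, weylExponent_neg, weylShift_neg, add_neg_cancel_right, map_mul,
    ← Complex.exp_conj, Complex.conj_I, Complex.conj_ofReal]
  push_cast
  ring_nf

section Times

variable (κe κm : ℝ) (M : Matrix (Fin 4) (Fin 4) ℝ)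

/-- The map `g ↦ f × g`. -/
def timesCLM (m : ℕ) (f : 𝓢(X 1, ℂ)) : 𝓢(R2 × X m, ℂ) →L[ℂ] 𝓢(R2 × X (1 + m), ℂ) :=
  (mulPhase _ (weylExponent_hasTemperateGrowth κe κm M m)).comp
    ((compInj (shear κe κm M m) (shear_injective κe κm M m)).comp (tensorCLM f))

@[simp]
theorem timesCLM_apply (m : ℕ) (f : 𝓢(X 1, ℂ)) (g : 𝓢(R2 × X m, ℂ)) :
    timesCLM κe κm M m f g = timesS κe κm M f g := rfl

/-- Complex conjugation of Schwartz functions. -/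
def conjS {E : Type*} [NormedAddCommGroup E] [NormedSpace ℝ E] (f : 𝓢(E, ℂ)) : 𝓢(E, ℂ) :=
  postcompCLM (𝕜 := ℝ) (Complex.conjCLE : ℂ →L[ℝ] ℂ) f

@[simp]
theorem conjS_apply {E : Type*} [NormedAddCommGroup E] [NormedSpace ℝ E] (f : 𝓢(E, ℂ)) (x : E) :
    conjS f x = (starRingEnd ℂ) (f x) := rfl

/-- Multiplication of a Schwartz function on a product by a Schwartz function of the first
variable. -/
def mulFst {V E : Type*} [NormedAddCommGroup V] [NormedSpace ℝ V] [NormedAddCommGroup E]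
    [NormedSpace ℝ E] (w : 𝓢(V, ℂ)) : 𝓢(V × E, ℂ) →L[ℂ] 𝓢(V × E, ℂ) :=
  smulLeftCLM ℂ (fun z : V × E => w z.1)

@[simp]
theorem mulFst_apply {V E : Type*} [NormedAddCommGroup V] [NormedSpace ℝ V] [NormedAddCommGroup E]
    [NormedSpace ℝ E] (w : 𝓢(V, ℂ)) (G : 𝓢(V × E, ℂ)) (z : V × E) :
    mulFst w G z = w z.1 * G z :=
  smulLeftCLM_apply_apply
    (w.hasTemperateGrowth.comp (ContinuousLinearMap.fst ℝ V E).hasTemperateGrowth) G z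

@[simp]
theorem slice_mulFst {V E : Type*} [NormedAddCommGroup V] [NormedSpace ℝ V] [NormedAddCommGroup E]
    [NormedSpace ℝ E] (w : 𝓢(V, ℂ)) (G : 𝓢(V × E, ℂ)) (s : V) :
    slice s (mulFst w G) = w s • slice s G := by
  ext x; simp

/-- The Schwartz function `p ↦ f(p) ⟨w, e^{i p · X} v⟩`. -/
def matS (w v : 𝓢(R2, ℂ)) (f : 𝓢(X 1, ℂ)) : 𝓢(X 1, ℂ) :=
  -- Using `timesS` with no further momentum variables shows that the matrix element times `f` is
  -- Schwartz; the factor in degree 0 is the constant 1.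
  pint volume (mulFst (conjS w) (timesS κe κm M f (tensor v (tprodS 0 fun j => j.elim0))))

theorem split_one_zero (p : X 1) : (split 1 0 p).1 = p := by
  ext i; rfl

theorem matS_apply (w v : 𝓢(R2, ℂ)) (f : 𝓢(X 1, ℂ)) (p : X 1) :
    matS κe κm M w v f p = f p * ∫ s, (starRingEnd ℂ) (w s) * weyl κe κm M p v s := by
  rw [matS, pint_apply, ← integral_const_mul]
  refine integral_congr_ae (Filter.Eventually.of_forall fun s => ?_)
  change (mulFst (conjS w) (timesS κe κm M f (tensor v (tprodS 0 fun j => j.elim0)))) (s, p) = _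
  rw [mulFst_apply]
  change (starRingEnd ℂ) (w s) * timesS κe κm M f (tensor v (tprodS 0 fun j => j.elim0)) (s, p) = _
  rw [timesS_apply, split_one_zero]
  simp only [weyl, tensor_apply, tprodS_apply, Finset.univ_eq_empty, Finset.prod_empty]
  ring

theorem starS_matS (w v : 𝓢(R2, ℂ)) (f : 𝓢(X 1, ℂ)) :
    starS (matS κe κm M w v f) = matS κe κm M v w (starS f) := by
  ext p
  rw [starS_apply, matS_apply, matS_apply, starS_apply, map_mul, ← integral_conj_weyl,
    ← integral_conj]
  simp only [map_mul, Complex.conj_conj, neg_neg]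

/-- After smearing in `s`, the Weyl operator survives only through its matrix element, a function of
`p` alone. The action f × on a product v ⊗ g thus becomes an ordinary tensor product, about which
the undeformed theory has information. -/
theorem integral_conj_mul_times {H : Type*} [NormedAddCommGroup H] [InnerProductSpace ℂ H]
    [CompleteSpace H] {m : ℕ} (w v : 𝓢(R2, ℂ)) (f : 𝓢(X 1, ℂ)) (g : 𝓢(X m, ℂ))
    (u : 𝓢(X (1 + m), ℂ) →L[ℂ] H) :
    ∫ s, (starRingEnd ℂ) (w s) • u (slice s (timesS κe κm M f (tensor v g))) =
      u (prodS (matS κe κm M w v f) g) := by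
  have h := integral_slice volume (u.restrictScalars ℝ)
    (mulFst (conjS w) (timesS κe κm M f (tensor v g)))
  simp only [ContinuousLinearMap.coe_restrictScalars', slice_mulFst, map_smul, conjS_apply] at h
  rw [h]
  congr 1
  ext P
  rw [pint_apply, prodS_apply, matS_apply, mul_right_comm, ← integral_const_mul]
  refine integral_congr_ae (Filter.Eventually.of_forall fun s => ?_)
  simp only [mulFst_apply, conjS_apply, timesS_apply, weyl, tensor_apply]
  ring

end Times

/-- Adjoints of the deformed fields at a fixed value of `θ`, from the adjoints of the undeformed
fields. -/
theorem integral_inner_times {H : Type*} [NormedAddCommGroup H] [InnerProductSpace ℂ H]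
    [CompleteSpace H] (κe κm : ℝ) (M : Matrix (Fin 4) (Fin 4) ℝ) {n m : ℕ}
    (a : 𝓢(X n, ℂ) →L[ℂ] H) (b : 𝓢(X (1 + m), ℂ) →L[ℂ] H) (c : 𝓢(X (1 + n), ℂ) →L[ℂ] H)
    (d : 𝓢(X m, ℂ) →L[ℂ] H)
    (hyp : ∀ f g h, ⟪a h, b (prodS f g)⟫_ℂ = ⟪c (prodS (starS f) h), d g⟫_ℂ)
    (f : 𝓢(X 1, ℂ)) (h : 𝓢(R2 × X n, ℂ)) (g : 𝓢(R2 × X m, ℂ)) :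
    ∫ s, ⟪a (slice s h), b (slice s (timesS κe κm M f g))⟫_ℂ =
      ∫ s, ⟪c (slice s (timesS κe κm M (starS f) h)), d (slice s g)⟫_ℂ := by
  -- Both sides are separately continuous in `h` and `g`, so products suffice. There the claim is
  -- `hyp` for the test function f(p)⟨w, e^{ip·X} v⟩, whose involution again has this form by
  -- `starS_matS`.
  have key1 : ∀ (w : 𝓢(R2, ℂ)) (h : 𝓢(X n, ℂ)),
      (pairCLM volume a b (tensor w h)).comp (timesCLM κe κm M m f) =
        pairCLM volume c d (timesS κe κm M (starS f) (tensor w h)) := by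
    intro w h
    refine ContinuousLinearMap.ext_on dense_span_tensor ?_
    rintro _ ⟨v, g, rfl⟩
    have e1 : pairCLM volume a b (tensor w h) (timesS κe κm M f (tensor v g)) =
        ⟪a h, b (prodS (matS κe κm M w v f) g)⟫_ℂ := by
      have e := integral_conj_mul_times κe κm M w v f g ((innerSL ℂ (a h)).comp b)
      refine Eq.trans ?_ e
      rw [pairCLM_apply]
      refine integral_congr_ae (Filter.Eventually.of_forall fun s => ?_)
      simp [mul_comm]
    have e2 : pairCLM volume d c (tensor v g) (timesS κe κm M (starS f) (tensor w h)) =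
        ⟪d g, c (prodS (matS κe κm M v w (starS f)) h)⟫_ℂ := by
      have e := integral_conj_mul_times κe κm M v w (starS f) h ((innerSL ℂ (d g)).comp c)
      refine Eq.trans ?_ e
      rw [pairCLM_apply]
      refine integral_congr_ae (Filter.Eventually.of_forall fun s => ?_)
      simp [mul_comm]
    rw [ContinuousLinearMap.comp_apply, timesCLM_apply, e1, ← conj_pairCLM, e2, inner_conj_symm,
      hyp, starS_matS]
  -- Complex conjugation exchanges the two entries and makes the form linear in `h`, so that density
  -- can be used in `h` too.
  have key2 : pairCLM volume b a (timesS κe κm M f g) =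
      (pairCLM volume d c g).comp (timesCLM κe κm M n (starS f)) := by
    refine ContinuousLinearMap.ext_on dense_span_tensor ?_
    rintro _ ⟨w, h, rfl⟩
    have := congrArg (fun u : 𝓢(R2 × X m, ℂ) →L[ℂ] ℂ => (starRingEnd ℂ) (u g)) (key1 w h)
    simpa only [ContinuousLinearMap.comp_apply, timesCLM_apply, conj_pairCLM] using this
  have := congrArg (fun u : 𝓢(R2 × X n, ℂ) →L[ℂ] ℂ => (starRingEnd ℂ) (u h)) key2
  simp only [ContinuousLinearMap.comp_apply, timesCLM_apply, conj_pairCLM] at this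
  exact this

/-! ### Functions of the total momentum -/

/-- Multiplication with a function of the total momentum. -/
def mulTot (n : ℕ) (b : 𝓢(X 1, ℂ)) : 𝓢(X n, ℂ) →L[ℂ] 𝓢(X n, ℂ) :=
  smulLeftCLM ℂ (fun P : X n => b (tot n P))

@[simp]
theorem mulTot_apply (n : ℕ) (b : 𝓢(X 1, ℂ)) (g : 𝓢(X n, ℂ)) (P : X n) :
    mulTot n b g P = b (tot n P) * g P :=
  smulLeftCLM_apply_apply (b.hasTemperateGrowth.comp (tot n).hasTemperateGrowth) g P

theorem mink_neg_tot_hasTemperateGrowth (n : ℕ) :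
    (fun z : X 1 × X n => mink (-z.1) (tot n z.2)).HasTemperateGrowth := by
  refine mink_hasTemperateGrowth (u := fun z : X 1 × X n => -z.1)
    (v := fun z : X 1 × X n => tot n z.2) ?_ ?_
  · exact (-(ContinuousLinearMap.fst ℝ (X 1) (X n))).hasTemperateGrowth
  · exact ((tot n).comp (ContinuousLinearMap.snd ℝ (X 1) (X n))).hasTemperateGrowth

/-- Multiplication with a Fourier transform of the total momentum as a superposition of
translations. -/
theorem apply_mulTot {H : Type*} [NormedAddCommGroup H] [InnerProductSpace ℂ H]
    [CompleteSpace H] {n : ℕ} (u : 𝓢(X n, ℂ) →L[ℂ] H) (β : 𝓢(X 1, ℂ)) (g : 𝓢(X n, ℂ)) :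
    u (mulTot n (FT 1 β) g) =
      ∫ y, ((((2 * Real.pi : ℝ) : ℂ) ^ (2 * 1))⁻¹ * β y) • u (transS n y g) := by
  set c : ℂ := (((2 * Real.pi : ℝ) : ℂ) ^ (2 * 1))⁻¹ with hc
  have h := integral_slice volume (u.restrictScalars ℝ)
    (mulPhase _ (mink_neg_tot_hasTemperateGrowth n) (tensor (c • β) g))
  have hs : ∀ y, slice y (mulPhase _ (mink_neg_tot_hasTemperateGrowth n) (tensor (c • β) g)) =
      (c * β y) • transS n y g := by
    intro y
    ext P
    simp only [slice_apply, mulPhase_apply, tensor_apply, smul_apply, transS_apply, smul_eq_mul]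
    ring
  simp only [hs, ContinuousLinearMap.coe_restrictScalars', map_smul] at h
  rw [h]
  congr 1
  ext P
  rw [pint_apply, mulTot_apply, FT_apply, ← hc, mul_right_comm, ← integral_const_mul]
  refine integral_congr_ae (Filter.Eventually.of_forall fun y => ?_)
  beta_reduce
  rw [mulPhase_apply, tensor_apply, smul_apply, smul_eq_mul, mink_neg_left, mink]
  push_cast
  ring_nf

theorem FT_starS (β : 𝓢(X 1, ℂ)) : FT 1 (starS β) = conjS (FT 1 β) := by
  ext p
  rw [conjS_apply, FT_apply, FT_apply, map_mul, ← integral_conj,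
    ← integral_neg_eq_self (fun x => _ * starS β x) volume]
  congr 1
  · simp [Complex.conj_ofNat]
  refine integral_congr_ae (Filter.Eventually.of_forall fun x => ?_)
  simp only [starS_apply, map_mul, ← Complex.exp_conj, map_neg, Complex.conj_I,
    Complex.conj_ofReal, neg_neg, PiLp.neg_apply, mul_neg, Finset.sum_neg_distrib]
  push_cast
  ring_nf

theorem transS_neg_transS (n : ℕ) (y : X 1) (f : 𝓢(X n, ℂ)) : transS n (-y) (transS n y f) = f := by
  ext P
  rw [transS_apply, transS_apply, ← mul_assoc, ← Complex.exp_add, mink_neg_left, mink_neg_left]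
  simp

section Invariance

variable {H : Type*} [NormedAddCommGroup H] [InnerProductSpace ℂ H] [CompleteSpace H] {n m : ℕ}

/-- A translation invariant form is compatible with multiplication by functions of the total
momentum. -/
theorem inner_mulTot (a : 𝓢(X n, ℂ) →L[ℂ] H) (d : 𝓢(X m, ℂ) →L[ℂ] H)
    (hyp : ∀ y h g, ⟪a (transS n y h), d (transS m y g)⟫_ℂ = ⟪a h, d g⟫_ℂ)
    (b : 𝓢(X 1, ℂ)) (h : 𝓢(X n, ℂ)) (g : 𝓢(X m, ℂ)) :
    ⟪a (mulTot n b h), d g⟫_ℂ = ⟪a h, d (mulTot m (conjS b) g)⟫_ℂ := by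
  -- With `b` a Fourier transform, multiplication by b(Q) is a superposition of translations.
  -- Invariance moves each translation to the other entry with y replaced by -y; conjugation and
  -- this reflection together produce the conjugate of `b`.
  obtain ⟨β, rfl⟩ := (FT 1).surjective b
  have e1 := apply_mulTot ((innerSL ℂ (d g)).comp a) β h
  have e2 := apply_mulTot ((innerSL ℂ (a h)).comp d) (starS β) g
  simp only [ContinuousLinearMap.comp_apply, innerSL_apply_apply] at e1 e2
  rw [← inner_conj_symm, e1, ← FT_starS, e2, ← integral_conj,
    ← integral_neg_eq_self _ (volume : Measure (X 1))]
  refine integral_congr_ae (Filter.Eventually.of_forall fun y => ?_)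
  have h3 : ⟪a (transS n (-y) h), d g⟫_ℂ = ⟪a h, d (transS m y g)⟫_ℂ := by
    rw [← hyp y]
    congr 2
    have := transS_neg_transS n (-y) h
    rwa [neg_neg] at this
  simp only [smul_eq_mul, map_mul, inner_conj_symm, starS_apply, map_inv₀, map_pow,
    Complex.conj_ofReal, h3]

end Invariance

/-! ### The vectors `e^{i Q · X} v` as functions of the total momentum `Q` -/

section Vmap

variable (κe κm : ℝ) (M : Matrix (Fin 4) (Fin 4) ℝ)

theorem weylShift_add (p q : X 1) :
    weylShift κe κm M (p + q) = weylShift κe κm M p + weylShift κe κm M q := by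
  ext i
  fin_cases i <;> simp [weylShift, coef_add] <;> ring

theorem weylShift_smul (c : ℝ) (p : X 1) :
    weylShift κe κm M (c • p) = c • weylShift κe κm M p := by
  ext i
  fin_cases i <;> simp [weylShift, coef_smul] <;> ring

/-- The linear map `(s, P) ↦ (s + weylShift (tot P), P)`. -/
def shearTot (n : ℕ) : R2 × X n →L[ℝ] R2 × X n :=
  LinearMap.toContinuousLinearMap
    { toFun := fun z => (z.1 + weylShift κe κm M (tot n z.2), z.2)
      map_add' := fun z w => by
        refine Prod.ext ?_ rfl
        simp only [Prod.fst_add, Prod.snd_add, map_add, weylShift_add]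
        abel
      map_smul' := fun c z => by
        refine Prod.ext ?_ rfl
        simp only [Prod.smul_fst, Prod.smul_snd, map_smul, weylShift_smul, RingHom.id_apply,
          smul_add] }

theorem shearTot_apply (n : ℕ) (z : R2 × X n) :
    shearTot κe κm M n z = (z.1 + weylShift κe κm M (tot n z.2), z.2) := rfl

theorem shearTot_injective (n : ℕ) : Function.Injective (shearTot κe κm M n) := by
  rintro ⟨s, P⟩ ⟨s', P'⟩ h
  simp only [shearTot_apply, Prod.mk.injEq] at h
  obtain ⟨h1, rfl⟩ := h
  exact Prod.ext (add_right_cancel h1) rfl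

theorem coord_comp_hasTemperateGrowth {D ι : Type*} [Fintype ι] [NormedAddCommGroup D]
    [NormedSpace ℝ D] {u : D → EuclideanSpace ℝ ι} (hu : u.HasTemperateGrowth) (i : ι) :
    (fun z => u z i).HasTemperateGrowth :=
  (coord_hasTemperateGrowth i).comp hu

theorem weylExponent_comp_hasTemperateGrowth {D : Type*} [NormedAddCommGroup D] [NormedSpace ℝ D]
    {A : D → Matrix (Fin 4) (Fin 4) ℝ} {p : D → X 1} {s : D → R2}
    (hA : ∀ μ ν, (fun z => A z μ ν).HasTemperateGrowth) (hp : p.HasTemperateGrowth)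
    (hs : s.HasTemperateGrowth) :
    (fun z => weylExponent κe κm (A z) (p z) (s z)).HasTemperateGrowth := by
  have hc : ∀ ν, (fun z => coef (A z) (p z) ν).HasTemperateGrowth := by
    intro ν
    unfold coef
    refine Function.HasTemperateGrowth.sum fun μ _ => ?_
    have h1 := coord_comp_hasTemperateGrowth hp (0, μ)
    have h2 := hA μ ν
    fun_prop
  have h0 := coord_comp_hasTemperateGrowth hs 0
  have h1 := coord_comp_hasTemperateGrowth hs 1
  have c0 := hc 0
  have c1 := hc 1
  have c2 := hc 2
  have c3 := hc 3
  unfold weylExponent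
  fun_prop

theorem weylExponent_tot_hasTemperateGrowth (n : ℕ) :
    (fun z : R2 × X n => weylExponent κe κm M (tot n z.2) z.1).HasTemperateGrowth :=
  weylExponent_comp_hasTemperateGrowth κe κm (A := fun _ : R2 × X n => M)
    (fun _ _ => Function.HasTemperateGrowth.const _)
    (((tot n).comp (ContinuousLinearMap.snd ℝ R2 (X n))).hasTemperateGrowth)
    (ContinuousLinearMap.fst ℝ R2 (X n)).hasTemperateGrowth

/-- The Schwartz function `(s, P) ↦ (e^{i Q · X} v)(s) g(P)`, where `Q` is the total momentum. -/
def Vmap (v : 𝓢(R2, ℂ)) (n : ℕ) : 𝓢(X n, ℂ) →L[ℂ] 𝓢(R2 × X n, ℂ) :=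
  (mulPhase _ (weylExponent_tot_hasTemperateGrowth κe κm M n)).comp
    ((compInj (shearTot κe κm M n) (shearTot_injective κe κm M n)).comp (tensorCLM v))

theorem Vmap_apply (v : 𝓢(R2, ℂ)) (n : ℕ) (g : 𝓢(X n, ℂ)) (s : R2) (P : X n) :
    Vmap κe κm M v n g (s, P) = weyl κe κm M (tot n P) v s * g P := by
  change Complex.exp _ * (v _ * g P) = _
  simp only [weyl, shearTot_apply]
  ring

theorem conj_weyl_mul_weyl (v : R2 → ℂ) (p : X 1) (s : R2) :
    (starRingEnd ℂ) (weyl κe κm M p v s) * weyl κe κm M p v s =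
      (starRingEnd ℂ) (v (s + weylShift κe κm M p)) * v (s + weylShift κe κm M p) := by
  simp only [weyl, map_mul, ← Complex.exp_conj, Complex.conj_I, Complex.conj_ofReal]
  rw [mul_mul_mul_comm, ← Complex.exp_add]
  simp

/-- The function Q ↦ (e^{iQ·X} v)(s) need not decay, since the displacement has a kernel. If `g` has
compact support, it may be cut off in Q and becomes a Schwartz multiplier to which `inner_mulTot`
applies. -/
theorem slice_Vmap_eq_mulTot (v : 𝓢(R2, ℂ)) {n : ℕ} (g : 𝓢(X n, ℂ)) (χ : 𝓢(X 1, ℂ))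
    (hχ : ∀ P, g P ≠ 0 → χ (tot n P) = 1) (s : R2) :
    slice s (Vmap κe κm M v n g) = mulTot n (slice s (Vmap κe κm M v 1 χ)) g := by
  ext P
  rw [slice_apply, Vmap_apply, mulTot_apply, slice_apply, Vmap_apply, tot_one]
  by_cases h : g P = 0
  · simp [h]
  · rw [hχ P h, mul_one]

variable {H : Type*} [NormedAddCommGroup H] [InnerProductSpace ℂ H] [CompleteSpace H] {n m : ℕ}

/-- Moving one multiplier across the form leaves |(e^{iQ·X} v)(s)|², which is |v|² at a point
shifted by an amount depending only on Q. Its integral over `s` is ‖v‖² for every Q. -/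
theorem integral_inner_Vmap_of_compact (a : 𝓢(X n, ℂ) →L[ℂ] H) (d : 𝓢(X m, ℂ) →L[ℂ] H)
    (hyp : ∀ y h g, ⟪a (transS n y h), d (transS m y g)⟫_ℂ = ⟪a h, d g⟫_ℂ)
    (v : 𝓢(R2, ℂ)) (h : 𝓢(X n, ℂ)) (g : 𝓢(X m, ℂ)) (hh : HasCompactSupport h)
    (hg : HasCompactSupport g) :
    ∫ s, ⟪a (slice s (Vmap κe κm M v n h)), d (slice s (Vmap κe κm M v m g))⟫_ℂ =
      (∫ s, (starRingEnd ℂ) (v s) * v s) * ⟪a h, d g⟫_ℂ := by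
  obtain ⟨χ, -, hχ⟩ := exists_cutoff (tot n '' tsupport h ∪ tot m '' tsupport g)
    ((IsCompact.image hh (tot n).continuous).union (IsCompact.image hg (tot m).continuous))
  have hχh : ∀ P, h P ≠ 0 → χ (tot n P) = 1 := fun P hP =>
    hχ _ (Or.inl ⟨P, subset_tsupport _ hP, rfl⟩)
  have hχg : ∀ P, g P ≠ 0 → χ (tot m P) = 1 := fun P hP =>
    hχ _ (Or.inr ⟨P, subset_tsupport _ hP, rfl⟩)
  set vv : 𝓢(R2, ℂ) := smulLeftCLM ℂ (conjS v) v
  have hvv : ∀ s, vv s = (starRingEnd ℂ) (v s) * v s := fun s =>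
    smulLeftCLM_apply_apply (conjS v).hasTemperateGrowth v s
  set W : 𝓢(R2 × X m, ℂ) :=
    compInj (shearTot κe κm M m) (shearTot_injective κe κm M m) (tensor vv g) with hW
  have hs : ∀ s, ⟪a (slice s (Vmap κe κm M v n h)), d (slice s (Vmap κe κm M v m g))⟫_ℂ =
      ((innerSL ℂ (a h)).comp d) (slice s W) := by
    intro s
    rw [slice_Vmap_eq_mulTot κe κm M v h χ hχh, slice_Vmap_eq_mulTot κe κm M v g χ hχg,
      inner_mulTot a d hyp, ContinuousLinearMap.comp_apply, innerSL_apply_apply]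
    congr 2
    ext P
    simp only [mulTot_apply, conjS_apply, slice_apply, Vmap_apply, hW, compInj_apply,
      shearTot_apply, tensor_apply, hvv, tot_one]
    by_cases hP : g P = 0
    · simp [hP]
    · rw [hχg P hP, mul_one, ← mul_assoc, conj_weyl_mul_weyl]
  have := integral_slice volume (((innerSL ℂ (a h)).comp d).restrictScalars ℝ) W
  simp only [ContinuousLinearMap.coe_restrictScalars'] at this
  simp only [hs]
  rw [this]
  have hp : pint volume W = (∫ s, (starRingEnd ℂ) (v s) * v s) • g := by
    ext P
    rw [pint_apply, smul_apply, smul_eq_mul, ← integral_mul_const,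
      ← integral_add_right_eq_self (μ := (volume : Measure R2))
        (fun s => (starRingEnd ℂ) (v s) * v s * g P) (weylShift κe κm M (tot m P))]
    refine integral_congr_ae (Filter.Eventually.of_forall fun s => ?_)
    simp only [hW, compInj_apply, shearTot_apply, tensor_apply, hvv]
  rw [hp]
  simp

/-- For a translation invariant form, `g ↦ (e^{i Q · X} v) g` preserves inner products, up to the
norm of `v`. -/
theorem integral_inner_Vmap (a : 𝓢(X n, ℂ) →L[ℂ] H) (d : 𝓢(X m, ℂ) →L[ℂ] H)
    (hyp : ∀ y h g, ⟪a (transS n y h), d (transS m y g)⟫_ℂ = ⟪a h, d g⟫_ℂ)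
    (v : 𝓢(R2, ℂ)) (h : 𝓢(X n, ℂ)) (g : 𝓢(X m, ℂ)) :
    ∫ s, ⟪a (slice s (Vmap κe κm M v n h)), d (slice s (Vmap κe κm M v m g))⟫_ℂ =
      (∫ s, (starRingEnd ℂ) (v s) * v s) * ⟪a h, d g⟫_ℂ := by
  set c := ∫ s, (starRingEnd ℂ) (v s) * v s
  -- The compact supports are removed by density, first in `g`, then in `h` after conjugating the
  -- form.
  have key : ∀ h : 𝓢(X n, ℂ), HasCompactSupport h → ∀ g,
      pairCLM volume a d (Vmap κe κm M v n h) (Vmap κe κm M v m g) = c * ⟪a h, d g⟫_ℂ := by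
    intro h hh
    refine fun g => congrFun (Continuous.ext_on (dense_hasCompactSupport (E := X m))
      ((pairCLM volume a d (Vmap κe κm M v n h)).continuous.comp (Vmap κe κm M v m).continuous)
      (continuous_const.mul (continuous_const.inner d.continuous)) fun g hg => ?_) g
    exact integral_inner_Vmap_of_compact κe κm M a d hyp v h g hh hg
  have key2 : ∀ h, pairCLM volume d a (Vmap κe κm M v m g) (Vmap κe κm M v n h) =
      (starRingEnd ℂ) c * ⟪d g, a h⟫_ℂ := by
    refine fun h => congrFun (Continuous.ext_on (dense_hasCompactSupport (E := X n))
      ((pairCLM volume d a (Vmap κe κm M v m g)).continuous.comp (Vmap κe κm M v n).continuous)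
      (continuous_const.mul (continuous_const.inner a.continuous)) fun h hh => ?_) h
    change pairCLM volume d a (Vmap κe κm M v m g) (Vmap κe κm M v n h) =
      (starRingEnd ℂ) c * ⟪d g, a h⟫_ℂ
    rw [← conj_pairCLM, key h hh, map_mul, inner_conj_symm]
  have := key2 h
  rw [← conj_pairCLM, ← inner_conj_symm (d g), ← map_mul] at this
  exact (starRingEnd ℂ).injective this

end Vmap

/-! ### Deformed products -/

/-- In the coordinates given by `M` the form is that of `θ₁`, which couples only the conjugate pairs
(0, 1) and (2, 3). -/
theorem twist_eq_of_orbit {κe κm : ℝ} {M : Matrix (Fin 4) (Fin 4) ℝ} {θ : R16}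
    (h : ∀ μ ν, (M * theta1 κe κm * M.transpose) μ ν = θ (μ, ν)) (p q : X 1) :
    twist θ (fun μ => p (0, μ)) (fun μ => q (0, μ)) =
      κe * (coef M p 0 * coef M q 1 - coef M p 1 * coef M q 0) +
        κm * (coef M p 2 * coef M q 3 - coef M p 3 * coef M q 2) := by
  simp only [twist, ← h, coef, Matrix.mul_apply, Matrix.transpose_apply, theta1,
    Fin.sum_univ_four]
  simp
  ring

theorem twist_sum_right {ι : Type*} [Fintype ι] (θ : R16) (p : Fin 4 → ℝ) (q : ι → Fin 4 → ℝ) :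
    twist θ p (fun μ => ∑ r, q r μ) = ∑ r, twist θ p (q r) := by
  simp only [twist, Finset.mul_sum]
  calc _ = ∑ μ, ∑ r, ∑ ν, eta μ * p μ * θ (μ, ν) * (eta ν * q r ν) :=
        Finset.sum_congr rfl fun μ _ => Finset.sum_comm
    _ = _ := Finset.sum_comm

theorem moyalExponent_one (θ : R16) (m : ℕ) (P : X (1 + m)) :
    moyalExponent θ 1 m P = -(1 / 2 : ℝ) * twist θ (fun μ => (split 1 m P).1 (0, μ))
      (fun μ => tot m (split 1 m P).2 (0, μ)) := by
  simp only [tot_apply, split_snd, twist_sum_right, moyalExponent, Finset.univ_unique,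
    Finset.sum_singleton, Finset.mul_sum]
  rfl

/-- The Moyal product with a function of one variable, in momentum space. -/
def moyalS (θ : R16) {m : ℕ} (f : 𝓢(X 1, ℂ)) : 𝓢(X m, ℂ) →L[ℂ] 𝓢(X (1 + m), ℂ) :=
  (mulPhase (moyalExponent θ 1 m) (moyalExponent_hasTemperateGrowth θ 1 m)).comp (prodSCLM f)

theorem moyalS_apply (θ : R16) {m : ℕ} (f : 𝓢(X 1, ℂ)) (g : 𝓢(X m, ℂ)) (P : X (1 + m)) :
    moyalS θ f g P = Complex.exp (Complex.I * (moyalExponent θ 1 m P : ℂ)) *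
      (f (split 1 m P).1 * g (split 1 m P).2) := rfl

/-- The Weyl operators intertwine the actions of test functions on the enlarged algebra with the
Moyal product. -/
theorem timesS_Vmap {κe κm : ℝ} {M : Matrix (Fin 4) (Fin 4) ℝ} {θ : R16}
    (h : ∀ μ ν, (M * theta1 κe κm * M.transpose) μ ν = θ (μ, ν)) (v : 𝓢(R2, ℂ)) {m : ℕ}
    (f : 𝓢(X 1, ℂ)) (g : 𝓢(X m, ℂ)) :
    timesS κe κm M f (Vmap κe κm M v m g) = Vmap κe κm M v (1 + m) (moyalS θ f g) := by
  ext ⟨s, P⟩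
  rw [timesS_apply, Vmap_apply, moyalS_apply, tot_add, tot_one]
  simp only [weyl, Vmap_apply]
  set p := (split 1 m P).1 with hp
  set Q := tot m (split 1 m P).2 with hQ
  -- The Weyl relation e^{ip·X} e^{iQ·X} = e^{-(i/2) pθQ} e^{i(p+Q)·X}, at the level of exponents.
  have e : weylExponent κe κm M (p + Q) s + moyalExponent θ 1 m P =
      weylExponent κe κm M p s + weylExponent κe κm M Q (s + weylShift κe κm M p) := by
    rw [moyalExponent_one, twist_eq_of_orbit h]
    simp only [weylExponent, coef_add, PiLp.add_apply, weylShift, ← hp, ← hQ]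
    simp
    ring
  have e' := congrArg (fun t : ℝ => Complex.exp (Complex.I * (t : ℂ))) e
  simp only [Complex.ofReal_add, mul_add, Complex.exp_add] at e'
  rw [weylShift_add, ← add_assoc]
  linear_combination (-(f p * v (s + weylShift κe κm M p + weylShift κe κm M Q) *
    g (split 1 m P).2)) * e'

/-! ### The undeformed theory in momentum space -/

theorem prodS_tprodS {m : ℕ} (f : 𝓢(X 1, ℂ)) (g : Fin m → 𝓢(X 1, ℂ)) :
    prodS f (tprodS m g) = tprodS (1 + m) (Fin.append (fun _ => f) g) := by
  ext P
  rw [prodS_apply, tprodS_apply, tprodS_apply, Fin.prod_univ_add]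
  simp only [Fin.append_left, Fin.append_right, Finset.univ_unique, Finset.prod_singleton]
  congr 2
  ext ⟨j, μ⟩
  have : j = 0 := Subsingleton.elim _ _
  subst this
  rfl

theorem tprod_single {K n : ℕ} (k : Fin n → Fin K) (g : Fin n → 𝓢(X 1, ℂ)) :
    tprod (fun j => (Pi.single (fun _ => k j) (g j) : TestFn K 1)) = Pi.single k (tprodS n g) := by
  funext k'
  by_cases h : k' = k
  · subst h
    simp [tprod]
  · rw [Pi.single_eq_of_ne h]
    obtain ⟨j, hj⟩ := Function.ne_iff.mp h
    ext P
    rw [tprod, tprodS_apply]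
    refine Finset.prod_eq_zero (Finset.mem_univ j) ?_
    rw [Pi.single_eq_of_ne]
    · rfl
    · exact fun h' => hj (congrFun h' 0)

namespace FieldTheory

variable {K : ℕ} {H : Type*} [NormedAddCommGroup H] [InnerProductSpace ℂ H]
  (T : FieldTheory K H)

/-- The vector valued distribution `Ψⁿ_k` in momentum space. -/
def cmp (n : ℕ) (k : Fin n → Fin K) : 𝓢(X n, ℂ) →L[ℂ] H :=
  (T.Psi n).comp ((ContinuousLinearMap.single ℂ (fun _ : Fin n → Fin K => 𝓢(X n, ℂ)) k).comp
    ((FT n).symm : 𝓢(X n, ℂ) →L[ℂ] 𝓢(X n, ℂ)))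

theorem cmp_apply (n : ℕ) (k : Fin n → Fin K) (g : 𝓢(X n, ℂ)) :
    T.cmp n k g = T.Psi n (Pi.single k ((FT n).symm g)) := rfl

theorem Psi_eq_sum (n : ℕ) (f : TestFn K n) : T.Psi n f = ∑ k, T.cmp n k (FT n (f k)) := by
  simp only [cmp_apply, ContinuousLinearEquiv.symm_apply_apply, ← map_sum]
  congr 1
  exact (Finset.univ_sum_single f).symm

/-- The field `φ_k(f)` for a test function in momentum space. -/
def phiS (k : Fin K) (f : 𝓢(X 1, ℂ)) : Module.End ℂ (vacDom T.Psi) :=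
  T.phi (Pi.single (fun _ => k) ((FT 1).symm f))

theorem cmp_tprodS (n : ℕ) (k : Fin n → Fin K) (g : Fin n → 𝓢(X 1, ℂ)) :
    T.cmp n k (tprodS n g) =
      ((List.ofFn fun j => T.phiS (k j) (g j)).prod T.vac : vacDom T.Psi) := by
  have h : (FT n).symm (tprodS n g) = tprodS n fun j => (FT 1).symm (g j) := by
    rw [ContinuousLinearEquiv.symm_apply_eq, FT_tprodS]
    simp
  rw [cmp_apply, h, ← tprod_single, T.Psi_tprod]
  rfl

theorem cmp_append_prodS {m : ℕ} (j : Fin 1 → Fin K) (k : Fin m → Fin K) (f : 𝓢(X 1, ℂ))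
    (g : Fin m → 𝓢(X 1, ℂ)) :
    T.cmp (1 + m) (Fin.append j k) (prodS f (tprodS m g)) =
      (T.phiS (j 0) f ((List.ofFn fun i => T.phiS (k i) (g i)).prod T.vac) : vacDom T.Psi) := by
  rw [prodS_tprodS, cmp_tprodS]
  have : (fun i => T.phiS (Fin.append j k i) (Fin.append (fun _ => f) g i)) =
      Fin.append (fun i : Fin 1 => T.phiS (j i) f) (fun i => T.phiS (k i) (g i)) := by
    funext i
    refine Fin.addCases (fun i => ?_) (fun i => ?_) i <;> simp
  rw [this, List.ofFn_fin_append, List.prod_append]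
  simp

theorem conjT_single (k : Fin 1 → Fin K) (f : 𝓢(X 1, ℂ)) :
    conjT T.bar (Pi.single k ((FT 1).symm f)) =
      Pi.single (fun i => T.bar (k i)) ((FT 1).symm (starS f)) := by
  funext k'
  by_cases h : k' = fun i => T.bar (k i)
  · subst h
    simp only [conjT, T.bar_bar, Pi.single_eq_same]
    rw [ContinuousLinearEquiv.eq_symm_apply, FT_conj, ContinuousLinearEquiv.apply_symm_apply]
  · rw [Pi.single_eq_of_ne h, conjT, Pi.single_eq_of_ne, map_zero]
    rintro rfl
    exact h (by simp [T.bar_bar])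

theorem phiS_adjoint (k : Fin K) (f : 𝓢(X 1, ℂ)) :
    IsFormalAdjoint (T.phiS k f) (T.phiS (T.bar k) (starS f)) := by
  have := T.phi_adjoint (Pi.single (fun _ => k) ((FT 1).symm f))
  rwa [conjT_single] at this

theorem starS_starS (f : 𝓢(X 1, ℂ)) : starS (starS f) = f := by
  ext p; simp [starS_apply]

/-- For products of one-variable functions this is the adjoint relation of φ; density and continuity
extend it to general `g` and then to general `h`. It is the hypothesis `hyp` of
`integral_inner_times`. -/
theorem inner_cmp_prodS {n m : ℕ} (k' : Fin n → Fin K) (j : Fin 1 → Fin K) (k : Fin m → Fin K)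
    (f : 𝓢(X 1, ℂ)) (g : 𝓢(X m, ℂ)) (h : 𝓢(X n, ℂ)) :
    ⟪T.cmp n k' h, T.cmp (1 + m) (Fin.append j k) (prodS f g)⟫_ℂ =
      ⟪T.cmp (1 + n) (Fin.append (fun i => T.bar (j i)) k') (prodS (starS f) h),
        T.cmp m k g⟫_ℂ := by
  have key : ∀ (h : Fin n → 𝓢(X 1, ℂ)) (g : 𝓢(X m, ℂ)),
      ⟪T.cmp n k' (tprodS n h), T.cmp (1 + m) (Fin.append j k) (prodS f g)⟫_ℂ =
      ⟪T.cmp (1 + n) (Fin.append (fun i => T.bar (j i)) k') (prodS (starS f) (tprodS n h)),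
        T.cmp m k g⟫_ℂ := by
    intro h
    have : (innerSL ℂ (T.cmp n k' (tprodS n h))).comp
        ((T.cmp (1 + m) (Fin.append j k)).comp (prodSCLM f)) =
        (innerSL ℂ (T.cmp (1 + n) (Fin.append (fun i => T.bar (j i)) k')
          (prodS (starS f) (tprodS n h)))).comp (T.cmp m k) := by
      refine ContinuousLinearMap.ext_on (dense_span_tprodS m) ?_
      rintro _ ⟨g, rfl⟩
      simp only [ContinuousLinearMap.comp_apply, prodSCLM_apply, innerSL_apply_apply]
      rw [cmp_append_prodS, cmp_append_prodS, cmp_tprodS, cmp_tprodS]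
      have := T.phiS_adjoint (T.bar (j 0)) (starS f)
        ((List.ofFn fun i => T.phiS (k' i) (h i)).prod T.vac)
        ((List.ofFn fun i => T.phiS (k i) (g i)).prod T.vac)
      rw [T.bar_bar, starS_starS] at this
      exact this.symm
    intro g
    exact congrArg (fun u => u g) this
  have : (innerSL ℂ (T.cmp (1 + m) (Fin.append j k) (prodS f g))).comp (T.cmp n k') =
      (innerSL ℂ (T.cmp m k g)).comp
        ((T.cmp (1 + n) (Fin.append (fun i => T.bar (j i)) k')).comp (prodSCLM (starS f))) := by
    refine ContinuousLinearMap.ext_on (dense_span_tprodS n) ?_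
    rintro _ ⟨h, rfl⟩
    simp only [ContinuousLinearMap.comp_apply, prodSCLM_apply, innerSL_apply_apply]
    rw [← inner_conj_symm, key, inner_conj_symm]
  have := congrArg (fun u => u h) this
  simp only [ContinuousLinearMap.comp_apply, prodSCLM_apply, innerSL_apply_apply] at this
  rw [← inner_conj_symm, this, inner_conj_symm]

theorem U_phiS (y : R4) (k : Fin K) (f : 𝓢(X 1, ℂ)) (ξ : vacDom T.Psi) :
    T.U y (T.phiS k f ξ : H) =
      T.phiS k (transS 1 (WithLp.toLp 2 fun i => y i.2) f) ⟨T.U y ξ, T.U_dom y ξ ξ.2⟩ := by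
  rw [phiS, T.U_phi, phiS]
  congr 3
  funext k'
  rw [transT]
  by_cases h : k' = fun _ => k
  · subst h
    simp only [Pi.single_eq_same]
    rw [ContinuousLinearEquiv.eq_symm_apply, FT_translate,
      ContinuousLinearEquiv.apply_symm_apply]
  · rw [Pi.single_eq_of_ne h, Pi.single_eq_of_ne h, map_zero]

/-- Covariance of the fields and invariance of the vacuum give this on products, by moving `U`
through the factors one at a time; the rest is density. -/
theorem U_cmp (y : R4) (n : ℕ) (k : Fin n → Fin K) (g : 𝓢(X n, ℂ)) :
    T.U y (T.cmp n k g) = T.cmp n k (transS n (WithLp.toLp 2 fun i => y i.2) g) := by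
  have : ((T.U y).toContinuousLinearEquiv : H →L[ℂ] H).comp (T.cmp n k) =
      (T.cmp n k).comp (transS n (WithLp.toLp 2 fun i => y i.2)) := by
    refine ContinuousLinearMap.ext_on (dense_span_tprodS n) ?_
    rintro _ ⟨g, rfl⟩
    simp only [ContinuousLinearMap.comp_apply]
    rw [transS_tprodS, cmp_tprodS, cmp_tprodS, List.ofFn_eq_map, List.ofFn_eq_map]
    change T.U y _ = _
    induction List.finRange n with
    | nil => simpa using T.U_vac y
    | cons i l ih =>
      simp only [List.map_cons, List.prod_cons, Module.End.mul_apply]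
      rw [U_phiS]
      congr 2
      exact Subtype.ext ih
  exact congrArg (fun u => u g) this

/-- Unitarity of `U`. This is the invariance on which the isometry property of V rests. -/
theorem inner_cmp_transS {n m : ℕ} (k' : Fin n → Fin K) (k : Fin m → Fin K) (y : X 1)
    (h : 𝓢(X n, ℂ)) (g : 𝓢(X m, ℂ)) :
    ⟪T.cmp n k' (transS n y h), T.cmp m k (transS m y g)⟫_ℂ = ⟪T.cmp n k' h, T.cmp m k g⟫_ℂ := by
  have hy : y = WithLp.toLp 2 fun i => (WithLp.toLp 2 fun μ => y (0, μ) : R4) i.2 := by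
    ext ⟨j, μ⟩
    have : j = 0 := Subsingleton.elim _ _
    subst this
    rfl
  rw [hy, ← U_cmp, ← U_cmp, LinearIsometryEquiv.inner_map_map]

end FieldTheory

/-! ### The enlarged algebra at a fixed value of `θ` -/

/-- Schwartz functions of `s ∈ ℝ²` and `n` momentum variables, with `Kⁿ` components. -/
abbrev FibN (K n : ℕ) : Type := (Fin n → Fin K) → 𝓢(R2 × X n, ℂ)

/-- Terminating sequences of such functions. -/
abbrev Fib (K : ℕ) : Type := DirectSum ℕ (FibN K)

/-- Restriction to a fixed value of `θ`. -/
def restrictN {κe κm : ℝ} {K : ℕ} (θ : Sig κe κm) (n : ℕ) : Amb κe κm K n →ₗ[ℂ] FibN K n where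
  toFun g k := g k θ
  map_add' _ _ := rfl
  map_smul' _ _ := rfl

/-- Restriction to a fixed value of `θ`. -/
def restrict {κe κm : ℝ} {K : ℕ} (θ : Sig κe κm) : AmbBorchers κe κm K →ₗ[ℂ] Fib K :=
  DirectSum.toModule ℂ ℕ _ fun n => (DirectSum.lof ℂ ℕ (FibN K) n).comp (restrictN θ n)

/-- The action of a test function at a fixed value of `θ`. -/
def timesFibN (κe κm : ℝ) (M : Matrix (Fin 4) (Fin 4) ℝ) {K : ℕ} (f : TestFn K 1) (m : ℕ) :
    FibN K m →ₗ[ℂ] FibN K (1 + m) where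
  toFun g k := timesS κe κm M (FT 1 (f fun j => k (Fin.castAdd m j)))
    (g fun j => k (Fin.natAdd 1 j))
  map_add' g g' := by
    funext k
    exact map_add (timesCLM κe κm M m (FT 1 (f fun j => k (Fin.castAdd m j)))) _ _
  map_smul' c g := by
    funext k
    exact map_smul (timesCLM κe κm M m (FT 1 (f fun j => k (Fin.castAdd m j)))) _ _

/-- The action of a test function at a fixed value of `θ`. -/
def timesFib (κe κm : ℝ) (M : Matrix (Fin 4) (Fin 4) ℝ) {K : ℕ} (f : TestFn K 1) :
    Fib K →ₗ[ℂ] Fib K :=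
  DirectSum.toModule ℂ ℕ _ fun m =>
    (DirectSum.lof ℂ ℕ (FibN K) (1 + m)).comp (timesFibN κe κm M f m)

/-- The action is pointwise in `θ`, so that algebraic identities may be proved in one fibre at a
time. -/
theorem restrict_times {κe κm : ℝ} (Λ : LorentzSection κe κm) {K : ℕ} (f : TestFn K 1)
    (θ : Sig κe κm) (g : AmbBorchers κe κm K) :
    restrict θ (times Λ f g) = timesFib κe κm (Λ.toFun θ) f (restrict θ g) := by
  have : (restrict θ).comp (times Λ f) =
      (timesFib κe κm (Λ.toFun θ) f).comp (restrict (K := K) θ) := by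
    refine DirectSum.linearMap_ext ℂ fun n => LinearMap.ext fun G => ?_
    simp only [LinearMap.comp_apply, times, restrict, timesFib, DirectSum.toModule_lof]
    rfl
  exact congrArg (fun u => u g) this

/-- Restriction to a fixed value of `s`, in position space. -/
def evalFibN {K : ℕ} (s : R2) (n : ℕ) : FibN K n →ₗ[ℂ] TestFn K n where
  toFun g k := (FT n).symm (slice s (g k))
  map_add' g g' := by funext k; simp
  map_smul' c g := by funext k; simp

/-- Restriction to a fixed value of `s`, in position space. -/
def evalFib {K : ℕ} (s : R2) : Fib K →ₗ[ℂ] Borchers K :=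
  DirectSum.toModule ℂ ℕ _ fun n => (DirectSum.lof ℂ ℕ (TestFn K) n).comp (evalFibN s n)

theorem evalAt_eq {κe κm : ℝ} {K : ℕ} (s : R2) (θ : Sig κe κm) (g : AmbBorchers κe κm K) :
    evalAt s θ g = evalFib s (restrict θ g) := by
  have : evalAt s θ = (evalFib s).comp (restrict (K := K) θ) := by
    refine DirectSum.linearMap_ext ℂ fun n => LinearMap.ext fun G => ?_
    simp only [LinearMap.comp_apply, evalAt, restrict, evalFib, DirectSum.toModule_lof]
    rfl
  exact congrArg (fun u => u g) this

/-- The embedding `g ↦ (e^{i Q · X} v) g` of test functions of `n` variables. -/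
def VFibN (κe κm : ℝ) (M : Matrix (Fin 4) (Fin 4) ℝ) {K : ℕ} (v : 𝓢(R2, ℂ)) (n : ℕ) :
    TestFn K n →ₗ[ℂ] FibN K n where
  toFun g k := Vmap κe κm M v n (FT n (g k))
  map_add' g g' := by funext k; simp
  map_smul' c g := by funext k; simp

/-- The embedding `g ↦ (e^{i Q · X} v) g` of the Borchers-Uhlmann algebra. -/
def VFib (κe κm : ℝ) (M : Matrix (Fin 4) (Fin 4) ℝ) {K : ℕ} (v : 𝓢(R2, ℂ)) :
    Borchers K →ₗ[ℂ] Fib K :=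
  DirectSum.toModule ℂ ℕ _ fun n => (DirectSum.lof ℂ ℕ (FibN K) n).comp (VFibN κe κm M v n)

/-- Componentwise this is the Weyl relation `timesS_Vmap`: V embeds the Moyal-deformed theory into
the fibre. -/
theorem timesFib_VFib {κe κm : ℝ} {M : Matrix (Fin 4) (Fin 4) ℝ} {θ : R16}
    (h : ∀ μ ν, (M * theta1 κe κm * M.transpose) μ ν = θ (μ, ν)) {K : ℕ} (v : 𝓢(R2, ℂ))
    (f : TestFn K 1) (g : Borchers K) :
    timesFib κe κm M f (VFib κe κm M v g) = VFib κe κm M v (moyal K θ (emb f) g) := by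
  have : (timesFib κe κm M f).comp (VFib κe κm M v) =
      (VFib κe κm M v).comp (moyal K θ (emb f)) := by
    refine DirectSum.linearMap_ext ℂ fun n => LinearMap.ext fun G => ?_
    simp only [LinearMap.comp_apply, emb, moyal_lof]
    simp only [VFib, timesFib, DirectSum.toModule_lof, LinearMap.comp_apply]
    congr 1
    funext k
    refine (timesS_Vmap h v _ _).trans ?_
    simp only [VFibN, LinearMap.coe_mk, AddHom.coe_mk, moyalN, ContinuousLinearEquiv.apply_symm_apply]
    rfl
  exact congrArg (fun u => u g) this

/-- The unit of the Borchers-Uhlmann algebra. -/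
def unitB (K : ℕ) : Borchers K := DirectSum.lof ℂ ℕ (TestFn K) 0 (tprod fun j => j.elim0)

theorem tot_zero (P : X 0) : tot 0 P = 0 := by
  ext i; simp

theorem weyl_zero (κe κm : ℝ) (M : Matrix (Fin 4) (Fin 4) ℝ) (v : R2 → ℂ) :
    weyl κe κm M 0 v = v := by
  have hc : ∀ ν, coef M 0 ν = 0 := fun ν => by simp [coef]
  funext s
  have : weylShift κe κm M 0 = 0 := by
    ext i
    fin_cases i <;> simp [weylShift, hc]
  simp [weyl, weylExponent, hc, this]

/-- In degree 0 the total momentum vanishes and the Weyl operator is trivial, so v ⊗ 1 is in the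
image of V in every fibre. Polynomials applied to it can therefore be compared with Moyal
polynomials. -/
theorem restrict_elem_unitB {κe κm : ℝ} {K : ℕ} {v : R2 × R16 → ℂ}
    (h₁ : ContDiff ℝ (⊤ : ℕ∞) v) (h₂ : HasCompactSupport v) (M : Matrix (Fin 4) (Fin 4) ℝ)
    (θ : Sig κe κm) :
    restrict θ (elem (K := K) h₁ h₂ (unitB K)) =
      VFib κe κm M (sliceV h₁ h₂ (θ : R16)) (unitB K) := by
  simp only [unitB, elem, restrict, VFib, DirectSum.toModule_lof, LinearMap.comp_apply]
  congr 1
  funext k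
  ext ⟨s, P⟩
  simp only [VFibN, LinearMap.coe_mk, AddHom.coe_mk, Vmap_apply, tot_zero, weyl_zero]
  rfl

namespace FieldTheory

variable {K : ℕ} {H : Type*} [NormedAddCommGroup H] [InnerProductSpace ℂ H] (T : FieldTheory K H)

theorem PsiB_unitB : T.PsiB (unitB K) = T.vac := by
  simp only [PsiB, unitB, DirectSum.toModule_lof]
  have := T.Psi_tprod 0 fun j => j.elim0
  simpa using this

/-- The function `s ↦ Ψ(𝐠_s)` at a fixed value of `θ`. -/
def PsiFib (G : Fib K) (s : R2) : H := T.PsiB (evalFib s G)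

theorem PsiOt_eq {κe κm : ℝ} (g : AmbBorchers κe κm K) (s : R2) (θ : Sig κe κm) :
    T.PsiOt g (s, θ) = T.PsiFib (restrict θ g) s := by
  rw [PsiOt, evalAt_eq, PsiFib]

theorem PsiFib_add (G G' : Fib K) (s : R2) :
    T.PsiFib (G + G') s = T.PsiFib G s + T.PsiFib G' s := by
  simp [PsiFib]

@[simp]
theorem PsiFib_zero (s : R2) : T.PsiFib (0 : Fib K) s = 0 := by
  simp [PsiFib]

theorem PsiFib_lof (n : ℕ) (G : FibN K n) (s : R2) :
    T.PsiFib (DirectSum.lof ℂ ℕ (FibN K) n G) s = ∑ k, T.cmp n k (slice s (G k)) := by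
  simp only [PsiFib, evalFib, PsiB, DirectSum.toModule_lof, LinearMap.comp_apply]
  simp [Psi_eq_sum, evalFibN]

theorem PsiFib_timesFib_lof (κe κm : ℝ) (M : Matrix (Fin 4) (Fin 4) ℝ) (f : TestFn K 1) (m : ℕ)
    (G : FibN K m) (s : R2) :
    T.PsiFib (timesFib κe κm M f (DirectSum.lof ℂ ℕ (FibN K) m G)) s =
      ∑ j, ∑ k, T.cmp (1 + m) (Fin.append j k) (slice s (timesS κe κm M (FT 1 (f j)) (G k))) := by
  rw [timesFib, DirectSum.toModule_lof, LinearMap.comp_apply, PsiFib_lof, ← Fintype.sum_prod_type',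
    ← (Fin.appendEquiv 1 m).sum_comp]
  refine Finset.sum_congr rfl fun p _ => ?_
  simp [timesFibN, Fin.appendEquiv]

theorem integrable_inner_PsiFib (G G' : Fib K) :
    Integrable fun s => ⟪T.PsiFib G s, T.PsiFib G' s⟫_ℂ := by
  induction G using DirectSum.induction_on with
  | zero => simp
  | add G₁ G₂ h h' => simp only [PsiFib_add, inner_add_left]; exact h.add h'
  | of n G =>
    induction G' using DirectSum.induction_on with
    | zero => simp
    | add G₁ G₂ h h' => simp only [PsiFib_add, inner_add_right]; exact h.add h'
    | of n' G' =>
      simp only [← DirectSum.lof_eq_of ℂ, PsiFib_lof, sum_inner, inner_sum]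
      exact integrable_finsetSum _ fun k _ => integrable_finsetSum _ fun k' _ =>
        integrable_inner_slice volume _ _ _ _

/-- The conjugation of the indices of one-variable test functions. -/
def barPerm : Equiv.Perm (Fin 1 → Fin K) where
  toFun j i := T.bar (j i)
  invFun j i := T.bar (j i)
  left_inv j := by simp [T.bar_bar]
  right_inv j := by simp [T.bar_bar]

theorem barPerm_apply (j : Fin 1 → Fin K) : T.barPerm j = fun i => T.bar (j i) := rfl

theorem FT_conjT (f : TestFn K 1) (j : Fin 1 → Fin K) :
    FT 1 (conjT T.bar f fun i => T.bar (j i)) = starS (FT 1 (f j)) := by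
  simp only [conjT, T.bar_bar, FT_conj]

theorem integral_sum_sum_sum {α β γ : Type*} [Fintype α] [Fintype β] [Fintype γ]
    (F : α → β → γ → R2 → ℂ) (hF : ∀ a b c, Integrable (F a b c)) :
    ∫ s, ∑ a, ∑ b, ∑ c, F a b c s = ∑ a, ∑ b, ∑ c, ∫ s, F a b c s := by
  rw [integral_finsetSum _ fun a _ => integrable_finsetSum _ fun b _ =>
    integrable_finsetSum _ fun c _ => hF a b c]
  refine Finset.sum_congr rfl fun a _ => ?_
  rw [integral_finsetSum _ fun b _ => integrable_finsetSum _ fun c _ => hF a b c]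
  refine Finset.sum_congr rfl fun b _ => ?_
  rw [integral_finsetSum _ fun c _ => hF a b c]

variable [CompleteSpace H]

/-- The adjoint of the deformed field at a fixed value of `θ`. -/
theorem integral_inner_timesFib (κe κm : ℝ) (M : Matrix (Fin 4) (Fin 4) ℝ) (f : TestFn K 1)
    (G G' : Fib K) :
    ∫ s, ⟪T.PsiFib G s, T.PsiFib (timesFib κe κm M f G') s⟫_ℂ =
      ∫ s, ⟪T.PsiFib (timesFib κe κm M (conjT T.bar f) G) s, T.PsiFib G' s⟫_ℂ := by
  induction G using DirectSum.induction_on with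
  | zero => simp
  | add G₁ G₂ h h' =>
    simp only [map_add, PsiFib_add, inner_add_left]
    rw [integral_add (T.integrable_inner_PsiFib _ _) (T.integrable_inner_PsiFib _ _),
      integral_add (T.integrable_inner_PsiFib _ _) (T.integrable_inner_PsiFib _ _), h, h']
  | of n G =>
    induction G' using DirectSum.induction_on with
    | zero => simp
    | add G₁ G₂ h h' =>
      simp only [map_add, PsiFib_add, inner_add_right]
      rw [integral_add (T.integrable_inner_PsiFib _ _) (T.integrable_inner_PsiFib _ _),
        integral_add (T.integrable_inner_PsiFib _ _) (T.integrable_inner_PsiFib _ _), h, h']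
    | of m G' =>
      simp only [← DirectSum.lof_eq_of ℂ, PsiFib_lof, PsiFib_timesFib_lof, sum_inner, inner_sum]
      rw [integral_sum_sum_sum _ fun _ _ _ => integrable_inner_slice volume _ _ _ _,
        integral_sum_sum_sum _ fun _ _ _ => integrable_inner_slice volume _ _ _ _]
      rw [Finset.sum_comm (s := (Finset.univ : Finset (Fin m → Fin K)))]
      -- The component indices are relabelled by k ↦ k̄, which matches the conjugation in `conjT`.
      refine Eq.trans ?_ (Equiv.sum_comp T.barPerm _)
      refine Finset.sum_congr rfl fun j _ => Finset.sum_congr rfl fun k _ =>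
        Finset.sum_congr rfl fun k' _ => ?_
      rw [barPerm_apply, T.FT_conjT,
        integral_inner_times κe κm M (T.cmp n k') _
          (T.cmp (1 + n) (Fin.append (fun i => T.bar (j i)) k')) (T.cmp m k)
          (fun f g h => T.inner_cmp_prodS k' j k f g h)]

theorem PsiB_lof (n : ℕ) (g : TestFn K n) :
    T.PsiB (DirectSum.lof ℂ ℕ (TestFn K) n g) = ∑ k, T.cmp n k (FT n (g k)) := by
  rw [PsiB, DirectSum.toModule_lof, ← T.Psi_eq_sum]
  rfl

/-- The map `g ↦ (e^{i Q · X} v) g` preserves inner products, up to the norm of `v`. -/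
theorem integral_inner_VFib (κe κm : ℝ) (M : Matrix (Fin 4) (Fin 4) ℝ) (v : 𝓢(R2, ℂ))
    (h g : Borchers K) :
    ∫ s, ⟪T.PsiFib (VFib κe κm M v h) s, T.PsiFib (VFib κe κm M v g) s⟫_ℂ =
      (∫ s, (starRingEnd ℂ) (v s) * v s) * ⟪T.PsiB h, T.PsiB g⟫_ℂ := by
  induction h using DirectSum.induction_on with
  | zero => simp
  | add h₁ h₂ e₁ e₂ =>
    simp only [map_add, PsiFib_add, inner_add_left]
    rw [integral_add (T.integrable_inner_PsiFib _ _) (T.integrable_inner_PsiFib _ _), e₁, e₂,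
      mul_add]
  | of n h =>
    induction g using DirectSum.induction_on with
    | zero => simp
    | add h₁ h₂ e₁ e₂ =>
      simp only [map_add, PsiFib_add, inner_add_right]
      rw [integral_add (T.integrable_inner_PsiFib _ _) (T.integrable_inner_PsiFib _ _), e₁, e₂,
        mul_add]
    | of m g =>
      simp only [← DirectSum.lof_eq_of ℂ, VFib, DirectSum.toModule_lof, LinearMap.comp_apply,
        PsiFib_lof, PsiB_lof, sum_inner, inner_sum]
      rw [integral_finsetSum _ fun k _ => integrable_finsetSum _ fun k' _ =>
        integrable_inner_slice volume _ _ _ _, Finset.mul_sum]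
      refine Finset.sum_congr rfl fun k _ => ?_
      rw [integral_finsetSum _ fun k' _ => integrable_inner_slice volume _ _ _ _, Finset.mul_sum]
      refine Finset.sum_congr rfl fun k' _ => ?_
      exact integral_inner_Vmap κe κm M _ _ (T.inner_cmp_transS k' k) v _ _

theorem integral_conj_mul_self_ne_zero {v : R2 → ℂ} (hv : Continuous v) (hc : HasCompactSupport v)
    {s : R2} (hs : v s ≠ 0) : ∫ s, (starRingEnd ℂ) (v s) * v s ≠ 0 := by
  have h1 : ∀ s, (starRingEnd ℂ) (v s) * v s = ((‖v s‖ ^ 2 : ℝ) : ℂ) := fun s => by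
    rw [Complex.conj_mul']; push_cast; rfl
  simp only [h1]
  rw [integral_complex_ofReal, Complex.ofReal_ne_zero]
  refine (Continuous.integral_pos_of_hasCompactSupport_nonneg_nonzero (by fun_prop) ?_
    (fun s => by positivity) (x := s) (by simpa using hs)).ne'
  exact hc.comp_left (g := fun z : ℂ => ‖z‖ ^ 2) (by simp)

/-- The adjoint of the field deformed with `θ`. -/
theorem inner_PsiB_moyal {κe κm : ℝ} {M : Matrix (Fin 4) (Fin 4) ℝ} {θ : R16}
    (hM : ∀ μ ν, (M * theta1 κe κm * M.transpose) μ ν = θ (μ, ν)) (f : TestFn K 1)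
    (h g : Borchers K) :
    ⟪T.PsiB h, T.PsiB (moyal K θ (emb f) g)⟫_ℂ =
      ⟪T.PsiB (moyal K θ (emb (conjT T.bar f)) h), T.PsiB g⟫_ℂ := by
  -- Any `v` with ‖v‖² ≠ 0 will do: both sides are multiplied by ‖v‖², transported to the fibre by
  -- V, and compared there.
  obtain ⟨v, hv, hv1⟩ := exists_cutoff ({0} : Set R2) isCompact_singleton
  refine mul_left_cancel₀ (integral_conj_mul_self_ne_zero v.continuous hv (s := 0)
    (by simp [hv1])) ?_
  rw [← T.integral_inner_VFib κe κm M v, ← T.integral_inner_VFib κe κm M v,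
    ← timesFib_VFib hM, ← timesFib_VFib hM, T.integral_inner_timesFib]

end FieldTheory

/-! ### Hausdorff measure of level sets -/

open scoped NNReal ENNReal Topology

theorem euclideanHausdorffMeasure_image_le {X Y : Type*} [EMetricSpace X] [MeasurableSpace X]
    [BorelSpace X] [EMetricSpace Y] [MeasurableSpace Y] [BorelSpace Y] {f : X → Y} {C : ℝ≥0}
    {s : Set X} (h : LipschitzOnWith C f s) (d : ℕ) :
    (μHE[d] : Measure Y) (f '' s) ≤ (C : ℝ≥0∞) ^ d * (μHE[d] : Measure X) s := by
  simp only [Measure.euclideanHausdorffMeasure_def, Measure.smul_apply, ENNReal.smul_def,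
    smul_eq_mul]
  have := h.hausdorffMeasure_image_le (d := d) (by positivity)
  rw [ENNReal.rpow_natCast] at this
  calc _ ≤ _ * ((C : ℝ≥0∞) ^ d * (Measure.hausdorffMeasure (d : ℝ) : Measure X) s) := by gcongr
    _ = _ := by rw [mul_left_comm]

section LevelSet

variable {W Y : Type*} [NormedAddCommGroup W] [NormedSpace ℝ W] [FiniteDimensional ℝ W]
  [MeasurableSpace W] [BorelSpace W] [NormedAddCommGroup Y] [NormedSpace ℝ Y]
  [FiniteDimensional ℝ Y] {q : W → Y} {q' : W →L[ℝ] Y} {z : W}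

/-- By the implicit function theorem the level set near `z` is a Lipschitz image of a bounded subset
of ker q', which has finite Lebesgue measure. -/
theorem exists_levelSet_measure_lt_top (hq : HasStrictFDerivAt q q' z) (hq' : q'.range = ⊤) :
    ∃ N ∈ 𝓝 z, (μHE[Module.finrank ℝ q'.ker] : Measure W) ({w | q w = q z} ∩ N) < ∞ := by
  have := FiniteDimensional.complete ℝ W
  have := FiniteDimensional.complete ℝ Y
  have := FiniteDimensional.complete ℝ q'.ker
  set φ := hq.implicitFunctionDataOfComplemented q q' hq'
    q'.ker_closedComplemented_of_finiteDimensional_range with hφ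
  obtain ⟨C, U, hU, hC⟩ := φ.hasStrictFDerivAt_implicitFunction_fderiv.exists_lipschitzOnWith
  set B := U ∩ Metric.ball (φ.rightFun φ.pt) 1
  have hB : B ∈ 𝓝 (φ.rightFun φ.pt) := Filter.inter_mem hU (Metric.ball_mem_nhds _ one_pos)
  have h1 : ∀ᶠ x in 𝓝 z, φ.rightFun x ∈ B :=
    φ.hasStrictFDerivAt_rightFun.continuousAt.eventually hB
  have h2 : ∀ᶠ x in 𝓝 z, φ.leftFun x = φ.leftFun φ.pt ↔
      φ.implicitFunction (φ.leftFun φ.pt) (φ.rightFun x) = x := φ.leftFun_eq_iff_implicitFunction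
  refine ⟨{x | φ.rightFun x ∈ B ∧ (φ.leftFun x = φ.leftFun φ.pt ↔
    φ.implicitFunction (φ.leftFun φ.pt) (φ.rightFun x) = x)}, h1.and h2, ?_⟩
  have hsub : {w | q w = q z} ∩ {x | φ.rightFun x ∈ B ∧ (φ.leftFun x = φ.leftFun φ.pt ↔
      φ.implicitFunction (φ.leftFun φ.pt) (φ.rightFun x) = x)} ⊆
      φ.implicitFunction (φ.leftFun φ.pt) '' B := by
    rintro x ⟨hx, hxB, hxi⟩
    exact ⟨_, hxB, hxi.mp hx⟩
  refine (measure_mono hsub).trans_lt ((euclideanHausdorffMeasure_image_le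
    (hC.mono Set.inter_subset_left) _).trans_lt ?_)
  refine ENNReal.mul_lt_top (ENNReal.pow_lt_top ENNReal.coe_lt_top) ?_
  exact (measure_mono Set.inter_subset_right).trans_lt measure_ball_lt_top

/-- The chart in the other direction is affine, hence Lipschitz, and maps the piece of the level set
onto a set containing a ball of ker q'. -/
theorem levelSet_measure_pos (hq : HasStrictFDerivAt q q' z) (hq' : q'.range = ⊤) {N : Set W}
    (hN : N ∈ 𝓝 z) :
    0 < (μHE[Module.finrank ℝ q'.ker] : Measure W) ({w | q w = q z} ∩ N) := by
  have := FiniteDimensional.complete ℝ W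
  have := FiniteDimensional.complete ℝ Y
  have := FiniteDimensional.complete ℝ q'.ker
  set φ := hq.implicitFunctionDataOfComplemented q q' hq'
    q'.ker_closedComplemented_of_finiteDimensional_range with hφ
  have hc := φ.hasStrictFDerivAt_implicitFunction_fderiv.continuousAt
  have hz : φ.implicitFunction (φ.leftFun φ.pt) (φ.rightFun φ.pt) = z :=
    φ.implicitFunction_apply_image.self_of_nhds
  have h1 : ∀ᶠ w in 𝓝 (φ.rightFun φ.pt), φ.implicitFunction (φ.leftFun φ.pt) w ∈ N := by
    refine hc.eventually ?_
    rw [hz]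
    exact hN
  have h2 : ∀ᶠ w in 𝓝 (φ.rightFun φ.pt),
      φ.prodFun (φ.implicitFunction (φ.leftFun φ.pt) w) = (φ.leftFun φ.pt, w) := by
    have : Filter.Tendsto (fun w => (φ.leftFun φ.pt, w)) (𝓝 (φ.rightFun φ.pt))
        (𝓝 (φ.prodFun φ.pt)) := (Continuous.prodMk_right _).continuousAt
    exact this.eventually φ.prodFun_implicitFunction
  obtain ⟨r, hr, hB⟩ := Metric.eventually_nhds_iff_ball.mp (h1.and h2)
  obtain ⟨L, hL⟩ : ∃ L, LipschitzWith L φ.rightFun := by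
    refine ⟨‖φ.rightDeriv‖₊, LipschitzWith.of_dist_le_mul fun x y => ?_⟩
    change dist (φ.rightDeriv (x - z)) (φ.rightDeriv (y - z)) ≤ _
    rw [dist_eq_norm, ← map_sub, sub_sub_sub_cancel_right, dist_eq_norm]
    exact φ.rightDeriv.le_opNorm _
  have hsub : Metric.ball (φ.rightFun φ.pt) r ⊆ φ.rightFun '' ({w | q w = q z} ∩ N) := by
    intro w hw
    obtain ⟨hw1, hw2⟩ := hB w hw
    exact ⟨_, ⟨congrArg Prod.fst hw2, hw1⟩, congrArg Prod.snd hw2⟩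
  have hpos : 0 < (μHE[Module.finrank ℝ q'.ker] : Measure q'.ker)
      (Metric.ball (φ.rightFun φ.pt) r) := Metric.measure_ball_pos _ _ hr
  have hle := hpos.trans_le ((measure_mono hsub).trans
    (euclideanHausdorffMeasure_image_le hL.lipschitzOnWith _))
  exact pos_iff_ne_zero.mpr fun h0 => by simp [h0] at hle

end LevelSet

/-! ### The measure on `Σ` -/

/-- Antisymmetric matrices as vectors in `ℂ³`. -/
def toC3 : R16 →L[ℝ] ℂ × ℂ × ℂ :=
  LinearMap.toContinuousLinearMap
    { toFun := fun θ => (θ (0, 1) + θ (2, 3) * Complex.I, θ (0, 2) + θ (3, 1) * Complex.I,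
        θ (0, 3) + θ (1, 2) * Complex.I)
      map_add' := fun x y => by
        refine Prod.ext ?_ (Prod.ext ?_ ?_) <;> simp <;> ring
      map_smul' := fun c x => by
        refine Prod.ext ?_ (Prod.ext ?_ ?_) <;> simp <;> ring }

/-- The antisymmetric matrix of a vector in `ℂ³`. -/
def ofC3 : ℂ × ℂ × ℂ →L[ℝ] R16 :=
  LinearMap.toContinuousLinearMap
    { toFun := fun z => WithLp.toLp 2 fun i =>
        !![0, z.1.re, z.2.1.re, z.2.2.re; -z.1.re, 0, z.2.2.im, -z.2.1.im;
          -z.2.1.re, -z.2.2.im, 0, z.1.im; -z.2.2.re, z.2.1.im, -z.1.im, 0] i.1 i.2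
      map_add' := fun x y => by
        ext ⟨i, j⟩
        fin_cases i <;> fin_cases j <;> simp <;> ring
      map_smul' := fun c x => by
        ext ⟨i, j⟩
        fin_cases i <;> fin_cases j <;> simp }

/-- The square of a vector in `ℂ³`. -/
def sqC3 (z : ℂ × ℂ × ℂ) : ℂ := z.1 ^ 2 + z.2.1 ^ 2 + z.2.2 ^ 2

theorem toC3_ofC3 (z : ℂ × ℂ × ℂ) : toC3 (ofC3 z) = z := by
  refine Prod.ext ?_ (Prod.ext ?_ ?_) <;> simp [toC3, ofC3]

theorem ofC3_antisymm (z : ℂ × ℂ × ℂ) (μ ν : Fin 4) : ofC3 z (μ, ν) = -ofC3 z (ν, μ) := by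
  fin_cases μ <;> fin_cases ν <;> simp [ofC3]

theorem ofC3_toC3 {θ : R16} (h : ∀ μ ν, θ (μ, ν) = -θ (ν, μ)) : ofC3 (toC3 θ) = θ := by
  have hd : ∀ μ, θ (μ, μ) = 0 := fun μ => by linarith [h μ μ]
  ext ⟨i, j⟩
  fin_cases i <;> fin_cases j <;> simp [toC3, ofC3, hd] <;>
    first | rfl | exact (h _ _).symm

theorem sum_perm_succ {n : ℕ} (F : Equiv.Perm (Fin (n + 1)) → ℝ) :
    ∑ g, F g = ∑ p, ∑ e, F (Equiv.Perm.decomposeFin.symm (p, e)) := by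
  rw [← Fintype.sum_prod_type', ← Equiv.Perm.decomposeFin.symm.sum_comp]

theorem sum_perm_two (F : ℝ → Fin 2 → Fin 2 → ℝ) :
    ∑ g : Equiv.Perm (Fin 2), F ((Equiv.Perm.sign g : ℤ) : ℝ) (g 0) (g 1) =
      F 1 0 1 + F (-1) 1 0 := by
  have e1 : ∀ (p : Fin 2) (e : Equiv.Perm (Fin 1)), Equiv.Perm.decomposeFin.symm (p, e) 1 =
      Equiv.swap 0 p (e 0).succ := fun p e => Equiv.Perm.decomposeFin_symm_apply_succ e p 0
  rw [sum_perm_succ]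
  simp only [Equiv.Perm.decomposeFin_symm_apply_zero, e1, Equiv.Perm.decomposeFin.symm_sign,
    Fin.sum_univ_two, Fintype.sum_unique]
  simp

theorem sum_perm_three (F : ℝ → Fin 3 → Fin 3 → Fin 3 → ℝ) :
    ∑ g : Equiv.Perm (Fin 3), F ((Equiv.Perm.sign g : ℤ) : ℝ) (g 0) (g 1) (g 2) =
      F 1 0 1 2 + F (-1) 0 2 1 + (F (-1) 1 0 2 + F 1 1 2 0) + (F (-1) 2 1 0 + F 1 2 0 1) := by
  have e2 : ∀ (p : Fin 3) (e : Equiv.Perm (Fin 2)), Equiv.Perm.decomposeFin.symm (p, e) 2 =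
      Equiv.swap 0 p (e 1).succ := fun p e => Equiv.Perm.decomposeFin_symm_apply_succ e p 1
  have e1 : ∀ (p : Fin 3) (e : Equiv.Perm (Fin 2)), Equiv.Perm.decomposeFin.symm (p, e) 1 =
      Equiv.swap 0 p (e 0).succ := fun p e => Equiv.Perm.decomposeFin_symm_apply_succ e p 0
  have k0 := sum_perm_two fun a x y => F a 0 x.succ y.succ
  have k1 := sum_perm_two fun a x y => F (-a) 1 (Equiv.swap 0 1 x.succ) (Equiv.swap 0 1 y.succ)
  have k2 := sum_perm_two fun a x y => F (-a) 2 (Equiv.swap 0 2 x.succ) (Equiv.swap 0 2 y.succ)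
  rw [sum_perm_succ]
  simp only [Equiv.Perm.decomposeFin_symm_apply_zero, e1, e2, Equiv.Perm.decomposeFin.symm_sign,
    Fin.sum_univ_three]
  simp only [Equiv.swap_apply_def, Equiv.swap_self, Equiv.refl_apply] at *
  simp only [Fin.isValue, Fin.reduceEq, if_true, if_false, Fin.reduceSucc, one_mul, neg_mul,
    neg_neg, Units.val_neg, Int.cast_neg, Fin.succ_ne_zero] at *
  rw [k0, k1, k2]

/-- Each of the three pairings of the indices occurs eight times, with signs absorbed by
antisymmetry. The sum is reduced from S₄ to S₃ to S₂ by choosing the image of 0. -/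
theorem sum_perm_four (θ : Fin 4 → Fin 4 → ℝ) (h : ∀ μ ν, θ μ ν = -θ ν μ) :
    ∑ g : Equiv.Perm (Fin 4), -((Equiv.Perm.sign g : ℤ) : ℝ) * θ (g 0) (g 1) * θ (g 2) (g 3) =
      -8 * (θ 0 1 * θ 2 3 + θ 0 2 * θ 3 1 + θ 0 3 * θ 1 2) := by
  have e3 : ∀ (p : Fin 4) (e : Equiv.Perm (Fin 3)), Equiv.Perm.decomposeFin.symm (p, e) 3 =
      Equiv.swap 0 p (e 2).succ := fun p e => Equiv.Perm.decomposeFin_symm_apply_succ e p 2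
  have e2 : ∀ (p : Fin 4) (e : Equiv.Perm (Fin 3)), Equiv.Perm.decomposeFin.symm (p, e) 2 =
      Equiv.swap 0 p (e 1).succ := fun p e => Equiv.Perm.decomposeFin_symm_apply_succ e p 1
  have e1 : ∀ (p : Fin 4) (e : Equiv.Perm (Fin 3)), Equiv.Perm.decomposeFin.symm (p, e) 1 =
      Equiv.swap 0 p (e 0).succ := fun p e => Equiv.Perm.decomposeFin_symm_apply_succ e p 0
  have k0 := sum_perm_three fun a x y z => -a * θ 0 x.succ * θ y.succ z.succ
  have k1 := sum_perm_three fun a x y z => a * θ 1 (Equiv.swap 0 1 x.succ) *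
    θ (Equiv.swap 0 1 y.succ) (Equiv.swap 0 1 z.succ)
  have k2 := sum_perm_three fun a x y z => a * θ 2 (Equiv.swap 0 2 x.succ) *
    θ (Equiv.swap 0 2 y.succ) (Equiv.swap 0 2 z.succ)
  have k3 := sum_perm_three fun a x y z => a * θ 3 (Equiv.swap 0 3 x.succ) *
    θ (Equiv.swap 0 3 y.succ) (Equiv.swap 0 3 z.succ)
  rw [sum_perm_succ]
  simp only [Equiv.Perm.decomposeFin_symm_apply_zero, e1, e2, e3,
    Equiv.Perm.decomposeFin.symm_sign, Fin.sum_univ_four]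
  simp only [Equiv.swap_apply_def, Equiv.swap_self, Equiv.refl_apply] at *
  simp only [Fin.isValue, Fin.reduceEq, if_true, if_false, Fin.reduceSucc, one_mul, neg_mul,
    neg_neg, Units.val_neg, Int.cast_neg, Fin.succ_ne_zero] at *
  rw [k0, k1, k2, k3, h 1 0, h 2 0, h 3 0, h 2 1, h 3 1, h 3 2]
  ring

/-- With electric part e and magnetic part b, the two invariants are the real and imaginary parts of
the complex square (e + ib)². Hence Σ is a complex quadric in ℂ³, and one submersion describes both
equations. -/
theorem sqC3_toC3 {κe κm : ℝ} {θ : R16} (h : ∀ μ ν, θ (μ, ν) = -θ (ν, μ)) :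
    sqC3 (toC3 θ) = (κe + κm * Complex.I) ^ 2 ↔ θ ∈ Sig κe κm := by
  have hd : ∀ μ, θ (μ, μ) = 0 := fun μ => by linarith [h μ μ]
  have hI : ∑ g : Equiv.Perm (Fin 4), -((Equiv.Perm.sign g : ℤ) : ℝ) * θ (g 0, g 1) * θ (g 2, g 3)
      = -8 * (θ (0, 1) * θ (2, 3) + θ (0, 2) * θ (3, 1) + θ (0, 3) * θ (1, 2)) := by
    exact sum_perm_four (fun μ ν => θ (μ, ν)) h
  have hJ : ∑ μ, ∑ ν, (eta μ * eta ν * θ (μ, ν)) * θ (μ, ν) =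
      2 * (θ (2, 3) ^ 2 + θ (3, 1) ^ 2 + θ (1, 2) ^ 2 -
        (θ (0, 1) ^ 2 + θ (0, 2) ^ 2 + θ (0, 3) ^ 2)) := by
    simp only [Fin.sum_univ_four, hd]
    rw [h 1 0, h 2 0, h 3 0, h 2 1, h 3 1, h 3 2]
    simp [eta]
    ring
  have hre : sqC3 (toC3 θ) = (((θ (0, 1) ^ 2 + θ (0, 2) ^ 2 + θ (0, 3) ^ 2) -
      (θ (2, 3) ^ 2 + θ (3, 1) ^ 2 + θ (1, 2) ^ 2) : ℝ) : ℂ) +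
      ((2 * (θ (0, 1) * θ (2, 3) + θ (0, 2) * θ (3, 1) + θ (0, 3) * θ (1, 2)) : ℝ) : ℂ) *
        Complex.I := by
    simp only [sqC3, toC3, LinearMap.coe_toContinuousLinearMap', LinearMap.coe_mk, AddHom.coe_mk]
    push_cast
    linear_combination ((θ (2, 3) : ℂ) ^ 2 + (θ (3, 1) : ℂ) ^ 2 + (θ (1, 2) : ℂ) ^ 2) *
      Complex.I_sq
  have hk : ((κe : ℂ) + κm * Complex.I) ^ 2 = ((κe ^ 2 - κm ^ 2 : ℝ) : ℂ) +
      ((2 * (κe * κm) : ℝ) : ℂ) * Complex.I := by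
    push_cast
    linear_combination (κm : ℂ) ^ 2 * Complex.I_sq
  rw [hre, hk, Complex.ext_iff]
  simp only [Complex.add_re, Complex.ofReal_re, Complex.mul_re, Complex.I_re, Complex.I_im,
    Complex.ofReal_im, Complex.add_im, Complex.mul_im, mul_zero, mul_one, sub_zero, zero_add,
    add_zero]
  constructor
  · rintro ⟨h1, h2⟩
    exact ⟨h, by rw [hJ]; linarith, by rw [hI]; linarith⟩
  · rintro ⟨-, h1, h2⟩
    rw [hJ] at h1
    rw [hI] at h2
    exact ⟨by linarith, by linarith⟩

/-- The derivative of `sqC3`. -/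
def sqC3Deriv (z : ℂ × ℂ × ℂ) : ℂ × ℂ × ℂ →L[ℝ] ℂ :=
  (2 * z.1) • ContinuousLinearMap.fst ℝ ℂ (ℂ × ℂ) +
    (2 * z.2.1) • ((ContinuousLinearMap.fst ℝ ℂ ℂ).comp (ContinuousLinearMap.snd ℝ ℂ (ℂ × ℂ))) +
    (2 * z.2.2) • ((ContinuousLinearMap.snd ℝ ℂ ℂ).comp (ContinuousLinearMap.snd ℝ ℂ (ℂ × ℂ)))

theorem hasStrictFDerivAt_sqC3 (z : ℂ × ℂ × ℂ) : HasStrictFDerivAt sqC3 (sqC3Deriv z) z := by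
  have h1 : HasStrictFDerivAt (fun z : ℂ × ℂ × ℂ => z.1) _ z :=
    (ContinuousLinearMap.fst ℝ ℂ (ℂ × ℂ)).hasStrictFDerivAt
  have h2 : HasStrictFDerivAt (fun z : ℂ × ℂ × ℂ => z.2.1) _ z :=
    ((ContinuousLinearMap.fst ℝ ℂ ℂ).comp (ContinuousLinearMap.snd ℝ ℂ (ℂ × ℂ))).hasStrictFDerivAt
  have h3 : HasStrictFDerivAt (fun z : ℂ × ℂ × ℂ => z.2.2) _ z :=
    ((ContinuousLinearMap.snd ℝ ℂ ℂ).comp (ContinuousLinearMap.snd ℝ ℂ (ℂ × ℂ))).hasStrictFDerivAt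
  have h := ((h1.pow 2).add (h2.pow 2)).add (h3.pow 2)
  exact h.congr_fderiv (by simp [sqC3Deriv])

theorem range_sqC3Deriv {z : ℂ × ℂ × ℂ} (hz : z ≠ 0) : (sqC3Deriv z).range = ⊤ := by
  refine LinearMap.range_eq_top.mpr fun c => ?_
  have : z.1 ≠ 0 ∨ z.2.1 ≠ 0 ∨ z.2.2 ≠ 0 := by
    by_contra! h
    exact hz (Prod.ext h.1 (Prod.ext h.2.1 h.2.2))
  rcases this with h | h | h
  · exact ⟨(c / (2 * z.1), 0, 0), by simp [sqC3Deriv]; field_simp⟩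
  · exact ⟨(0, c / (2 * z.2.1), 0), by simp [sqC3Deriv]; field_simp⟩
  · exact ⟨(0, 0, c / (2 * z.2.2)), by simp [sqC3Deriv]; field_simp⟩

/-- Real dimensions 6 - 2 = 4; this is the dimension of the Hausdorff measure in `vMeasure`. -/
theorem finrank_ker_sqC3Deriv {z : ℂ × ℂ × ℂ} (hz : z ≠ 0) :
    Module.finrank ℝ (sqC3Deriv z).ker = 4 := by
  have h := (sqC3Deriv z : ℂ × ℂ × ℂ →ₗ[ℝ] ℂ).finrank_range_add_finrank_ker
  rw [range_sqC3Deriv hz] at h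
  simp [Module.finrank_prod, Complex.finrank_real_complex] at h
  have : Module.finrank ℝ (sqC3Deriv z).ker =
    Module.finrank ℝ (LinearMap.ker (sqC3Deriv z : ℂ × ℂ × ℂ →ₗ[ℝ] ℂ)) := rfl
  omega

/-- Here `hκ` enters: the level κe + iκm ≠ 0 keeps Σ away from the origin of ℂ³, where `sqC3` is not
a submersion. -/
theorem toC3_ne_zero {κe κm : ℝ} (hκ : κe ≠ 0 ∨ κm ≠ 0) {θ : R16} (hθ : θ ∈ Sig κe κm) :
    toC3 θ ≠ 0 := by
  intro h0
  have h := (sqC3_toC3 (κe := κe) (κm := κm) hθ.1).mpr hθ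
  rw [h0] at h
  have : ((κe : ℂ) + κm * Complex.I) = 0 := by
    have h' : (0 : ℂ) = (κe + κm * Complex.I) ^ 2 := by simpa [sqC3] using h
    exact pow_eq_zero_iff (two_ne_zero) |>.mp h'.symm
  rw [Complex.ext_iff] at this
  simp at this
  tauto

theorem isClosed_Sig (κe κm : ℝ) : IsClosed (Sig κe κm) := by
  have h : ∀ i, Continuous fun θ : R16 => θ i := fun i => (EuclideanSpace.proj (𝕜 := ℝ) i).continuous
  refine IsClosed.inter ?_ (IsClosed.inter ?_ ?_)
  · have : {θ : R16 | ∀ μ ν, θ (μ, ν) = -θ (ν, μ)} =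
        ⋂ μ, ⋂ ν, {θ : R16 | θ (μ, ν) = -θ (ν, μ)} := by
      ext θ; simp
    change IsClosed {θ : R16 | ∀ μ ν, θ (μ, ν) = -θ (ν, μ)}
    rw [this]
    exact isClosed_iInter fun μ => isClosed_iInter fun ν => isClosed_eq (h (μ, ν)) (h (ν, μ)).neg
  · refine isClosed_eq ?_ continuous_const
    fun_prop
  · refine isClosed_eq ?_ continuous_const
    fun_prop

/-- Locally Σ lies in the Lipschitz image under `ofC3` of a piece of the quadric with finite
measure. -/
theorem isLocallyFiniteMeasure_Sig {κe κm : ℝ} (hκ : κe ≠ 0 ∨ κm ≠ 0) :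
    IsLocallyFiniteMeasure (μHE[4] : Measure (Sig κe κm)) := by
  refine ⟨fun θ => ?_⟩
  have hz := toC3_ne_zero hκ θ.2
  obtain ⟨N, hN, hfin⟩ := exists_levelSet_measure_lt_top (hasStrictFDerivAt_sqC3 (toC3 θ))
    (range_sqC3Deriv hz)
  rw [finrank_ker_sqC3Deriv hz] at hfin
  refine ⟨(fun θ : Sig κe κm => toC3 θ) ⁻¹' N,
    (toC3.continuous.comp continuous_subtype_val).continuousAt.preimage_mem_nhds hN, ?_⟩
  rw [← isometry_subtype_coe.euclideanHausdorffMeasure_image]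
  have hsub : Subtype.val '' ((fun θ : Sig κe κm => toC3 θ) ⁻¹' N) ⊆
      ofC3 '' ({w | sqC3 w = sqC3 (toC3 θ)} ∩ N) := by
    rintro _ ⟨θ', h', rfl⟩
    refine ⟨toC3 θ', ⟨?_, h'⟩, ofC3_toC3 θ'.2.1⟩
    exact ((sqC3_toC3 θ'.2.1).mpr θ'.2).trans ((sqC3_toC3 θ.2.1).mpr θ.2).symm
  refine (measure_mono hsub).trans_lt ((euclideanHausdorffMeasure_image_le
    ofC3.lipschitz.lipschitzOnWith _).trans_lt ?_)
  exact ENNReal.mul_lt_top (ENNReal.pow_lt_top ENNReal.coe_lt_top) hfin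

/-- The linear map `toC3` sends an open piece of Σ onto a piece of the quadric of positive measure.
Full support is what upgrades statements for almost every `θ` to every `θ`. -/
theorem isOpenPosMeasure_Sig {κe κm : ℝ} (hκ : κe ≠ 0 ∨ κm ≠ 0) :
    (μHE[4] : Measure (Sig κe κm)).IsOpenPosMeasure := by
  refine ⟨fun O hO ⟨θ, hθ⟩ h0 => ?_⟩
  obtain ⟨O', hO', rfl⟩ := isOpen_induced_iff.mp hO
  have hz := toC3_ne_zero hκ θ.2
  have hpos := levelSet_measure_pos (hasStrictFDerivAt_sqC3 (toC3 θ)) (range_sqC3Deriv hz)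
    (N := ofC3 ⁻¹' O') (ofC3.continuous.continuousAt.preimage_mem_nhds (by
      rw [ofC3_toC3 θ.2.1]; exact hO'.mem_nhds hθ))
  rw [finrank_ker_sqC3Deriv hz] at hpos
  have hsub : {w | sqC3 w = sqC3 (toC3 θ)} ∩ ofC3 ⁻¹' O' ⊆
      toC3 '' (Subtype.val '' (Subtype.val ⁻¹' O' : Set (Sig κe κm))) := by
    rintro w ⟨hw, hwO⟩
    have : ofC3 w ∈ Sig κe κm := by
      rw [← sqC3_toC3 (ofC3_antisymm w), toC3_ofC3]
      exact hw.trans ((sqC3_toC3 θ.2.1).mpr θ.2)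
    exact ⟨ofC3 w, ⟨⟨ofC3 w, this⟩, hwO, rfl⟩, toC3_ofC3 w⟩
  have hle := hpos.trans_le ((measure_mono hsub).trans
    (euclideanHausdorffMeasure_image_le toC3.lipschitz.lipschitzOnWith _))
  rw [isometry_subtype_coe.euclideanHausdorffMeasure_image, h0] at hle
  simp at hle

/-! ### Measurability and decay -/

theorem hasTemperateGrowth_prodMk {D E F : Type*} [NormedAddCommGroup D] [NormedSpace ℝ D]
    [NormedAddCommGroup E] [NormedSpace ℝ E] [NormedAddCommGroup F] [NormedSpace ℝ F]
    {f : D → E} {g : D → F} (hf : f.HasTemperateGrowth) (hg : g.HasTemperateGrowth) :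
    (fun x => (f x, g x)).HasTemperateGrowth := by
  have h := ((ContinuousLinearMap.inl ℝ E F).hasTemperateGrowth.comp hf).add
    ((ContinuousLinearMap.inr ℝ E F).hasTemperateGrowth.comp hg)
  convert h using 1
  funext x
  simp

/-- A matrix, given as an element of `ℝ¹⁶`. -/
def matOf (m : R16) : Matrix (Fin 4) (Fin 4) ℝ := Matrix.of fun μ ν => m (μ, ν)

theorem weylShift_eq (κe κm : ℝ) (M : Matrix (Fin 4) (Fin 4) ℝ) (p : X 1) :
    weylShift κe κm M p = (κe * coef M p 1) • EuclideanSpace.single 0 (1 : ℝ) +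
      (κm * coef M p 3) • EuclideanSpace.single 1 (1 : ℝ) := by
  ext i
  fin_cases i <;> simp [weylShift]

theorem abs_coef_le (m : R16) (p : X 1) (ν : Fin 4) : |coef (matOf m) p ν| ≤ 4 * (‖p‖ * ‖m‖) := by
  have h : ∀ μ : Fin 4, |eta μ * p (0, μ) * matOf m μ ν| ≤ ‖p‖ * ‖m‖ := fun μ => by
    have h1 : |eta μ| = 1 := by
      fin_cases μ <;> simp [eta]
    rw [abs_mul, abs_mul, h1, one_mul]
    exact mul_le_mul (PiLp.norm_apply_le p (0, μ)) (PiLp.norm_apply_le m (μ, ν)) (abs_nonneg _)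
      (norm_nonneg _)
  calc _ ≤ ∑ μ : Fin 4, |eta μ * p (0, μ) * matOf m μ ν| := Finset.abs_sum_le_sum_abs _ _
    _ ≤ ∑ _μ : Fin 4, ‖p‖ * ‖m‖ := Finset.sum_le_sum fun μ _ => h μ
    _ = _ := by simp

theorem norm_weylShift_le (κe κm : ℝ) (m : R16) (p : X 1) :
    ‖weylShift κe κm (matOf m) p‖ ≤ 4 * (|κe| + |κm|) * (‖p‖ * ‖m‖) := by
  rw [weylShift_eq]
  refine (norm_add_le _ _).trans ?_
  simp only [norm_smul, PiLp.norm_single, Real.norm_eq_abs, abs_mul, abs_one, mul_one]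
  have h1 := mul_le_mul_of_nonneg_left (abs_coef_le m p 1) (abs_nonneg κe)
  have h3 := mul_le_mul_of_nonneg_left (abs_coef_le m p 3) (abs_nonneg κm)
  linarith

/-- The parameters `((M, θ), s)`. -/
abbrev Par : Type := (R16 × R16) × R2

section Times

variable (κe κm : ℝ) (m : ℕ)

/-- The map `(((M, θ), s), (p, q)) ↦ (p, (((M, θ), s + weylShift p), q))`. -/
def shearPar (x : Par × X (1 + m)) : X 1 × (Par × X m) :=
  ((split 1 m x.2).1, ((x.1.1, x.1.2 + weylShift κe κm (matOf x.1.1.1) (split 1 m x.2).1),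
    (split 1 m x.2).2))

theorem fst_split_hasTemperateGrowth :
    (fun x : Par × X (1 + m) => (split 1 m x.2).1).HasTemperateGrowth :=
  ((ContinuousLinearMap.fst ℝ _ _).comp ((split 1 m).comp
    (ContinuousLinearMap.snd ℝ Par (X (1 + m))))).hasTemperateGrowth

theorem matOf_hasTemperateGrowth (μ ν : Fin 4) :
    (fun x : Par × X (1 + m) => matOf x.1.1.1 μ ν).HasTemperateGrowth :=
  coord_comp_hasTemperateGrowth (u := fun x : Par × X (1 + m) => x.1.1.1)
    ((ContinuousLinearMap.fst ℝ _ _).comp ((ContinuousLinearMap.fst ℝ _ _).comp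
      (ContinuousLinearMap.fst ℝ Par (X (1 + m))))).hasTemperateGrowth (μ, ν)

theorem shearPar_hasTemperateGrowth : (shearPar κe κm m).HasTemperateGrowth := by
  have hp := fst_split_hasTemperateGrowth m
  have hc : ∀ ν, (fun x : Par × X (1 + m) =>
      coef (matOf x.1.1.1) (split 1 m x.2).1 ν).HasTemperateGrowth := by
    intro ν
    unfold coef
    refine Function.HasTemperateGrowth.sum fun μ _ => ?_
    have h1 := coord_comp_hasTemperateGrowth hp (0, μ)
    have h2 := matOf_hasTemperateGrowth m μ ν
    fun_prop
  have hs : (fun x : Par × X (1 + m) => x.1.2 +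
      weylShift κe κm (matOf x.1.1.1) (split 1 m x.2).1).HasTemperateGrowth := by
    simp only [weylShift_eq]
    refine Function.HasTemperateGrowth.add (((ContinuousLinearMap.snd ℝ _ _).comp
      (ContinuousLinearMap.fst ℝ Par (X (1 + m)))).hasTemperateGrowth)
      (Function.HasTemperateGrowth.add ?_ ?_)
    · exact ((Function.HasTemperateGrowth.const κe).mul (hc 1)).smul
        (Function.HasTemperateGrowth.const _)
    · exact ((Function.HasTemperateGrowth.const κm).mul (hc 3)).smul
        (Function.HasTemperateGrowth.const _)
  refine hasTemperateGrowth_prodMk hp (hasTemperateGrowth_prodMk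
    (hasTemperateGrowth_prodMk ?_ hs) ?_)
  · exact ((ContinuousLinearMap.fst ℝ _ _).comp
      (ContinuousLinearMap.fst ℝ Par (X (1 + m)))).hasTemperateGrowth
  · exact ((ContinuousLinearMap.snd ℝ _ _).comp ((split 1 m).comp
      (ContinuousLinearMap.snd ℝ Par (X (1 + m))))).hasTemperateGrowth

/-- The shear is not linear once `M` is a variable: the displacement is bilinear in `M` and `p`.
Both are visible in the image, so the inverse grows quadratically, whence the exponent 2. -/
theorem shearPar_upper : ∃ (k : ℕ) (C : ℝ), ∀ x : Par × X (1 + m),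
    ‖x‖ ≤ C * (1 + ‖shearPar κe κm m x‖) ^ k := by
  obtain ⟨L, -, hL⟩ := (split 1 m : X (1 + m) →ₗ[ℝ] X 1 × X m).exists_antilipschitzWith
    (LinearMap.ker_eq_bot.mpr (split_injective 1 m))
  refine ⟨2, 1 + L + 4 * (|κe| + |κm|), fun x => ?_⟩
  obtain ⟨⟨⟨M, θ⟩, s⟩, P⟩ := x
  set y := shearPar κe κm m (((M, θ), s), P) with hy
  set N := ‖y‖
  have hN : 0 ≤ N := norm_nonneg _
  have h1 : ‖(split 1 m P).1‖ ≤ N := norm_fst_le y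
  have h2' : ‖y.2‖ ≤ N := norm_snd_le y
  have h3 : ‖(split 1 m P).2‖ ≤ N := (norm_snd_le y.2).trans h2'
  have h4' : ‖y.2.1‖ ≤ N := (norm_fst_le y.2).trans h2'
  have h5 : ‖(M, θ)‖ ≤ N := (norm_fst_le y.2.1).trans h4'
  have h6 : ‖M‖ ≤ N := (norm_fst_le (M, θ)).trans h5
  have h7 : ‖s + weylShift κe κm (matOf M) (split 1 m P).1‖ ≤ N := (norm_snd_le y.2.1).trans h4'
  have h8 : ‖s‖ ≤ N + 4 * (|κe| + |κm|) * (N * N) := by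
    have e := norm_sub_le (s + weylShift κe κm (matOf M) (split 1 m P).1)
      (weylShift κe κm (matOf M) (split 1 m P).1)
    rw [add_sub_cancel_right] at e
    have e2 := norm_weylShift_le κe κm M (split 1 m P).1
    have e3 : ‖(split 1 m P).1‖ * ‖M‖ ≤ N * N := mul_le_mul h1 h6 (norm_nonneg _) hN
    have e4 : 4 * (|κe| + |κm|) * (‖(split 1 m P).1‖ * ‖M‖) ≤ 4 * (|κe| + |κm|) * (N * N) := by
      gcongr
    linarith
  have h9 : ‖P‖ ≤ L * N := by
    have e := hL.le_mul_dist P 0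
    rw [map_zero, dist_zero_right, dist_zero_right] at e
    refine e.trans (mul_le_mul_of_nonneg_left ?_ L.2)
    exact max_le h1 h3
  have hk : 0 ≤ 4 * (|κe| + |κm|) := by positivity
  have hL0 : (0 : ℝ) ≤ L := L.2
  have hNN : 0 ≤ N * N := mul_nonneg hN hN
  have g1 : N ≤ (1 + N) ^ 2 := by nlinarith
  have g2 : N * N ≤ (1 + N) ^ 2 := by nlinarith
  have hsq : 0 ≤ (1 + N) ^ 2 := by positivity
  have a1 := mul_le_mul_of_nonneg_left g1 hL0
  have a2 := mul_le_mul_of_nonneg_left g2 hk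
  have a3 := mul_nonneg hL0 hsq
  have a4 := mul_nonneg hk hsq
  refine max_le (max_le ?_ ?_) ?_
  · change ‖(M, θ)‖ ≤ _
    linarith
  · change ‖s‖ ≤ _
    linarith
  · change ‖P‖ ≤ _
    linarith

/-- The action of a test function on functions of the parameters and the momenta. -/
def timesPar (f : 𝓢(X 1, ℂ)) (𝒢 : 𝓢(Par × X m, ℂ)) : 𝓢(Par × X (1 + m), ℂ) :=
  mulPhase (fun x : Par × X (1 + m) => weylExponent κe κm (matOf x.1.1.1) (split 1 m x.2).1 x.1.2)
    (weylExponent_comp_hasTemperateGrowth κe κm (matOf_hasTemperateGrowth m)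
      (fst_split_hasTemperateGrowth m) (((ContinuousLinearMap.snd ℝ _ _).comp
        (ContinuousLinearMap.fst ℝ Par (X (1 + m)))).hasTemperateGrowth))
    (compCLM ℂ (shearPar_hasTemperateGrowth κe κm m) (shearPar_upper κe κm m) (tensor f 𝒢))

theorem timesPar_apply (f : 𝓢(X 1, ℂ)) (𝒢 : 𝓢(Par × X m, ℂ)) (M θ : R16) (s : R2)
    (P : X (1 + m)) :
    timesPar κe κm m f 𝒢 (((M, θ), s), P) =
      f (split 1 m P).1 * weyl κe κm (matOf M) (split 1 m P).1
        (fun s' => 𝒢 (((M, θ), s'), (split 1 m P).2)) s := by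
  change Complex.exp _ * (f _ * 𝒢 _) = _
  simp only [weyl, shearPar]
  ring

end Times

/-- The value of a Lorentz section as an element of `ℝ¹⁶`. -/
def LorentzSection.vec {κe κm : ℝ} (Λ : LorentzSection κe κm) (θ : Sig κe κm) : R16 :=
  WithLp.toLp 2 fun i => Λ.toFun θ i.1 i.2

theorem LorentzSection.matOf_vec {κe κm : ℝ} (Λ : LorentzSection κe κm) (θ : Sig κe κm) :
    matOf (Λ.vec θ) = Λ.toFun θ := rfl

theorem LorentzSection.measurable_vec {κe κm : ℝ} (Λ : LorentzSection κe κm) :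
    Measurable Λ.vec :=
  (WithLp.measurable_toLp 2 _).comp (measurable_pi_lambda _ fun i => Λ.measurable i.1 i.2)

/-- Functions of `θ`, `s` and the momenta, which depend on `θ` through smooth functions of `θ` and
`Λ_θ` and have compact support in `θ`. -/
def SmoothPar {κe κm : ℝ} (Λ : LorentzSection κe κm) {n : ℕ} (G : Sig κe κm → 𝓢(R2 × X n, ℂ)) :
    Prop :=
  ∃ 𝒢 : 𝓢(Par × X n, ℂ), (∃ C : Set R16, IsCompact C ∧ ∀ M θ s P, θ ∉ C → 𝒢 (((M, θ), s), P) = 0) ∧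
    ∀ θ s P, G θ (s, P) = 𝒢 (((Λ.vec θ, θ), s), P)

/-- The matrix `M` is an independent Schwartz variable of `𝒢`, evaluated at Λ_θ only at the end.
Since Λ is merely measurable in `θ`, it must never be differentiated. -/
theorem SmoothPar.times {κe κm : ℝ} {Λ : LorentzSection κe κm} {m : ℕ}
    {G : Sig κe κm → 𝓢(R2 × X m, ℂ)} (hG : SmoothPar Λ G) (f : 𝓢(X 1, ℂ)) :
    SmoothPar Λ fun θ => timesS κe κm (Λ.toFun θ) f (G θ) := by
  obtain ⟨𝒢, ⟨C, hC, h0⟩, h⟩ := hG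
  refine ⟨timesPar κe κm m f 𝒢, ⟨C, hC, fun M θ s P hθ => ?_⟩, fun θ s P => ?_⟩
  · rw [timesPar_apply]
    simp [weyl, h0 _ _ _ _ hθ]
  · rw [timesPar_apply, timesS_apply, Λ.matOf_vec]
    simp only [h]

/-- Local boundedness keeps Λ_θ in a compact set of matrices while `θ` ranges over a compact set.
The cutoff supplies the decay in `M` needed for a Schwartz function of (M, θ, s). -/
theorem LorentzSection.exists_cutoff {κe κm : ℝ} (Λ : LorentzSection κe κm) {C : Set R16}
    (hC : IsCompact C) : ∃ χ : 𝓢(R16, ℂ), ∀ θ : Sig κe κm, (θ : R16) ∈ C → χ (Λ.vec θ) = 1 := by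
  obtain ⟨B, hB⟩ := Λ.bounded (Subtype.val ⁻¹' C)
    ((isClosed_Sig κe κm).isClosedEmbedding_subtypeVal.isCompact_preimage hC)
  obtain ⟨χ, -, hχ⟩ := WeylWigner.exists_cutoff
    (WithLp.toLp 2 '' (Set.Icc (fun _ => -B) (fun _ => B) : Set (Fin 4 × Fin 4 → ℝ)) : Set R16)
    (isCompact_Icc.image (PiLp.continuous_toLp 2 _))
  refine ⟨χ, fun θ hθ => hχ _ ⟨fun i => Λ.toFun θ i.1 i.2, ⟨fun i => ?_, fun i => ?_⟩, rfl⟩⟩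
  · exact (abs_le.mp (hB θ hθ i.1 i.2)).1
  · exact (abs_le.mp (hB θ hθ i.1 i.2)).2

/-- The rearrangement `((M, θ), s) ↦ (M, (θ, s))`. -/
def assocPar : Par →L[ℝ] R16 × (R16 × R2) :=
  ((ContinuousLinearMap.fst ℝ _ _).comp (ContinuousLinearMap.fst ℝ (R16 × R16) R2)).prod
    (((ContinuousLinearMap.snd ℝ _ _).comp (ContinuousLinearMap.fst ℝ (R16 × R16) R2)).prod
      (ContinuousLinearMap.snd ℝ (R16 × R16) R2))

theorem assocPar_injective : Function.Injective assocPar := by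
  rintro ⟨⟨M, θ⟩, s⟩ ⟨⟨M', θ'⟩, s'⟩ h
  simp only [assocPar, ContinuousLinearMap.prod_apply, ContinuousLinearMap.comp_apply,
    ContinuousLinearMap.coe_fst', ContinuousLinearMap.coe_snd', Prod.mk.injEq] at h
  obtain ⟨rfl, rfl, rfl⟩ := h
  rfl

theorem SmoothPar.elem {κe κm : ℝ} (Λ : LorentzSection κe κm) {v : R2 × R16 → ℂ}
    (h₁ : ContDiff ℝ (⊤ : ℕ∞) v) (h₂ : HasCompactSupport v) {n : ℕ} (g : 𝓢(X n, ℂ)) :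
    SmoothPar Λ fun θ : Sig κe κm => tensor (sliceV h₁ h₂ (θ : R16)) g := by
  have hC : IsCompact (Prod.snd '' tsupport v) := IsCompact.image h₂ continuous_snd
  obtain ⟨χ, hχ⟩ := Λ.exists_cutoff hC
  set v' : 𝓢(R16 × R2, ℂ) := HasCompactSupport.toSchwartzMap (f := fun z : R16 × R2 => v z.swap)
    (h₂.comp_homeomorph (Homeomorph.prodComm R16 R2))
    (h₁.comp (contDiff_snd.prodMk contDiff_fst))
  have h0 : ∀ s θ, θ ∉ Prod.snd '' tsupport v → v (s, θ) = 0 := fun s θ hθ => by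
    by_contra hne
    exact hθ ⟨(s, θ), subset_tsupport _ hne, rfl⟩
  refine ⟨tensor (compInj assocPar assocPar_injective (tensor χ v')) g,
    ⟨_, hC, fun M θ s P hθ => ?_⟩, fun θ s P => ?_⟩
  · change χ M * v (s, θ) * g P = 0
    rw [h0 s θ hθ]
    simp
  · change v (s, θ) * g P = χ (Λ.vec θ) * v (s, θ) * g P
    by_cases hθ : (θ : R16) ∈ Prod.snd '' tsupport v
    · rw [hχ θ hθ, one_mul]
    · rw [h0 s θ hθ]
      simp

/-- Measurable functions of `s` and `θ` with rapid decay in `s` and compact support in `θ`. -/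
def RapidDecay {κe κm : ℝ} {H : Type*} [NormedAddCommGroup H] (F : R2 × Sig κe κm → H) : Prop :=
  StronglyMeasurable F ∧ ∃ (C : Set (Sig κe κm)) (B : ℝ), IsCompact C ∧ (∀ s, ∀ θ ∉ C, F (s, θ) = 0) ∧
    ∀ s θ, (1 + ‖s‖) ^ (volume : Measure R2).integrablePower * ‖F (s, θ)‖ ≤ B

namespace RapidDecay

variable {κe κm : ℝ} {H : Type*} [NormedAddCommGroup H] {F F' : R2 × Sig κe κm → H}

theorem zero : RapidDecay (fun _ : R2 × Sig κe κm => (0 : H)) :=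
  ⟨stronglyMeasurable_const, ∅, 0, isCompact_empty, by simp, by simp⟩

theorem add (h : RapidDecay F) (h' : RapidDecay F') : RapidDecay fun z => F z + F' z := by
  obtain ⟨hm, C, B, hC, h0, hB⟩ := h
  obtain ⟨hm', C', B', hC', h0', hB'⟩ := h'
  refine ⟨hm.add hm', C ∪ C', B + B', hC.union hC', fun s θ hθ => ?_, fun s θ => ?_⟩
  · beta_reduce
    rw [h0 s θ fun h => hθ (Or.inl h), h0' s θ fun h => hθ (Or.inr h), add_zero]
  · refine (mul_le_mul_of_nonneg_left (norm_add_le _ _) (by positivity)).trans ?_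
    rw [mul_add]
    exact add_le_add (hB s θ) (hB' s θ)

theorem const_smul [NormedSpace ℂ H] (h : RapidDecay F) (c : ℂ) : RapidDecay fun z => c • F z := by
  obtain ⟨hm, C, B, hC, h0, hB⟩ := h
  refine ⟨hm.const_smul c, C, ‖c‖ * B, hC, fun s θ hθ => ?_, fun s θ => ?_⟩
  · beta_reduce
    rw [h0 s θ hθ, smul_zero]
  · rw [norm_smul, mul_left_comm]
    exact mul_le_mul_of_nonneg_left (hB s θ) (norm_nonneg _)

theorem sum {ι : Type*} (s : Finset ι) {F : ι → R2 × Sig κe κm → H} (h : ∀ i, RapidDecay (F i)) :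
    RapidDecay fun z => ∑ i ∈ s, F i z := by
  classical
  induction s using Finset.induction_on with
  | empty => simpa using zero
  | insert i s hi ih =>
    simp only [Finset.sum_insert hi]
    exact (h i).add ih

theorem memLp (hκ : κe ≠ 0 ∨ κm ≠ 0) (h : RapidDecay F) : MemLp F 2 (vMeasure κe κm) := by
  have := isLocallyFiniteMeasure_Sig hκ
  obtain ⟨hm, C, B, hC, h0, hB⟩ := h
  have hB0 : 0 ≤ B ^ 2 := sq_nonneg B
  rw [memLp_two_iff_integrable_sq_norm hm.aestronglyMeasurable]
  -- The majorant factorises into an integrable power of 1 + ‖s‖ and the indicator of a compact set,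
  -- which has finite σ-measure.
  have hint : Integrable (fun z : R2 × Sig κe κm =>
      (B ^ 2 * (1 + ‖z.1‖) ^ (-((volume : Measure R2).integrablePower : ℝ))) *
        C.indicator (fun _ => (1 : ℝ)) z.2) (vMeasure κe κm) := by
    refine Integrable.mul_prod ((Measure.integrable_pow_neg_integrablePower volume).const_mul _) ?_
    exact (integrable_indicator_iff hC.measurableSet).mpr
      (integrableOn_const hC.measure_lt_top.ne)
  refine hint.mono' (hm.norm.pow 2).aestronglyMeasurable (Filter.Eventually.of_forall ?_)
  rintro ⟨s, θ⟩
  rw [Real.norm_of_nonneg (by positivity)]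
  by_cases hθ : θ ∈ C
  · simp only [Set.indicator_of_mem hθ, mul_one]
    rw [Real.rpow_neg (by positivity), Real.rpow_natCast, ← div_eq_mul_inv,
      le_div_iff₀ (by positivity)]
    set w := (1 + ‖s‖) ^ (volume : Measure R2).integrablePower with hw
    have hw1 : 1 ≤ w := one_le_pow₀ (by linarith [norm_nonneg s])
    have hb := hB s θ
    have hn := norm_nonneg (F (s, θ))
    calc ‖F (s, θ)‖ ^ 2 * w ≤ (w * ‖F (s, θ)‖) ^ 2 := by
          rw [mul_pow, mul_comm]
          gcongr
          nlinarith
      _ ≤ B ^ 2 := by gcongr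
  · rw [h0 s θ hθ]
    simp only [norm_zero]
    rw [zero_pow two_ne_zero]
    exact mul_nonneg (by positivity) (Set.indicator_nonneg (fun _ _ => zero_le_one) _)

end RapidDecay

/-- The slice at (s, θ) is the slice of the single Schwartz function `𝒢` at ((Λ_θ, θ), s).
Measurability follows from continuity of slices and measurability of Λ, and the decay in `s` is
uniform in `θ`. -/
theorem SmoothPar.rapidDecay {κe κm : ℝ} {Λ : LorentzSection κe κm} {n : ℕ}
    {G : Sig κe κm → 𝓢(R2 × X n, ℂ)} (hG : SmoothPar Λ G) {H : Type*} [NormedAddCommGroup H]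
    [NormedSpace ℂ H] (a : 𝓢(X n, ℂ) →L[ℂ] H) :
    RapidDecay fun z : R2 × Sig κe κm => a (slice z.1 (G z.2)) := by
  obtain ⟨𝒢, ⟨C, hC, h0⟩, h⟩ := hG
  have hs : ∀ s θ, slice s (G θ) = slice ((Λ.vec θ, (θ : R16)), s) 𝒢 := fun s θ => by
    ext P
    exact h θ s P
  refine ⟨?_, Subtype.val ⁻¹' C, ?_⟩
  · simp only [hs]
    exact (a.continuous.comp (continuous_slice 𝒢)).stronglyMeasurable.comp_measurable
      (((Λ.measurable_vec.comp measurable_snd).prodMk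
        (measurable_subtype_coe.comp measurable_snd)).prodMk measurable_fst)
  obtain ⟨t, D, hD, hb⟩ := exists_slice_bound (V := Par) (a.restrictScalars ℝ)
    (volume : Measure R2).integrablePower
  refine ⟨D * t.sup (schwartzSeminormFamily ℝ (Par × X n) ℂ) 𝒢,
    (isClosed_Sig κe κm).isClosedEmbedding_subtypeVal.isCompact_preimage hC,
    fun s θ hθ => ?_, fun s θ => ?_⟩
  · have : slice s (G θ) = 0 := by
      ext P
      rw [hs]
      exact h0 _ _ _ _ hθ
    simp [this]
  · simp only [hs]
    refine le_trans ?_ (hb 𝒢 ((Λ.vec θ, (θ : R16)), s))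
    rw [ContinuousLinearMap.coe_restrictScalars']
    gcongr
    exact norm_snd_le ((Λ.vec θ, (θ : R16)), s)

/-- The span of the functions with components of class `SmoothPar`. -/
def smoothSpan {κe κm : ℝ} (Λ : LorentzSection κe κm) (K : ℕ) :
    Submodule ℂ (AmbBorchers κe κm K) :=
  Submodule.span ℂ {g | ∃ (n : ℕ) (G : Amb κe κm K n), (∀ k, SmoothPar Λ (G k)) ∧
    g = DirectSum.lof ℂ ℕ (Amb κe κm K) n G}

/-- The regularity class contains the generators and is stable under the action, so minimality of
the enlarged algebra applies. -/
theorem enlarged_le_smoothSpan {κe κm : ℝ} (Λ : LorentzSection κe κm) (K : ℕ) :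
    enlarged Λ K ≤ smoothSpan Λ K := by
  refine sInf_le ⟨fun v h₁ h₂ g => ?_, fun f g hg => ?_⟩
  · induction g using DirectSum.induction_on with
    | zero => simp
    | add g g' h h' => rw [map_add]; exact Submodule.add_mem _ h h'
    | of n g =>
      refine Submodule.subset_span ⟨n, elemN h₁ h₂ n g,
        fun k => SmoothPar.elem Λ h₁ h₂ (FT n (g k)), ?_⟩
      rw [← DirectSum.lof_eq_of ℂ, elem, DirectSum.toModule_lof]
      rfl
  · induction hg using Submodule.span_induction with
    | zero => simp
    | add g g' _ _ h h' => rw [map_add]; exact Submodule.add_mem _ h h'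
    | smul c g _ h => rw [map_smul]; exact Submodule.smul_mem _ _ h
    | mem g hg =>
      obtain ⟨n, G, hG, rfl⟩ := hg
      refine Submodule.subset_span ⟨1 + n, timesN Λ f n G, fun k => (hG _).times _, ?_⟩
      rw [times, DirectSum.toModule_lof]
      rfl

namespace FieldTheory

variable {K : ℕ} {H : Type*} [NormedAddCommGroup H] [InnerProductSpace ℂ H] (T : FieldTheory K H)
  {κe κm : ℝ} (Λ : LorentzSection κe κm)

theorem PsiOt_lof (n : ℕ) (G : Amb κe κm K n) (z : R2 × Sig κe κm) :
    T.PsiOt (DirectSum.lof ℂ ℕ (Amb κe κm K) n G) z = ∑ k, T.cmp n k (slice z.1 (G k z.2)) := by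
  obtain ⟨s, θ⟩ := z
  rw [PsiOt_eq, restrict, DirectSum.toModule_lof, LinearMap.comp_apply, PsiFib_lof]
  rfl

theorem rapidDecay_PsiOt {g : AmbBorchers κe κm K} (hg : g ∈ enlarged Λ K) :
    RapidDecay (T.PsiOt g) := by
  replace hg := enlarged_le_smoothSpan Λ K hg
  induction hg using Submodule.span_induction with
  | zero =>
    have : T.PsiOt (0 : AmbBorchers κe κm K) = fun _ => 0 := by funext z; simp [PsiOt]
    rw [this]
    exact RapidDecay.zero
  | add g g' _ _ h h' =>
    have : T.PsiOt (g + g') = fun z => T.PsiOt g z + T.PsiOt g' z := by funext z; simp [PsiOt]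
    rw [this]
    exact h.add h'
  | smul c g _ h =>
    have : T.PsiOt (c • g) = fun z => c • T.PsiOt g z := by funext z; simp [PsiOt]
    rw [this]
    exact h.const_smul c
  | mem g hg =>
    obtain ⟨n, G, hG, rfl⟩ := hg
    rw [funext (T.PsiOt_lof n G)]
    exact RapidDecay.sum _ fun k => (hG k).rapidDecay (T.cmp n k)

/-- The functions `Ψ^⊗(𝐠)` are square integrable. -/
theorem memLp_PsiOt (hκ : κe ≠ 0 ∨ κm ≠ 0) {g : AmbBorchers κe κm K} (hg : g ∈ enlarged Λ K) :
    MemLp (T.PsiOt g) 2 (vMeasure κe κm) :=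
  (T.rapidDecay_PsiOt Λ hg).memLp hκ

end FieldTheory

/-! ### Operators on quotients -/

section Descend

variable {M N : Type*} [AddCommGroup M] [Module ℂ M] [NormedAddCommGroup N] [InnerProductSpace ℂ N]

/-- An endomorphism with a formal adjoint descends along a surjective map. -/
theorem exists_descend (p : M →ₗ[ℂ] N) (hp : Function.Surjective p) (q q' : Module.End ℂ M)
    (h : ∀ x y, ⟪p x, p (q y)⟫_ℂ = ⟪p (q' x), p y⟫_ℂ) :
    ∃ A : Module.End ℂ N, ∀ g, A (p g) = p (q g) := by
  have hk : p.ker ≤ (p.comp q).ker := fun g hg => by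
    rw [LinearMap.mem_ker] at hg
    rw [LinearMap.mem_ker, LinearMap.comp_apply]
    -- If p(g) = 0, then ‖p(q g)‖² = ⟪p(q' (q g)), p g⟫ = 0.
    have := h (q g) g
    rwa [hg, inner_zero_right, inner_self_eq_zero] at this
  refine ⟨(p.ker.liftQ (p.comp q) hk).comp
    (p.quotKerEquivOfSurjective hp).symm.toLinearMap, fun g => ?_⟩
  have : (p.quotKerEquivOfSurjective hp).symm (p g) = p.ker.mkQ g := by
    rw [LinearEquiv.symm_apply_eq]
    rfl
  rw [LinearMap.comp_apply, LinearEquiv.coe_coe, this]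
  rfl

theorem IsFormalAdjoint.symm {A B : Module.End ℂ N} (h : IsFormalAdjoint A B) :
    IsFormalAdjoint B A := fun x y => by
  rw [← inner_conj_symm, ← h, inner_conj_symm]

theorem IsFormalAdjoint.add {A A' B B' : Module.End ℂ N} (h : IsFormalAdjoint A B)
    (h' : IsFormalAdjoint A' B') : IsFormalAdjoint (A + A') (B + B') := fun x y => by
  simp only [LinearMap.add_apply, inner_add_left, inner_add_right, h x y, h' x y]

theorem IsFormalAdjoint.mul {A A' B B' : Module.End ℂ N} (h : IsFormalAdjoint A B)
    (h' : IsFormalAdjoint A' B') : IsFormalAdjoint (A * A') (B' * B) := fun x y => by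
  rw [Module.End.mul_apply, Module.End.mul_apply, h, h']

theorem isFormalAdjoint_algebraMap (c : ℂ) :
    IsFormalAdjoint (algebraMap ℂ (Module.End ℂ N) c)
      (algebraMap ℂ (Module.End ℂ N) ((starRingEnd ℂ) c)) := fun x y => by
  simp [Module.algebraMap_end_apply, mul_comm]

theorem IsFormalAdjoint.unique {A B B' : Module.End ℂ N} (h : IsFormalAdjoint A B)
    (h' : IsFormalAdjoint A B') : B = B' := by
  refine LinearMap.ext fun y => ext_inner_left ℂ fun x => ?_
  rw [← h, ← h']

end Descend

theorem conjT_conjT {K : ℕ} {H : Type*} [NormedAddCommGroup H] [InnerProductSpace ℂ H]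
    (T : FieldTheory K H) (f : TestFn K 1) : conjT T.bar (conjT T.bar f) = f := by
  funext k
  ext x
  change (starRingEnd ℂ) ((starRingEnd ℂ) (f (fun j => T.bar (T.bar (k j))) x)) = _
  simp [T.bar_bar]

theorem times_mem_enlarged {κe κm : ℝ} (Λ : LorentzSection κe κm) {K : ℕ} (f : TestFn K 1)
    {g : AmbBorchers κe κm K} (hg : g ∈ enlarged Λ K) : times Λ f g ∈ enlarged Λ K := by
  rw [enlarged, Submodule.mem_sInf] at *
  exact fun W hW => hW.2 f g (hg W hW)

theorem elem_mem_enlarged {κe κm : ℝ} (Λ : LorentzSection κe κm) {K : ℕ} {v : R2 × R16 → ℂ}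
    (h₁ : ContDiff ℝ (⊤ : ℕ∞) v) (h₂ : HasCompactSupport v) (g : Borchers K) :
    elem h₁ h₂ g ∈ enlarged Λ K := by
  rw [enlarged, Submodule.mem_sInf]
  exact fun W hW => hW.1 v h₁ h₂ g

/-- The action of a test function on the enlarged algebra. -/
def timesE {κe κm : ℝ} (Λ : LorentzSection κe κm) {K : ℕ} (f : TestFn K 1) :
    Module.End ℂ (enlarged Λ K) :=
  (times Λ f).restrict fun _ hg => times_mem_enlarged Λ f hg

theorem coe_timesE {κe κm : ℝ} (Λ : LorentzSection κe κm) {K : ℕ} (f : TestFn K 1)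
    (g : enlarged Λ K) : (timesE Λ f g : AmbBorchers κe κm K) = times Λ f g := rfl

namespace FieldTheory

variable {K : ℕ} {H : Type*} [NormedAddCommGroup H] [InnerProductSpace ℂ H] (T : FieldTheory K H)
  {κe κm : ℝ} (Λ : LorentzSection κe κm) (hκ : κe ≠ 0 ∨ κm ≠ 0)

/-- The vectors `Ψ^⊗(𝐠)`, as a linear map. -/
def PsiOtL : enlarged Λ K →ₗ[ℂ] T.domOt Λ where
  toFun g := ⟨(T.memLp_PsiOt Λ hκ g.2).toLp _, g, g.2, MemLp.coeFn_toLp _⟩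
  map_add' g g' := Subtype.ext <| (MemLp.toLp_congr (T.memLp_PsiOt Λ hκ (g + g').2)
      ((T.memLp_PsiOt Λ hκ g.2).add (T.memLp_PsiOt Λ hκ g'.2))
      (.of_forall fun z => by simp [PsiOt])).trans
      (MemLp.toLp_add (T.memLp_PsiOt Λ hκ g.2) (T.memLp_PsiOt Λ hκ g'.2))
  map_smul' c g := Subtype.ext <| (MemLp.toLp_congr (T.memLp_PsiOt Λ hκ (c • g).2)
      ((T.memLp_PsiOt Λ hκ g.2).const_smul c)
      (.of_forall fun z => by simp [PsiOt])).trans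
      (MemLp.toLp_const_smul c (T.memLp_PsiOt Λ hκ g.2))

theorem coeFn_PsiOtL (g : enlarged Λ K) :
    ((T.PsiOtL Λ hκ g : Lp H 2 (vMeasure κe κm)) : R2 × Sig κe κm → H) =ᵐ[vMeasure κe κm]
      T.PsiOt (g : AmbBorchers κe κm K) :=
  MemLp.coeFn_toLp (T.memLp_PsiOt Λ hκ g.2)

theorem eq_PsiOtL {ξ : T.domOt Λ} {g : AmbBorchers κe κm K} (hg : g ∈ enlarged Λ K)
    (h : (ξ : Lp H 2 (vMeasure κe κm)) =ᵐ[vMeasure κe κm] T.PsiOt g) :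
    ξ = T.PsiOtL Λ hκ ⟨g, hg⟩ :=
  Subtype.ext (Lp.ext (h.trans (T.coeFn_PsiOtL Λ hκ ⟨g, hg⟩).symm))

theorem PsiOtL_surjective : Function.Surjective (T.PsiOtL Λ hκ) := by
  rintro ⟨ξ, g, hg, h⟩
  exact ⟨⟨g, hg⟩, (T.eq_PsiOtL Λ hκ hg h).symm⟩

/-- Fubini with the integral over `s` inside, so that the results for fixed `θ` apply to the inner
integral. -/
theorem inner_PsiOtL [CompleteSpace H] (g g' : enlarged Λ K) :
    ⟪T.PsiOtL Λ hκ g, T.PsiOtL Λ hκ g'⟫_ℂ = ∫ θ, ∫ s,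
      ⟪T.PsiFib (restrict θ (g : AmbBorchers κe κm K)) s,
        T.PsiFib (restrict θ (g' : AmbBorchers κe κm K)) s⟫_ℂ ∂volume ∂(μHE[4]) := by
  have := isLocallyFiniteMeasure_Sig hκ
  have hint := L2.integrable_inner (𝕜 := ℂ) (T.PsiOtL Λ hκ g : Lp H 2 (vMeasure κe κm))
    (T.PsiOtL Λ hκ g' : Lp H 2 (vMeasure κe κm))
  have hae : (fun z => ⟪(T.PsiOtL Λ hκ g : Lp H 2 (vMeasure κe κm)) z,
      (T.PsiOtL Λ hκ g' : Lp H 2 (vMeasure κe κm)) z⟫_ℂ) =ᵐ[vMeasure κe κm]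
      fun z => ⟪T.PsiOt (g : AmbBorchers κe κm K) z, T.PsiOt (g' : AmbBorchers κe κm K) z⟫_ℂ := by
    filter_upwards [T.coeFn_PsiOtL Λ hκ g, T.coeFn_PsiOtL Λ hκ g'] with z h h'
    rw [h, h']
  rw [Submodule.coe_inner, L2.inner_def, integral_congr_ae hae]
  refine (integral_prod_symm _ (hint.congr hae)).trans ?_
  simp only [PsiOt_eq]

variable [CompleteSpace H]

theorem inner_PsiOtL_timesE (f : TestFn K 1) (g g' : enlarged Λ K) :
    ⟪T.PsiOtL Λ hκ g, T.PsiOtL Λ hκ (timesE Λ f g')⟫_ℂ =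
      ⟪T.PsiOtL Λ hκ (timesE Λ (conjT T.bar f) g), T.PsiOtL Λ hκ g'⟫_ℂ := by
  simp only [inner_PsiOtL, coe_timesE, restrict_times, integral_inner_timesFib]

/-- The deformed field operators. -/
def field (f : TestFn K 1) : Module.End ℂ (T.domOt Λ) :=
  (exists_descend (T.PsiOtL Λ hκ) (T.PsiOtL_surjective Λ hκ) (timesE Λ f) _
    (T.inner_PsiOtL_timesE Λ hκ f)).choose

theorem field_PsiOtL (f : TestFn K 1) (g : enlarged Λ K) :
    T.field Λ hκ f (T.PsiOtL Λ hκ g) = T.PsiOtL Λ hκ (timesE Λ f g) :=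
  (exists_descend (T.PsiOtL Λ hκ) (T.PsiOtL_surjective Λ hκ) (timesE Λ f) _
    (T.inner_PsiOtL_timesE Λ hκ f)).choose_spec g

/-- Every vector of the domain is some Ψ^⊗(𝐠), so the defining relation leaves no freedom. -/
theorem isDeformedField_iff {f : TestFn K 1} {A : Module.End ℂ (T.domOt Λ)} :
    T.IsDeformedField Λ f A ↔ A = T.field Λ hκ f := by
  constructor
  · intro h
    refine LinearMap.ext fun ξ => ?_
    obtain ⟨g, rfl⟩ := T.PsiOtL_surjective Λ hκ ξ
    rw [field_PsiOtL]
    exact T.eq_PsiOtL Λ hκ _ (h _ g g.2 (T.coeFn_PsiOtL Λ hκ g))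
  · rintro rfl ξ g hg h
    rw [T.eq_PsiOtL Λ hκ hg h, field_PsiOtL]
    exact T.coeFn_PsiOtL Λ hκ _

theorem field_adjoint (f : TestFn K 1) :
    IsFormalAdjoint (T.field Λ hκ f) (T.field Λ hκ (conjT T.bar f)) := by
  intro x y
  obtain ⟨g, rfl⟩ := T.PsiOtL_surjective Λ hκ x
  obtain ⟨g', rfl⟩ := T.PsiOtL_surjective Λ hκ y
  rw [field_PsiOtL, field_PsiOtL, inner_PsiOtL_timesE, conjT_conjT]

theorem polyAlgebra_eq : T.polyAlgebra Λ = Algebra.adjoin ℂ (Set.range (T.field Λ hκ)) := by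
  rw [polyAlgebra]
  congr 1
  ext A
  simp only [isDeformedField_iff T Λ hκ, Set.mem_ofPred_eq, Set.mem_range, eq_comm]

end FieldTheory

/-! ### Representations of the free algebra -/

section FreeAlgebra

variable {ι : Type*}

/-- A homomorphism on the range of another homomorphism, with larger kernel. -/
theorem exists_algHom_of_range {R F A B : Type*} [CommRing R] [Ring F] [Ring A] [Ring B]
    [Algebra R F] [Algebra R A] [Algebra R B] (ρ : F →ₐ[R] A) (σ : F →ₐ[R] B)
    (h : ∀ w, ρ w = 0 → σ w = 0) {S : Subalgebra R A} (hS : S = ρ.range) :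
    ∃ π : S →ₐ[R] B, ∀ (s : S) (w : F), (s : A) = ρ w → π s = σ w := by
  subst hS
  have hmem : ∀ s : ρ.range, ∃ w, ρ w = s := fun s => s.2
  choose c hc using hmem
  have key : ∀ w w', ρ w = ρ w' → σ w = σ w' := fun w w' e => by
    have := h (w - w') (by rw [map_sub, e, sub_self])
    rwa [map_sub, sub_eq_zero] at this
  refine ⟨AlgHom.ofLinearMap
    { toFun := fun s => σ (c s)
      map_add' := fun s s' => by
        rw [← map_add]
        exact key _ _ (by simp [hc])
      map_smul' := fun r s => by
        rw [RingHom.id_apply, ← map_smul]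
        exact key _ _ (by simp [hc]) } ?_ ?_, fun s w hs => key _ _ (by rw [hc, hs])⟩
  · change σ (c 1) = 1
    rw [← map_one σ]
    exact key _ _ (by simp [hc])
  · intro s s'
    change σ (c (s * s')) = σ (c s) * σ (c s')
    rw [← map_mul]
    exact key _ _ (by simp [hc])

theorem lift_intertwine {M N : Type*} [AddCommGroup M] [Module ℂ M] [AddCommGroup N] [Module ℂ N]
    (a : ι → Module.End ℂ M) (b : ι → Module.End ℂ N) (p : M →ₗ[ℂ] N)
    (h : ∀ i m, p (a i m) = b i (p m)) (w : FreeAlgebra ℂ ι) (m : M) :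
    p (FreeAlgebra.lift ℂ a w m) = FreeAlgebra.lift ℂ b w (p m) := by
  induction w using FreeAlgebra.induction generalizing m with
  | grade0 r => simp [Module.algebraMap_end_apply]
  | grade1 i => simpa using h i m
  | mul w w' h h' => simp [h, h']
  | add w w' h h' => simp [h, h']

/-- Adjoints of polynomials, simultaneously in two representations. -/
theorem exists_adjoint_lift {M N : Type*} [NormedAddCommGroup M] [InnerProductSpace ℂ M]
    [NormedAddCommGroup N] [InnerProductSpace ℂ N]
    (a : ι → Module.End ℂ M) (b : ι → Module.End ℂ N) (c : ι → ι)
    (ha : ∀ i, IsFormalAdjoint (a i) (a (c i))) (hb : ∀ i, IsFormalAdjoint (b i) (b (c i)))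
    (w : FreeAlgebra ℂ ι) : ∃ w' : FreeAlgebra ℂ ι,
      IsFormalAdjoint (FreeAlgebra.lift ℂ a w) (FreeAlgebra.lift ℂ a w') ∧
      IsFormalAdjoint (FreeAlgebra.lift ℂ b w) (FreeAlgebra.lift ℂ b w') := by
  induction w using FreeAlgebra.induction with
  | grade0 r =>
    refine ⟨algebraMap ℂ _ ((starRingEnd ℂ) r), ?_, ?_⟩ <;>
    · rw [AlgHom.commutes, AlgHom.commutes]
      exact isFormalAdjoint_algebraMap r
  | grade1 i =>
    refine ⟨FreeAlgebra.ι ℂ (c i), ?_, ?_⟩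
    · simpa using ha i
    · simpa using hb i
  | mul w w' h h' =>
    obtain ⟨u, h1, h2⟩ := h
    obtain ⟨u', h1', h2'⟩ := h'
    refine ⟨u' * u, ?_, ?_⟩
    · simpa using h1.mul h1'
    · simpa using h2.mul h2'
  | add w w' h h' =>
    obtain ⟨u, h1, h2⟩ := h
    obtain ⟨u', h1', h2'⟩ := h'
    refine ⟨u + u', ?_, ?_⟩
    · simpa using h1.add h1'
    · simpa using h2.add h2'

end FreeAlgebra

/-! ### Moyal polynomials and strong cyclicity of the vacuum -/

/-- Polynomials of Moyal multiplications. -/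
def moyalPoly (K : ℕ) (θ : R16) : FreeAlgebra ℂ (TestFn K 1) →ₐ[ℂ] Module.End ℂ (Borchers K) :=
  FreeAlgebra.lift ℂ fun f => moyal K θ (emb f)

/-- The linear maps on the Borchers-Uhlmann algebra which are continuous on each summand. -/
def IsSummandwiseContinuous {K : ℕ} {H : Type*} [NormedAddCommGroup H] [InnerProductSpace ℂ H]
    (l : Borchers K →ₗ[ℂ] H) : Prop :=
  ∀ n, Continuous fun g : TestFn K n => l (DirectSum.lof ℂ ℕ (TestFn K) n g)

theorem continuous_moyalN {K : ℕ} (θ : R16) (f : TestFn K 1) (m : ℕ) :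
    Continuous fun g : TestFn K m => moyalN θ f g :=
  continuous_pi fun k => (((FT (1 + m)).symm.continuous.comp
    (moyalS θ (FT 1 (f fun j => k (Fin.castAdd m j)))).continuous).comp (FT m).continuous).comp
    (continuous_apply fun j => k (Fin.natAdd 1 j))

theorem IsSummandwiseContinuous.moyalPoly {K : ℕ} {H : Type*} [NormedAddCommGroup H]
    [InnerProductSpace ℂ H] {l : Borchers K →ₗ[ℂ] H} (hl : IsSummandwiseContinuous l) (θ : R16)
    (w : FreeAlgebra ℂ (TestFn K 1)) : IsSummandwiseContinuous (l.comp (moyalPoly K θ w)) := by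
  induction w using FreeAlgebra.induction generalizing l with
  | grade0 r =>
    intro n
    have h := (hl n).const_smul r
    simp only [WeylWigner.moyalPoly, AlgHom.commutes, LinearMap.comp_apply,
      Module.algebraMap_end_apply, map_smul]
    exact h
  | grade1 f =>
    intro n
    simp only [WeylWigner.moyalPoly, FreeAlgebra.lift_ι_apply, LinearMap.comp_apply, emb, moyal_lof]
    exact (hl (1 + n)).comp (continuous_moyalN θ f n)
  | mul w w' h h' =>
    rw [map_mul]
    exact h' (h hl)
  | add w w' h h' =>
    intro n
    have h := (h hl n).add (h' hl n)
    simp only [map_add, LinearMap.comp_apply, LinearMap.add_apply] at h ⊢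
    exact h

theorem mulPhase_surjective {E : Type*} [NormedAddCommGroup E] [NormedSpace ℝ E] (Q : E → ℝ)
    (hQ : Q.HasTemperateGrowth) : Function.Surjective (mulPhase Q hQ) := fun f => by
  refine ⟨mulPhase (-Q) hQ.neg f, ?_⟩
  ext x
  rw [mulPhase_apply, mulPhase_apply, ← mul_assoc, ← Complex.exp_add]
  simp

theorem moyalN_single {K : ℕ} (θ : R16) {m : ℕ} (k : Fin (1 + m) → Fin K) (f : 𝓢(X 1, ℂ))
    (g : 𝓢(X m, ℂ)) :
    moyalN θ (Pi.single (fun j => k (Fin.castAdd m j)) ((FT 1).symm f) : TestFn K 1)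
      (Pi.single (fun j => k (Fin.natAdd 1 j)) ((FT m).symm g) : TestFn K m) =
      Pi.single k ((FT (1 + m)).symm (moyalS θ f g)) := by
  funext k'
  by_cases h : k' = k
  · subst h
    simp only [moyalN, Pi.single_eq_same, ContinuousLinearEquiv.apply_symm_apply]
    rfl
  · rw [Pi.single_eq_of_ne h, moyalN]
    by_cases h1 : (fun j => k' (Fin.castAdd m j)) = fun j => k (Fin.castAdd m j)
    · have h2 : (fun j => k' (Fin.natAdd 1 j)) ≠ fun j => k (Fin.natAdd 1 j) := fun h2 =>
        h (funext fun j => Fin.addCases (congrFun h1) (congrFun h2) j)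
      rw [Pi.single_eq_of_ne h2, map_zero, ← prodSCLM_apply]
      simp only [map_zero]
    · rw [Pi.single_eq_of_ne h1, map_zero, ← prodSCLMRight_apply]
      simp only [map_zero]

theorem lof_zero_eq {K : ℕ} (g : TestFn K 0) :
    DirectSum.lof ℂ ℕ (TestFn K) 0 g = g default 0 • unitB K := by
  rw [unitB, ← map_smul]
  congr 1
  funext k
  ext x
  rw [Subsingleton.elim k default, Subsingleton.elim x 0]
  simp [tprod, tprodS_apply]

/-- A subspace of the Borchers-Uhlmann algebra which contains the unit, is closed in each component
and stable under Moyal multiplication by one-variable test functions is everything. -/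
theorem mem_of_moyal_stable {K : ℕ} (θ : R16) (W : Submodule ℂ (Borchers K)) (h1 : unitB K ∈ W)
    (hW : ∀ f, ∀ g ∈ W, moyal K θ (emb f) g ∈ W)
    (hc : ∀ n, IsClosed {g : TestFn K n | DirectSum.lof ℂ ℕ (TestFn K) n g ∈ W})
    (g : Borchers K) : g ∈ W := by
  have key : ∀ n (g : TestFn K n), DirectSum.lof ℂ ℕ (TestFn K) n g ∈ W := by
    intro n
    induction n with
    | zero => exact fun g => by rw [lof_zero_eq]; exact W.smul_mem _ h1
    | succ m ih =>
      rw [add_comm]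
      have hk : ∀ (k : Fin (1 + m) → Fin K) (G : 𝓢(X (1 + m), ℂ)),
          DirectSum.lof ℂ ℕ (TestFn K) (1 + m) (Pi.single k ((FT (1 + m)).symm G)) ∈ W := by
        intro k G
        -- The Moyal phase is invertible, so it suffices to treat functions of the form phase times
        -- `G`. For `G` a product these are Moyal products, and products span a dense subspace.
        obtain ⟨G, rfl⟩ := mulPhase_surjective (moyalExponent θ 1 m)
          (moyalExponent_hasTemperateGrowth θ 1 m) G
        let L : 𝓢(X (1 + m), ℂ) →L[ℂ] TestFn K (1 + m) :=
          (ContinuousLinearMap.single ℂ (fun _ : Fin (1 + m) → Fin K => 𝓢(X (1 + m), ℂ)) k).comp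
            (((FT (1 + m)).symm : 𝓢(X (1 + m), ℂ) →L[ℂ] 𝓢(X (1 + m), ℂ)).comp
              (mulPhase (moyalExponent θ 1 m) (moyalExponent_hasTemperateGrowth θ 1 m)))
        let V : Submodule ℂ 𝓢(X (1 + m), ℂ) :=
          (W.comap (DirectSum.lof ℂ ℕ (TestFn K) (1 + m))).comap (L : _ →ₗ[ℂ] _)
        have hV : IsClosed (V : Set 𝓢(X (1 + m), ℂ)) := (hc (1 + m)).preimage L.continuous
        have hle : Submodule.span ℂ {G : 𝓢(X (1 + m), ℂ) | ∃ a b, G = prodS a b} ≤ V := by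
          rw [Submodule.span_le]
          rintro _ ⟨a, b, rfl⟩
          change DirectSum.lof ℂ ℕ (TestFn K) (1 + m)
            (Pi.single k ((FT (1 + m)).symm (moyalS θ a b))) ∈ W
          rw [← moyalN_single, ← moyal_lof]
          exact hW _ _ (ih _)
        exact hV.closure_subset_iff.mpr hle (dense_span_prodS 1 m G)
      intro g
      rw [← Finset.univ_sum_single g, map_sum]
      refine W.sum_mem fun k _ => ?_
      simpa using hk k (FT (1 + m) (g k))
  induction g using DirectSum.induction_on with
  | zero => exact W.zero_mem
  | add g g' h h' => exact W.add_mem h h'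
  | of n g => exact key n g

namespace FieldTheory

variable {K : ℕ} {H : Type*} [NormedAddCommGroup H] [InnerProductSpace ℂ H] (T : FieldTheory K H)

theorem isSummandwiseContinuous_PsiB : IsSummandwiseContinuous T.PsiB := fun n => by
  simpa [PsiB, DirectSum.toModule_lof] using (T.Psi n).continuous

/-- The orbit of `Ψ(g)` under polynomials in the fields deformed with `θ`. -/
def orbit (θ : R16) : Borchers K →ₗ[ℂ] FreeAlgebra ℂ (TestFn K 1) → H :=
  LinearMap.pi fun w => T.PsiB.comp (moyalPoly K θ w)

theorem orbit_apply (θ : R16) (g : Borchers K) (w : FreeAlgebra ℂ (TestFn K 1)) :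
    T.orbit θ g w = T.PsiB (moyalPoly K θ w g) := rfl

/-- The vacuum is strongly cyclic for the deformed fields. -/
theorem orbit_mem_closure (θ : R16) (g : Borchers K) :
    T.orbit θ g ∈ closure (Set.range fun u => T.orbit θ (moyalPoly K θ u (unitB K))) := by
  let S : Submodule ℂ (FreeAlgebra ℂ (TestFn K 1) → H) :=
    LinearMap.range ((T.orbit θ).comp
      ((moyalPoly K θ).toLinearMap.flip (unitB K)))
  have hS : (S : Set (FreeAlgebra ℂ (TestFn K 1) → H)) =
      Set.range fun u => T.orbit θ (moyalPoly K θ u (unitB K)) := by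
    rw [LinearMap.coe_range]; rfl
  rw [← hS]
  -- The vectors `g` whose orbit lies in the closure form a subspace satisfying the hypotheses. The
  -- product topology on functions of `w` is the graph topology.
  refine mem_of_moyal_stable θ (S.topologicalClosure.comap (T.orbit θ)) ?_ ?_ ?_ g
  · refine subset_closure ⟨1, ?_⟩
    simp
  · intro f g hg
    -- Multiplying `g` by `f` replaces the argument `w` of its orbit by `w * f`, a continuous
    -- operation in the product topology that preserves the space of orbits of the unit.
    have hR : Continuous fun (x : FreeAlgebra ℂ (TestFn K 1) → H) w => x (w * FreeAlgebra.ι ℂ f) :=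
      continuous_pi fun w => continuous_apply _
    have := map_mem_closure hR hg (t := S) ?_
    · have e : T.orbit θ (moyal K θ (emb f) g) =
          fun w => T.orbit θ g (w * FreeAlgebra.ι ℂ f) := by
        funext w
        simp [orbit_apply, moyalPoly]
      change T.orbit θ (moyal K θ (emb f) g) ∈ closure (S : Set _)
      rwa [e]
    · rintro _ ⟨u, rfl⟩
      refine ⟨FreeAlgebra.ι ℂ f * u, ?_⟩
      funext w
      simp [orbit_apply, moyalPoly]
  · exact fun n => isClosed_closure.preimage (continuous_pi fun w =>
      (T.isSummandwiseContinuous_PsiB.moyalPoly θ w) n)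

end FieldTheory

/-! ### Continuity in the deformation parameter -/

theorem moyalExponent_param_hasTemperateGrowth (m : ℕ) :
    (fun z : R16 × X (1 + m) => moyalExponent z.1 1 m z.2).HasTemperateGrowth := by
  unfold moyalExponent twist
  refine Function.HasTemperateGrowth.sum fun l _ => Function.HasTemperateGrowth.sum fun r _ => ?_
  refine (Function.HasTemperateGrowth.const _).mul ?_
  refine Function.HasTemperateGrowth.sum fun μ _ => Function.HasTemperateGrowth.sum fun ν _ => ?_
  have h1 := coord_comp_hasTemperateGrowth
    (ContinuousLinearMap.fst ℝ R16 (X (1 + m))).hasTemperateGrowth (μ, ν)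
  have h2 := coord_comp_hasTemperateGrowth
    (ContinuousLinearMap.snd ℝ R16 (X (1 + m))).hasTemperateGrowth (Fin.castAdd m l, μ)
  have h3 := coord_comp_hasTemperateGrowth
    (ContinuousLinearMap.snd ℝ R16 (X (1 + m))).hasTemperateGrowth (Fin.natAdd 1 r, ν)
  exact (((Function.HasTemperateGrowth.const _).mul h2).mul h1).mul
    ((Function.HasTemperateGrowth.const _).mul h3)

/-- The linear map `(θ, (p, q)) ↦ (p, (θ, q))`. -/
def splitParam (m : ℕ) : R16 × X (1 + m) →L[ℝ] X 1 × (R16 × X m) :=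
  ((ContinuousLinearMap.fst ℝ _ _).comp ((split 1 m).comp (ContinuousLinearMap.snd ℝ _ _))).prod
    ((ContinuousLinearMap.fst ℝ _ _).prod
      ((ContinuousLinearMap.snd ℝ _ _).comp ((split 1 m).comp (ContinuousLinearMap.snd ℝ _ _))))

theorem splitParam_injective (m : ℕ) : Function.Injective (splitParam m) := by
  rintro ⟨θ, P⟩ ⟨θ', P'⟩ h
  have h1 : (split 1 m P).1 = (split 1 m P').1 := congrArg (fun z => z.1) h
  have h2 : θ = θ' := congrArg (fun z => z.2.1) h
  have h3 : (split 1 m P).2 = (split 1 m P').2 := congrArg (fun z => z.2.2) h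
  exact Prod.ext h2 (split_injective 1 m (Prod.ext h1 h3))

/-- The Moyal product with a one-variable test function, for families of functions depending on
the deformation parameter. -/
def moyalParam {m : ℕ} (f : 𝓢(X 1, ℂ)) (G : 𝓢(R16 × X m, ℂ)) : 𝓢(R16 × X (1 + m), ℂ) :=
  mulPhase _ (moyalExponent_param_hasTemperateGrowth m)
    (compInj (splitParam m) (splitParam_injective m) (tensor f G))

theorem slice_moyalParam {m : ℕ} (f : 𝓢(X 1, ℂ)) (G : 𝓢(R16 × X m, ℂ)) (θ : R16) :
    slice θ (moyalParam f G) = moyalS θ f (slice θ G) := rfl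

/-- The family `θ ↦ 𝐠_θ` of test functions of `n` variables. -/
def famN {K : ℕ} (n : ℕ) (G : (Fin n → Fin K) → 𝓢(R16 × X n, ℂ)) (θ : R16) : Borchers K :=
  DirectSum.lof ℂ ℕ (TestFn K) n fun k => (FT n).symm (slice θ (G k))

/-- The families `θ ↦ 𝐠_θ` in the Borchers-Uhlmann algebra which are Schwartz functions. -/
def schwartzFam (K : ℕ) : Submodule ℂ (R16 → Borchers K) :=
  Submodule.span ℂ {G | ∃ n G', G = famN n G'}

/-- The Moyal phase is of temperate growth jointly in `θ` and the momenta, so `θ` can be carried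
along as a further Schwartz variable. Continuity in `θ` then comes from `continuous_slice`. -/
theorem moyal_mem_schwartzFam {K : ℕ} (f : TestFn K 1) {G : R16 → Borchers K}
    (hG : G ∈ schwartzFam K) : (fun θ => moyal K θ (emb f) (G θ)) ∈ schwartzFam K := by
  induction hG using Submodule.span_induction with
  | zero =>
    simp only [Pi.zero_apply, map_zero]
    exact (schwartzFam K).zero_mem
  | add G G' _ _ h h' =>
    simp only [Pi.add_apply, map_add]
    exact (schwartzFam K).add_mem h h'
  | smul c G _ h =>
    simp only [Pi.smul_apply, map_smul]
    exact (schwartzFam K).smul_mem c h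
  | mem G h =>
    obtain ⟨n, G, rfl⟩ := h
    refine Submodule.subset_span ⟨1 + n, fun k => moyalParam
      (FT 1 (f fun j => k (Fin.castAdd n j))) (G fun j => k (Fin.natAdd 1 j)), ?_⟩
    funext θ
    simp only [famN, emb, moyal_lof, slice_moyalParam]
    congr 1
    funext k
    simp only [moyalN, ContinuousLinearEquiv.apply_symm_apply]
    rfl

theorem moyalPoly_mem_schwartzFam {K : ℕ} (w : FreeAlgebra ℂ (TestFn K 1)) {G : R16 → Borchers K}
    (hG : G ∈ schwartzFam K) : (fun θ => moyalPoly K θ w (G θ)) ∈ schwartzFam K := by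
  induction w using FreeAlgebra.induction generalizing G with
  | grade0 r =>
    simp only [moyalPoly, AlgHom.commutes, Module.algebraMap_end_apply]
    exact (schwartzFam K).smul_mem r hG
  | grade1 f =>
    simp only [moyalPoly, FreeAlgebra.lift_ι_apply]
    exact moyal_mem_schwartzFam f hG
  | mul w w' h h' =>
    simp only [map_mul, Module.End.mul_apply]
    exact h (h' hG)
  | add w w' h h' =>
    simp only [map_add, LinearMap.add_apply]
    exact (schwartzFam K).add_mem (h hG) (h' hG)

/-- The weight χ is there because nonzero constant families are not Schwartz in `θ`; χ can be taken
equal to 1 at the point of interest. -/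
theorem smul_unitB_mem_schwartzFam {K : ℕ} (χ : 𝓢(R16, ℂ)) :
    (fun θ => χ θ • unitB K) ∈ schwartzFam K := by
  refine Submodule.subset_span ⟨0, fun k => tensor χ
    (FT 0 ((tprod fun j => j.elim0 : TestFn K 0) k)), ?_⟩
  funext θ
  simp only [famN, slice_tensor, map_smul, ContinuousLinearEquiv.symm_apply_apply, unitB]
  rw [← map_smul]
  rfl

namespace FieldTheory

variable {K : ℕ} {H : Type*} [NormedAddCommGroup H] [InnerProductSpace ℂ H] (T : FieldTheory K H)

theorem continuous_PsiB_schwartzFam {G : R16 → Borchers K} (hG : G ∈ schwartzFam K) :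
    Continuous fun θ => T.PsiB (G θ) := by
  induction hG using Submodule.span_induction with
  | zero => simpa using continuous_const
  | add G G' _ _ h h' =>
    simp only [Pi.add_apply, map_add]
    exact h.add h'
  | smul c G _ h =>
    simp only [Pi.smul_apply, map_smul]
    exact h.const_smul c
  | mem G h =>
    obtain ⟨n, G, rfl⟩ := h
    exact (T.isSummandwiseContinuous_PsiB n).comp (continuous_pi fun k =>
      (FT n).symm.continuous.comp (continuous_slice (G k)))

variable [CompleteSpace H] {κe κm : ℝ} (Λ : LorentzSection κe κm) (hκ : κe ≠ 0 ∨ κm ≠ 0)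

/-- Polynomials in the deformed fields. -/
def poly : FreeAlgebra ℂ (TestFn K 1) →ₐ[ℂ] Module.End ℂ (T.domOt Λ) :=
  FreeAlgebra.lift ℂ (T.field Λ hκ)

theorem polyAlgebra_eq_range : T.polyAlgebra Λ = (T.poly Λ hκ).range := by
  rw [polyAlgebra_eq T Λ hκ, Algebra.adjoin_range_eq_range_freeAlgebra_lift]
  rfl

theorem lift_timesE_PsiOtL (w : FreeAlgebra ℂ (TestFn K 1)) (g : enlarged Λ K) :
    T.PsiOtL Λ hκ (FreeAlgebra.lift ℂ (timesE Λ) w g) = T.poly Λ hκ w (T.PsiOtL Λ hκ g) :=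
  lift_intertwine (timesE Λ) (T.field Λ hκ) (T.PsiOtL Λ hκ)
    (fun f g => (T.field_PsiOtL Λ hκ f g).symm) w g

theorem ae_ae_eq_zero_of_PsiOtL_eq_zero {g : enlarged Λ K} (hg : T.PsiOtL Λ hκ g = 0) :
    ∀ᵐ θ ∂(μHE[4] : Measure (Sig κe κm)), ∀ᵐ s ∂(volume : Measure R2),
      T.PsiFib (restrict θ (g : AmbBorchers κe κm K)) s = 0 := by
  have := isLocallyFiniteMeasure_Sig hκ
  have hae : T.PsiOt (g : AmbBorchers κe κm K) =ᵐ[vMeasure κe κm] 0 := by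
    refine (T.coeFn_PsiOtL Λ hκ g).symm.trans ?_
    rw [hg]
    exact Lp.coeFn_zero H 2 (vMeasure κe κm)
  have hae' := Measure.ae_ae_of_ae_prod
    (Measure.measurePreserving_swap.quasiMeasurePreserving.ae hae)
  simpa only [Prod.swap_prod_mk, PsiOt_eq, Pi.zero_apply] using hae'

end FieldTheory

/-- Two intertwining relations are chained, restriction to the fibre and the embedding V, starting
from v ⊗ 1 = V(1). -/
theorem restrict_lift_timesE_elem_unitB {K : ℕ} {κe κm : ℝ} (Λ : LorentzSection κe κm)
    {v : R2 × R16 → ℂ} (h₁ : ContDiff ℝ (⊤ : ℕ∞) v) (h₂ : HasCompactSupport v)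
    (w : FreeAlgebra ℂ (TestFn K 1)) (θ : Sig κe κm) :
    restrict θ (FreeAlgebra.lift ℂ (timesE Λ) w ⟨elem h₁ h₂ (unitB K),
        elem_mem_enlarged Λ h₁ h₂ _⟩ : AmbBorchers κe κm K) =
      VFib κe κm (Λ.toFun θ) (sliceV h₁ h₂ (θ : R16)) (moyalPoly K (θ : R16) w (unitB K)) := by
  have h1 := lift_intertwine (timesE Λ) (timesFib κe κm (Λ.toFun θ))
    ((restrict θ).comp (enlarged Λ K).subtype)
    (fun f g => restrict_times Λ f θ (g : AmbBorchers κe κm K)) w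
    ⟨elem h₁ h₂ (unitB K), elem_mem_enlarged Λ h₁ h₂ _⟩
  have h2 := lift_intertwine (fun f => moyal K (θ : R16) (emb f))
    (timesFib κe κm (Λ.toFun θ)) (VFib κe κm (Λ.toFun θ) (sliceV h₁ h₂ (θ : R16)))
    (fun f g => (timesFib_VFib (Λ.orbit θ) _ f g).symm) w (unitB K)
  refine h1.trans (Eq.trans ?_ h2.symm)
  rw [← restrict_elem_unitB h₁ h₂ (Λ.toFun θ) θ]
  rfl

/-! ### Polynomial relations at every value of `θ` -/

namespace FieldTheory

variable {K : ℕ} {H : Type*} [NormedAddCommGroup H] [InnerProductSpace ℂ H] [CompleteSpace H]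
  (T : FieldTheory K H) {κe κm : ℝ} (Λ : LorentzSection κe κm) (hκ : κe ≠ 0 ∨ κm ≠ 0)

/-- V preserves norms up to ‖v‖² ≠ 0, so it detects vanishing of Ψ(g). -/
theorem eq_zero_of_ae_PsiFib_VFib (M : Matrix (Fin 4) (Fin 4) ℝ) {v : 𝓢(R2, ℂ)}
    (hv : HasCompactSupport v) {s : R2} (hs : v s ≠ 0) {g : Borchers K}
    (h : ∀ᵐ s, T.PsiFib (VFib κe κm M v g) s = 0) : T.PsiB g = 0 := by
  have hz : (fun s => ⟪T.PsiFib (VFib κe κm M v g) s, T.PsiFib (VFib κe κm M v g) s⟫_ℂ)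
      =ᵐ[volume] fun _ => 0 := by
    filter_upwards [h] with s hs
    rw [hs, inner_zero_left]
  have hi := integral_congr_ae hz
  rw [integral_zero, T.integral_inner_VFib, mul_eq_zero] at hi
  exact inner_self_eq_zero.mp
    (hi.resolve_left (integral_conj_mul_self_ne_zero v.continuous hv hs))

/-- A polynomial relation between the fields `φ^⊗` holds for the fields deformed with any `θ`,
on the vacuum. -/
theorem PsiB_moyalPoly_unitB_eq_zero {w : FreeAlgebra ℂ (TestFn K 1)} (hw : T.poly Λ hκ w = 0)
    (θ : Sig κe κm) : T.PsiB (moyalPoly K (θ : R16) w (unitB K)) = 0 := by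
  have := isOpenPosMeasure_Sig hκ
  obtain ⟨v, hv, hv1⟩ := exists_cutoff ({(0, (θ : R16))} : Set (R2 × R16)) isCompact_singleton
  -- The weight v(0, θ') makes `F` continuous by the Schwartz family argument; it equals 1 at `θ`.
  -- Where it is nonzero, so is the slice of `v`, and the fibre argument applies.
  let F : Sig κe κm → H := fun θ' => T.PsiB (moyalPoly K (θ' : R16) w (v (0, (θ' : R16)) • unitB K))
  have hF : Continuous F := (T.continuous_PsiB_schwartzFam (moyalPoly_mem_schwartzFam w
    (smul_unitB_mem_schwartzFam (slice 0 v)))).comp continuous_subtype_val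
  have hsm : ContDiff ℝ (⊤ : ℕ∞) v := v.smooth ⊤
  have hae := T.ae_ae_eq_zero_of_PsiOtL_eq_zero Λ hκ (g := FreeAlgebra.lift ℂ (timesE Λ) w
    ⟨elem hsm hv (unitB K), elem_mem_enlarged Λ hsm hv _⟩) (by
      rw [lift_timesE_PsiOtL, hw, LinearMap.zero_apply])
  simp only [restrict_lift_timesE_elem_unitB Λ hsm hv] at hae
  have hF0 : F =ᵐ[(μHE[4] : Measure (Sig κe κm))] fun _ => 0 := by
    filter_upwards [hae] with θ' h
    by_cases h0 : v (0, (θ' : R16)) = 0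
    · simp [F, h0]
    have := T.eq_zero_of_ae_PsiFib_VFib (Λ.toFun θ') (v := sliceV hsm hv (θ' : R16))
      (hv.comp_isClosedEmbedding (Topology.IsClosedEmbedding.of_continuous_injective_isClosedMap
        (f := fun s : R2 => (s, (θ' : R16))) (by fun_prop) (fun _ _ h => congrArg Prod.fst h)
        (isClosedMap_prodMk_right (θ' : R16)))) (s := 0) h0 h
    simp only [F, map_smul, this, smul_zero]
  -- A continuous function that vanishes almost everywhere for a measure of full support vanishes
  -- identically.
  have := congrFun ((hF.ae_eq_iff_eq _ continuous_const).mp hF0) θ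
  simpa [F, hv1] using this

end FieldTheory

/-! ### The fields deformed with a fixed matrix -/

/-- Pairs l < r either have l equal to the first variable or lie among the remaining ones. -/
theorem twistExponent_add (θ : R16) (m : ℕ) (P : X (1 + m)) :
    twistExponent θ (1 + m) P =
      moyalExponent θ 1 m P + twistExponent θ m (split 1 m P).2 := by
  have h1 : ∀ (l : Fin 1) (r : Fin m), Fin.castAdd m l < Fin.natAdd 1 r := fun l r => by
    rw [Fin.lt_def]; simp
  have h2 : ∀ (l : Fin m) (r : Fin 1), ¬ Fin.natAdd 1 l < Fin.castAdd m r := fun l r => by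
    rw [Fin.lt_def]; simp
  have h3 : ∀ l r : Fin m, Fin.natAdd 1 l < Fin.natAdd 1 r ↔ l < r := fun l r => by
    simp
  have h4 : ∀ l r : Fin 1, ¬ Fin.castAdd m l < Fin.castAdd m r := fun l r => by
    rw [Subsingleton.elim l r]; exact lt_irrefl _
  simp only [twistExponent, Fin.sum_univ_add, h1, h2, h3, h4, if_true, if_false,
    Finset.sum_const_zero, zero_add, moyalExponent, split_snd]

theorem moyalN_twistedTprod {K m : ℕ} (θ : R16) (f : Fin (1 + m) → TestFn K 1) :
    moyalN θ (f (Fin.castAdd m 0)) (twistedTprod θ fun j => f (Fin.natAdd 1 j)) =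
      twistedTprod θ f := by
  funext k
  simp only [moyalN, twistedTprod, ContinuousLinearEquiv.apply_symm_apply]
  congr 1
  ext P
  simp only [mulPhase_apply, prodS_apply, tprodS_apply, Fin.prod_univ_add, twistExponent_add,
    Complex.ofReal_add, mul_add, Complex.exp_add, Finset.univ_unique, Finset.prod_singleton]
  have e1 : (fun j => k (Fin.castAdd m j)) = fun _ : Fin 1 => k (Fin.castAdd m default) :=
    funext fun j => by rw [Subsingleton.elim j default]
  have e2 : (split 1 m P).1 = pt P (Fin.castAdd m default) := by
    ext ⟨j, μ⟩
    rw [Subsingleton.elim j default]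
    rfl
  have e3 : ∀ j, pt (split 1 m P).2 j = pt P (Fin.natAdd 1 j) := fun j => rfl
  rw [e1, e2]
  simp only [e3, show (0 : Fin 1) = default from rfl]
  ring

theorem lof_zero_twistedTprod {K : ℕ} (θ : R16) (f : Fin 0 → TestFn K 1) :
    DirectSum.lof ℂ ℕ (TestFn K) 0 (twistedTprod θ f) = unitB K := by
  rw [unitB]
  congr 1
  funext k
  rw [twistedTprod, ContinuousLinearEquiv.symm_apply_eq, tprod, FT_tprodS]
  ext P
  rw [mulPhase_apply, tprodS_apply, tprodS_apply]
  simp [twistExponent]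

namespace FieldTheory

variable {K : ℕ} {H : Type*} [NormedAddCommGroup H] [InnerProductSpace ℂ H] (T : FieldTheory K H)

theorem range_PsiB : LinearMap.range T.PsiB = T.dom := by
  refine le_antisymm ?_ ?_
  · rintro _ ⟨g, rfl⟩
    induction g using DirectSum.induction_on with
    | zero => rw [map_zero]; exact T.dom.zero_mem
    | add g g' h h' => rw [map_add]; exact T.dom.add_mem h h'
    | of n g =>
      rw [← DirectSum.lof_eq_of ℂ, PsiB, DirectSum.toModule_lof]
      exact Submodule.subset_span (Set.mem_iUnion.mpr ⟨n, g, rfl⟩)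
  · refine Submodule.span_le.mpr (Set.iUnion_subset fun n => ?_)
    rintro _ ⟨g, rfl⟩
    exact ⟨DirectSum.lof ℂ ℕ (TestFn K) n g, by rw [PsiB, DirectSum.toModule_lof]; rfl⟩

/-- The map `Ψ` into the domain `𝒟`. -/
def PsiD : Borchers K →ₗ[ℂ] T.dom :=
  T.PsiB.codRestrict T.dom fun g => T.range_PsiB ▸ LinearMap.mem_range_self T.PsiB g

theorem coe_PsiD (g : Borchers K) : (T.PsiD g : H) = T.PsiB g := rfl

theorem PsiD_surjective : Function.Surjective T.PsiD := by
  rintro ⟨x, hx⟩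
  rw [← T.range_PsiB] at hx
  obtain ⟨g, rfl⟩ := hx
  exact ⟨g, rfl⟩

/-- The vacuum as a vector in `𝒟`. -/
def vacD : T.dom := T.vac

theorem PsiD_unitB : T.PsiD (unitB K) = T.vacD := Subtype.ext T.PsiB_unitB

variable [CompleteSpace H] {κe κm : ℝ} (Λ : LorentzSection κe κm) (hκ : κe ≠ 0 ∨ κm ≠ 0)
  (θ : Sig κe κm)

/-- The field operators deformed with `θ`, on `𝒟`. -/
def fieldD (f : TestFn K 1) : Module.End ℂ T.dom :=
  (exists_descend T.PsiD T.PsiD_surjective (moyal K (θ : R16) (emb f)) _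
    (T.inner_PsiB_moyal (Λ.orbit θ) f)).choose

theorem fieldD_PsiD (f : TestFn K 1) (g : Borchers K) :
    T.fieldD Λ θ f (T.PsiD g) = T.PsiD (moyal K (θ : R16) (emb f) g) :=
  (exists_descend T.PsiD T.PsiD_surjective (moyal K (θ : R16) (emb f)) _
    (T.inner_PsiB_moyal (Λ.orbit θ) f)).choose_spec g

theorem fieldD_adjoint (f : TestFn K 1) :
    IsFormalAdjoint (T.fieldD Λ θ f) (T.fieldD Λ θ (conjT T.bar f)) := by
  intro x y
  obtain ⟨g, rfl⟩ := T.PsiD_surjective x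
  obtain ⟨g', rfl⟩ := T.PsiD_surjective y
  rw [fieldD_PsiD, fieldD_PsiD, Submodule.coe_inner, Submodule.coe_inner]
  simp only [coe_PsiD]
  rw [T.inner_PsiB_moyal (Λ.orbit θ), conjT_conjT]

/-- Polynomials in the fields deformed with `θ`. -/
def polyD : FreeAlgebra ℂ (TestFn K 1) →ₐ[ℂ] Module.End ℂ T.dom :=
  FreeAlgebra.lift ℂ (T.fieldD Λ θ)

theorem polyD_PsiD (w : FreeAlgebra ℂ (TestFn K 1)) (g : Borchers K) :
    T.polyD Λ θ w (T.PsiD g) = T.PsiD (moyalPoly K (θ : R16) w g) :=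
  (lift_intertwine _ _ T.PsiD (fun f g => (T.fieldD_PsiD Λ θ f g).symm) w g).symm

theorem polyD_mem_closure (x : T.dom) : (fun w => (T.polyD Λ θ w x : H)) ∈
    closure (Set.range fun u w => (T.polyD Λ θ w (T.polyD Λ θ u T.vacD) : H)) := by
  obtain ⟨g, rfl⟩ := T.PsiD_surjective x
  have := T.orbit_mem_closure (θ : R16) g
  simp only [← PsiD_unitB, polyD_PsiD]
  exact this

/-- The component `w = 1` of strong cyclicity is cyclicity in the norm, and 𝒟 is dense. -/
theorem dense_polyD_vacD : Dense (Set.range fun u => (T.polyD Λ θ u T.vacD : H)) := by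
  refine dense_closure.mp (T.dense.mono fun x hx => ?_)
  have := map_mem_closure (continuous_apply (1 : FreeAlgebra ℂ (TestFn K 1)))
    (T.polyD_mem_closure Λ θ ⟨x, hx⟩)
    (t := Set.range fun u => (T.polyD Λ θ u T.vacD : H)) ?_
  · simpa using this
  · rintro _ ⟨u, rfl⟩
    exact ⟨u, by simp⟩

/-- If `w` vanishes in 𝒫^⊗, so does `w * u`, hence π(w) kills all π(u)Ω. For an unbounded operator
norm density of these vectors does not suffice, but it shows that the formal adjoint of π(w) is
orthogonal to a dense set. So the adjoint vanishes, and therefore π(w) does. -/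
theorem polyD_eq_zero {w : FreeAlgebra ℂ (TestFn K 1)} (hw : T.poly Λ hκ w = 0) :
    T.polyD Λ θ w = 0 := by
  obtain ⟨w', -, h⟩ := exists_adjoint_lift (T.field Λ hκ) (T.fieldD Λ θ) (conjT T.bar)
    (T.field_adjoint Λ hκ) (T.fieldD_adjoint Λ θ) w
  have h0 : T.polyD Λ θ w' = 0 := by
    refine LinearMap.ext fun x => Subtype.ext ?_
    refine (T.dense_polyD_vacD Λ θ).eq_zero_of_inner_right ℂ ?_
    rintro _ ⟨u, rfl⟩
    have e := h (T.polyD Λ θ u T.vacD) x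
    have e0 : T.polyD Λ θ w (T.polyD Λ θ u T.vacD) = 0 := by
      rw [← Module.End.mul_apply, ← map_mul, ← PsiD_unitB, polyD_PsiD]
      exact Subtype.ext (T.PsiB_moyalPoly_unitB_eq_zero Λ hκ (by rw [map_mul, hw, zero_mul]) θ)
    change ⟪T.polyD Λ θ w _, x⟫_ℂ = _ at e
    rw [e0, inner_zero_left] at e
    exact e.symm
  refine IsFormalAdjoint.unique (IsFormalAdjoint.symm h) (B' := 0) fun x y => ?_
  change ⟪T.polyD Λ θ w' x, y⟫_ℂ = _
  rw [h0]
  simp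

theorem exists_rep : ∃ π : T.polyAlgebra Λ →ₐ[ℂ] Module.End ℂ T.dom,
    ∀ (A : T.polyAlgebra Λ) w, (A : Module.End ℂ (T.domOt Λ)) = T.poly Λ hκ w →
      π A = T.polyD Λ θ w :=
  exists_algHom_of_range _ _ (fun _ => T.polyD_eq_zero Λ hκ θ) (T.polyAlgebra_eq_range Λ hκ)

/-- The representation `π^θ`. -/
def rep : T.polyAlgebra Λ →ₐ[ℂ] Module.End ℂ T.dom := (T.exists_rep Λ hκ θ).choose

theorem rep_eq {A : T.polyAlgebra Λ} {w : FreeAlgebra ℂ (TestFn K 1)}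
    (h : (A : Module.End ℂ (T.domOt Λ)) = T.poly Λ hκ w) : T.rep Λ hκ θ A = T.polyD Λ θ w :=
  (T.exists_rep Λ hκ θ).choose_spec A w h

theorem exists_poly_eq (A : T.polyAlgebra Λ) :
    ∃ w, (A : Module.End ℂ (T.domOt Λ)) = T.poly Λ hκ w := by
  obtain ⟨w, hw⟩ := (T.polyAlgebra_eq_range Λ hκ).le A.2
  exact ⟨w, hw.symm⟩

theorem poly_mem (w : FreeAlgebra ℂ (TestFn K 1)) : T.poly Λ hκ w ∈ T.polyAlgebra Λ := by
  rw [T.polyAlgebra_eq_range Λ hκ]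
  exact ⟨w, rfl⟩

theorem rep_field {f : TestFn K 1} {A : T.polyAlgebra Λ}
    (h : T.IsDeformedField Λ f (A : Module.End ℂ (T.domOt Λ))) :
    T.rep Λ hκ θ A = T.fieldD Λ θ f := by
  rw [T.rep_eq Λ hκ θ (w := FreeAlgebra.ι ℂ f), polyD, FreeAlgebra.lift_ι_apply]
  rw [(T.isDeformedField_iff Λ hκ).mp h, poly, FreeAlgebra.lift_ι_apply]

theorem isStarAlgebra_polyAlgebra (hκ : κe ≠ 0 ∨ κm ≠ 0) :
    IsStarAlgebra (T.polyAlgebra Λ) := by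
  intro A hA
  obtain ⟨w, rfl⟩ := T.exists_poly_eq Λ hκ ⟨A, hA⟩
  obtain ⟨w', h, -⟩ := exists_adjoint_lift (T.field Λ hκ) (T.field Λ hκ) (conjT T.bar)
    (T.field_adjoint Λ hκ) (T.field_adjoint Λ hκ) w
  exact ⟨_, T.poly_mem Λ hκ w', h⟩

theorem rep_star {A B : T.polyAlgebra Λ}
    (h : IsFormalAdjoint (A : Module.End ℂ (T.domOt Λ)) (B : Module.End ℂ (T.domOt Λ))) :
    IsFormalAdjoint (T.rep Λ hκ θ A) (T.rep Λ hκ θ B) := by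
  obtain ⟨w, hw⟩ := T.exists_poly_eq Λ hκ A
  obtain ⟨w', h1, h2⟩ := exists_adjoint_lift (T.field Λ hκ) (T.fieldD Λ θ) (conjT T.bar)
    (T.field_adjoint Λ hκ) (T.fieldD_adjoint Λ θ) w
  rw [T.rep_eq Λ hκ θ hw, T.rep_eq Λ hκ θ (w := w')]
  · exact h2
  -- Formal adjoints on the domain are unique, so `B` is the polynomial `w'`, for which the adjoint
  -- relation on 𝒟 is known.
  · rw [hw] at h
    exact h.unique h1

theorem rep_mem_closure (x : T.dom) : (fun A => (T.rep Λ hκ θ A x : H)) ∈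
    closure (Set.range fun B A => (T.rep Λ hκ θ A (T.rep Λ hκ θ B T.vacD) : H)) := by
  -- Choosing a polynomial for each operator turns functions on the free algebra into functions on
  -- 𝒫^⊗, continuously for the product topologies.
  choose c hc using T.exists_poly_eq Λ hκ
  have hr : Continuous fun (u : FreeAlgebra ℂ (TestFn K 1) → H) (A : T.polyAlgebra Λ) => u (c A) :=
    continuous_pi fun A => continuous_apply _
  have := map_mem_closure hr (T.polyD_mem_closure Λ θ x) (t := Set.range fun B A =>
    (T.rep Λ hκ θ A (T.rep Λ hκ θ B T.vacD) : H)) ?_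
  · simpa only [← T.rep_eq Λ hκ θ (hc _)] using this
  · rintro _ ⟨u, rfl⟩
    refine ⟨⟨_, T.poly_mem Λ hκ u⟩, ?_⟩
    funext A
    dsimp only
    rw [T.rep_eq Λ hκ θ (hc A), T.rep_eq Λ hκ θ (w := u) rfl]

theorem prod_fieldD_vacD : ∀ (n : ℕ) (f : Fin n → TestFn K 1),
    (List.ofFn fun j => T.fieldD Λ θ (f j)).prod T.vacD =
      T.PsiD (DirectSum.lof ℂ ℕ (TestFn K) n (twistedTprod (θ : R16) f)) := by
  intro n
  induction n with
  | zero =>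
    intro f
    rw [lof_zero_twistedTprod, PsiD_unitB]
    simp
  | succ m ih =>
    rw [add_comm]
    intro f
    rw [List.ofFn_add, List.prod_append, Module.End.mul_apply]
    erw [ih fun j => f (Fin.natAdd 1 j)]
    rw [← moyalN_twistedTprod, ← moyal_lof]
    simp only [List.ofFn_succ, List.ofFn_zero, List.prod_cons, List.prod_nil, mul_one, fieldD_PsiD]
    rfl

/-- The functional `A ↦ ⟨Ω, π^θ(A) Ω⟩`. -/
def omega : T.polyAlgebra Λ →ₗ[ℂ] ℂ :=
  (innerₛₗ ℂ T.vacD).comp ((LinearMap.applyₗ T.vacD).comp (T.rep Λ hκ θ).toLinearMap)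

theorem omega_apply (A : T.polyAlgebra Λ) :
    T.omega Λ hκ θ A = ⟪T.vacD, T.rep Λ hκ θ A T.vacD⟫_ℂ := rfl

theorem isOmegaTheta_omega : T.IsOmegaTheta Λ θ (T.omega Λ hκ θ) := by
  intro n f A hA
  have h : T.rep Λ hκ θ (List.ofFn A).prod = (List.ofFn fun j => T.fieldD Λ θ (f j)).prod := by
    rw [map_list_prod, List.map_ofFn]
    congr 2
    funext j
    exact T.rep_field Λ hκ θ (hA j)
  rw [omega_apply, h, prod_fieldD_vacD, npoint, Submodule.coe_inner, coe_PsiD, PsiB,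
    DirectSum.toModule_lof]
  rfl

/-- 𝒫^⊗ is the linear span of monomials in the fields, and on those the value is prescribed. -/
theorem IsOmegaTheta.unique {ω ω' : T.polyAlgebra Λ →ₗ[ℂ] ℂ} (h : T.IsOmegaTheta Λ θ ω)
    (h' : T.IsOmegaTheta Λ θ ω') : ω = ω' := by
  have hle : Subalgebra.toSubmodule (T.polyAlgebra Λ) ≤
      (LinearMap.eqLocus ω ω').map (T.polyAlgebra Λ).val.toLinearMap := by
    refine (Algebra.adjoin_eq_span (R := ℂ) _).le.trans (Submodule.span_le.mpr fun A hA => ?_)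
    obtain ⟨l, hl, rfl⟩ := Submonoid.exists_list_of_mem_closure hA
    choose f hf using fun j : Fin l.length => hl (l.get j) (l.get_mem j)
    let B : Fin l.length → T.polyAlgebra Λ := fun j =>
      ⟨l.get j, Algebra.subset_adjoin ⟨f j, hf j⟩⟩
    refine ⟨(List.ofFn B).prod, ?_, ?_⟩
    · exact (h _ f B hf).trans (h' _ f B hf).symm
    · change (T.polyAlgebra Λ).val (List.ofFn B).prod = _
      rw [map_list_prod, List.map_ofFn]
      congr 1
      exact List.ofFn_get l
  refine LinearMap.ext fun A => ?_
  obtain ⟨B, hB, e⟩ := hle A.2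
  rwa [← Subtype.ext (a1 := B) (a2 := A) e]

end FieldTheory

/-! ### Uniqueness of the GNS data -/

namespace GNSData

variable {E : Type*} [NormedAddCommGroup E] [InnerProductSpace ℂ E]
  {𝒜 : Subalgebra ℂ (Module.End ℂ E)} {ω : 𝒜 →ₗ[ℂ] ℂ}
  {H : Type*} [NormedAddCommGroup H] [InnerProductSpace ℂ H]
  {H' : Type*} [NormedAddCommGroup H'] [InnerProductSpace ℂ H']

/-- The map `A ↦ π(A) Ω`. -/
def cyc (G : GNSData 𝒜 ω H) : 𝒜 →ₗ[ℂ] H :=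
  G.dom.subtype.comp ((LinearMap.applyₗ G.vac).comp G.π.toLinearMap)

theorem cyc_apply (G : GNSData 𝒜 ω H) (A : 𝒜) : G.cyc A = G.π A G.vac := rfl

theorem denseRange_cyc (G : GNSData 𝒜 ω H) : DenseRange G.cyc := by
  refine dense_closure.mp (G.dense.mono fun x hx => ?_)
  have := map_mem_closure (continuous_apply (1 : 𝒜)) (G.cyclic ⟨x, hx⟩)
    (t := Set.range G.cyc) ?_
  · simpa using this
  · rintro _ ⟨B, rfl⟩
    exact ⟨B, by simp [cyc_apply]⟩

/-- Both squared norms equal ω(A* A), so the state determines the geometry of the cyclic vectors. -/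
theorem norm_cyc (h𝒜 : IsStarAlgebra 𝒜) (G : GNSData 𝒜 ω H) (G' : GNSData 𝒜 ω H') (A : 𝒜) :
    ‖G.cyc A‖ = ‖G'.cyc A‖ := by
  obtain ⟨B, hB, h⟩ := h𝒜 A A.2
  have h1 : ⟪G.cyc A, G.cyc A⟫_ℂ = ω (⟨B, hB⟩ * A) := by
    rw [G.implements, map_mul, Module.End.mul_apply]
    exact G.star A ⟨B, hB⟩ h G.vac (G.π A G.vac)
  have h2 : ⟪G'.cyc A, G'.cyc A⟫_ℂ = ω (⟨B, hB⟩ * A) := by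
    rw [G'.implements, map_mul, Module.End.mul_apply]
    exact G'.star A ⟨B, hB⟩ h G'.vac (G'.π A G'.vac)
  rw [norm_eq_sqrt_re_inner (𝕜 := ℂ), norm_eq_sqrt_re_inner (𝕜 := ℂ), h1, h2]

/-- Strong cyclicity says that the orbit of the vacuum already exhausts the closure of the
representation, which is thereby expressed through `cyc` alone. -/
theorem closedOrbits_eq (G : GNSData 𝒜 ω H) :
    G.closedOrbits = closure (Set.range fun B A => G.cyc (A * B)) := by
  have e : (fun (B A : 𝒜) => G.cyc (A * B)) = fun B A => (G.π A (G.π B G.vac) : H) := by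
    funext B A
    rw [cyc_apply, map_mul, Module.End.mul_apply]
  rw [e]
  refine subset_antisymm (closure_minimal ?_ isClosed_closure) (closure_mono ?_)
  · rintro _ ⟨x, rfl⟩
    exact G.cyclic x
  · rintro _ ⟨B, rfl⟩
    exact ⟨G.π B G.vac, rfl⟩

/-- GNS data are unique up to unitary equivalence. -/
theorem unitarilyEquivalent [CompleteSpace H] [CompleteSpace H'] (h𝒜 : IsStarAlgebra 𝒜)
    (G : GNSData 𝒜 ω H) (G' : GNSData 𝒜 ω H') : G.UnitarilyEquivalent G' := by
  let V : H ≃ₗᵢ[ℂ] H' := (LinearEquiv.refl ℂ 𝒜).extendOfIsometry G.cyc G'.cyc G.denseRange_cyc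
    G'.denseRange_cyc fun A => (G.norm_cyc h𝒜 G' A).symm
  have hV : ∀ A, V (G.cyc A) = G'.cyc A := fun A => LinearEquiv.extendOfIsometry_eq ..
  refine ⟨V, by simpa [cyc_apply] using hV 1, hV, fun x => ?_⟩
  -- Applying `V` in each coordinate is a homeomorphism for the graph topologies and matches the two
  -- orbits of the vacuum, so it carries one closure, domain included, onto the other.
  let Φ : (𝒜 → H) ≃ₜ (𝒜 → H') := Homeomorph.piCongrRight fun _ => V.toHomeomorph
  have hΦ : Φ '' G.closedOrbits = G'.closedOrbits := by
    rw [closedOrbits_eq, closedOrbits_eq, Φ.image_closure, ← Set.range_comp]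
    congr 2
    funext B A
    exact hV _
  rw [← hΦ]
  exact (Φ.injective.mem_set_image (a := x)).symm

end GNSData

/-! ### Positivity of the state and its GNS data -/

namespace FieldTheory

variable {K : ℕ} {H : Type*} [NormedAddCommGroup H] [InnerProductSpace ℂ H] [CompleteSpace H]
  (T : FieldTheory K H) {κe κm : ℝ} (Λ : LorentzSection κe κm) (hκ : κe ≠ 0 ∨ κm ≠ 0)
  (θ : Sig κe κm)

theorem isState_omega : IsState (T.polyAlgebra Λ) (T.omega Λ hκ θ) := by
  refine ⟨?_, fun A B h => ?_⟩
  · rw [omega_apply, map_one]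
    change ⟪(T.vac : H), (T.vac : H)⟫_ℂ = 1
    rw [inner_self_eq_norm_sq_to_K, Submodule.norm_coe, T.norm_vac]
    simp
  · have e : T.omega Λ hκ θ (B * A) =
        ⟪T.rep Λ hκ θ A T.vacD, T.rep Λ hκ θ A T.vacD⟫_ℂ := by
      rw [omega_apply, map_mul, Module.End.mul_apply]
      exact (T.rep_star Λ hκ θ h T.vacD (T.rep Λ hκ θ A T.vacD)).symm
    rw [e]
    exact ⟨inner_self_nonneg (𝕜 := ℂ), inner_self_im (𝕜 := ℂ) (T.rep Λ hκ θ A T.vacD)⟩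

/-- The GNS data of `ω^θ`. -/
def gns : GNSData (T.polyAlgebra Λ) (T.omega Λ hκ θ) H where
  dom := T.dom
  dense := T.dense
  π := T.rep Λ hκ θ
  star _ _ h := T.rep_star Λ hκ θ h
  vac := T.vacD
  implements _ := rfl
  cyclic := T.rep_mem_closure Λ hκ θ

theorem gns_field {f : TestFn K 1} {A : T.polyAlgebra Λ}
    (h : T.IsDeformedField Λ f (A : Module.End ℂ (T.domOt Λ))) {g : Borchers K} {x : T.dom}
    (hx : (x : H) = T.PsiB g) :
    (T.rep Λ hκ θ A x : H) = T.PsiB (moyal K (θ : R16) (emb f) g) := by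
  have : x = T.PsiD g := Subtype.ext hx
  rw [this, T.rep_field Λ hκ θ h, fieldD_PsiD, coe_PsiD]

end FieldTheory

end WeylWigner

end

theorem mainTheorem2 {K : ℕ} {H : Type*} [NormedAddCommGroup H] [InnerProductSpace ℂ H]
    [CompleteSpace H] (T : FieldTheory K H) (κe κm : ℝ) (hκ : κe ≠ 0 ∨ κm ≠ 0)
    (Λ : LorentzSection κe κm) (θ : Sig κe κm) :
    (∀ g ∈ enlarged Λ K, MemLp (T.PsiOt g) 2 (vMeasure κe κm)) ∧
    (∀ f, ∃! A, T.IsDeformedField Λ f A) ∧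
    (∀ f A B, T.IsDeformedField Λ f A → T.IsDeformedField Λ (conjT T.bar f) B →
      IsFormalAdjoint A B) ∧
    IsStarAlgebra (T.polyAlgebra Λ) ∧
    (∃! ω, T.IsOmegaTheta Λ θ ω) ∧
    ∀ ω, T.IsOmegaTheta Λ θ ω →
      IsState (T.polyAlgebra Λ) ω ∧
      ∃ G : GNSData (T.polyAlgebra Λ) ω H,
        G.dom = T.dom ∧ (G.vac : H) = T.vac ∧
        (∀ (f : TestFn K 1) (A : T.polyAlgebra Λ),
          T.IsDeformedField Λ f (A : Module.End ℂ (T.domOt Λ)) →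
            ∀ (g : Borchers K) (x : G.dom), (x : H) = T.PsiB g →
              (G.π A x : H) = T.PsiB (moyal K (θ : R16) (emb f) g)) ∧
        ∀ (H' : Type*) [NormedAddCommGroup H'] [InnerProductSpace ℂ H'] [CompleteSpace H']
          (G' : GNSData (T.polyAlgebra Λ) ω H'), G'.UnitarilyEquivalent G := by
  have hstar := T.isStarAlgebra_polyAlgebra Λ hκ
  refine ⟨fun g hg => T.memLp_PsiOt Λ hκ hg,
    fun f => ⟨T.field Λ hκ f, (T.isDeformedField_iff Λ hκ).mpr rfl,
      fun A hA => (T.isDeformedField_iff Λ hκ).mp hA⟩,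
    fun f A B hA hB => ?_, hstar,
    ⟨T.omega Λ hκ θ, T.isOmegaTheta_omega Λ hκ θ,
      fun ω hω => FieldTheory.IsOmegaTheta.unique T Λ θ hω (T.isOmegaTheta_omega Λ hκ θ)⟩,
    fun ω hω => ?_⟩
  · rw [(T.isDeformedField_iff Λ hκ).mp hA, (T.isDeformedField_iff Λ hκ).mp hB]
    exact T.field_adjoint Λ hκ f
  · obtain rfl := FieldTheory.IsOmegaTheta.unique T Λ θ hω (T.isOmegaTheta_omega Λ hκ θ)
    exact ⟨T.isState_omega Λ hκ θ, T.gns Λ hκ θ, rfl, rfl,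
      fun f A hA g x hx => T.gns_field Λ hκ θ hA hx,
      fun H' _ _ _ G' => G'.unitarilyEquivalent hstar _⟩
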